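/- Let $0<\alpha<1$ and let $E_1>E_2>\cdots$ be the points, in decreasing order, of a Poisson point process on $\mathbb R$ with intensity measure $\alpha e^{-\alpha E}\,dE$ (the energy landscape $\underline E$). For a threshold $E\in\mathbb R$ let $N_E$ be the number of $i$ with $E_i\ge E$; for a time unit $\tau_0>0$ put $x_i:=\tau_0e^{-E_i}$. Given $\underline E$, $\tau_0$ and $E$, let $Y_E$ be the continuous-time random walk on $\{1,\dots,N_E\}$ with uniform initial distribution which, on arriving at a site $i$, waits an exponential time of mean $\frac{N_E}{N_E-1}\,x_i^{-1}$ and then jumps to a site chosen uniformly among the other $N_E-1$ sites, and let $$\Pi_E(t,t_w):=\mathbb P_E\bigl(Y_E(s)=Y_E(t_w)\ \ \forall s\in[t_w,t_w+t]\bigr),$$ where $\mathbb P_E$ is the law of $Y_E$ for the fixed landscape. Let $\gamma_\infty$ be the infinite path oriented from $\infty+i$ to $\infty-i$ with support $\{x\pm i: x\ge -1\}\cup\{-1+bi: |b|\le 1\}$. For almost every energy landscape $\underline E$ the following holds for all $t,t_w>0$. (i) For every $\tau_0>0$, $$\lim_{E\to-\infty}\Pi_E(t,t_w)=\frac1{2\pi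 i}\int_{\gamma_\infty}\frac{e^{-t_w\lambda}}{\lambda}\;\frac{\tau_0^\alpha\sum_{j=1}^\infty \frac{e^{-x_jt}}{x_j-\lambda}}{\tau_0^\alpha\sum_{j=1}^\infty\frac{1}{x_j-\lambda}}\,d\lambda ,$$ where both series converge absolutely and the denominator does not vanish for every $\lambda\in\gamma_\infty$, and the integral converges absolutely. (ii) With $\theta=t/t_w$, $$\lim_{\tau_0\downarrow0}\ \lim_{E\to-\infty}\Pi_E(t,t_w)=\frac{\sin(\pi\alpha)}{\pi}\int_{\frac{\theta}{1+\theta}}^1u^{-\alpha}(1-u)^{\alpha-1}\,du .$$ -/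

import Mathlib

open MeasureTheory ProbabilityTheory Filter Topology Set

/-! ### Poisson point processes and the energy landscape -/

/-- A random measure `ξ` on `S`, defined on the probability space `(Ω, P)`, is a Poisson point
process with intensity measure `Λ`: the mass of a measurable set `B` with `Λ B < ∞` has the
Poisson law with parameter `Λ B`, and the masses of pairwise disjoint measurable sets are
independent. -/
structure IsPoissonPointProcess {Ω S : Type*} [MeasurableSpace Ω] [MeasurableSpace S]
    (P : Measure Ω) (Λ : Measure S) (ξ : Ω → Measure S) : Prop where
  hasLaw : ∀ B : Set S, MeasurableSet B → Λ B ≠ ⊤ →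
    HasLaw (fun ω => ξ ω B)
      ((poissonMeasure (Λ B).toNNReal).map (Nat.cast : ℕ → ENNReal)) P
  indep : ∀ (k : ℕ) (B : Fin k → Set S), (∀ i, MeasurableSet (B i)) →
    Pairwise (fun i j => Disjoint (B i) (B j)) → iIndepFun (fun i ω => ξ ω (B i)) P

/-- The measure `α e^{-α E} dE` on `ℝ`. -/
noncomputable def landscapeIntensity (α : ℝ) : Measure ℝ :=
  volume.withDensity (fun e => ENNReal.ofReal (α * Real.exp (-α * e)))

/-- `(E_0 > E_1 > ...)` is the decreasing enumeration of the points of a Poisson point process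
on `ℝ` with intensity measure `α e^{-α E} dE`. -/
structure IsEnergyLandscape {Ω : Type*} [MeasurableSpace Ω] (P : Measure Ω) (α : ℝ)
    (energy : ℕ → Ω → ℝ) : Prop where
  measurable : ∀ j, Measurable (energy j)
  decreasing : ∀ᵐ ω ∂P, StrictAnti (fun j => energy j ω)
  poisson : IsPoissonPointProcess P (landscapeIntensity α)
    (fun ω => Measure.sum (fun j => Measure.dirac (energy j ω)))

/-! ### The random walk on the complete graph with `n + 2` sites -/

/-- The randomness driving the walk: the starting site, the choices made at the successive jumps
(one of the `n + 1` other sites each time), and standard exponential clocks. -/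
abbrev WalkSpace (n : ℕ) : Type := Fin (n + 2) × (ℕ → Fin (n + 1)) × (ℕ → ℝ)

/-- Uniform starting site, uniform jump choices, exponential clocks of mean `1`, all
independent. -/
noncomputable def walkMeasure (n : ℕ) : Measure (WalkSpace n) :=
  (PMF.uniformOfFintype (Fin (n + 2))).toMeasure.prod
    ((Measure.infinitePi (fun _ : ℕ => (PMF.uniformOfFintype (Fin (n + 1))).toMeasure)).prod
      (Measure.infinitePi (fun _ : ℕ => expMeasure 1)))

/-- The successive sites visited by the walk. The map `i.succAbove` is a bijection from
`Fin (n + 1)` onto the sites different from `i`, so that every jump leads to a site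
chosen uniformly among the sites different from the present one. -/
def jumpChain {n : ℕ} (w : WalkSpace n) : ℕ → Fin (n + 2)
  | 0 => w.1
  | k + 1 => (jumpChain w k).succAbove (w.2.1 k)

/-- The time spent by the walk at the `k`-th visited site `i`: an exponential time of mean
`(N / (N - 1)) / x_i`, where `N = n + 2` is the number of sites. -/
noncomputable def holdingTime {n : ℕ} (x : ℕ → ℝ) (w : WalkSpace n) (k : ℕ) : ℝ :=
  ((n + 2 : ℝ) / (n + 1 : ℝ)) / x (jumpChain w k) * w.2.2 k

/-- The site occupied at time `s`: the `k`-th visited site, for the first `k` such that the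
`(k + 1)`-st jump has not happened by time `s`. -/
noncomputable def walkPosition {n : ℕ} (x : ℕ → ℝ) (w : WalkSpace n) (s : ℝ) : Fin (n + 2) :=
  jumpChain w (sInf {k : ℕ | s < ∑ i ∈ Finset.range (k + 1), holdingTime x w i})

/-- The probability that the walk on `N` sites does not move during `[t_w, t_w + t]`.
On one site the walk never moves; the value `0` for `N = 0` is a convention. -/
noncomputable def walkCorrelation : (N : ℕ) → (x : ℕ → ℝ) → (t tw : ℝ) → ℝ
  | 0, _, _, _ => 0
  | 1, _, _, _ => 1
  | n + 2, x, t, tw => (walkMeasure n).real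
      {w | ∀ s ∈ Icc tw (tw + t), walkPosition x w s = walkPosition x w tw}

/-! ### The model on the Poisson point process -/

/-- `N_E`, the number of energies that are at least `E`. -/
noncomputable def numSites (e : ℕ → ℝ) (E : ℝ) : ℕ := {j : ℕ | E ≤ e j}.ncard

/-- `x_j = τ₀ e^{-E_j}`. -/
noncomputable def trapRate (e : ℕ → ℝ) (τ₀ : ℝ) (j : ℕ) : ℝ := τ₀ * Real.exp (-e j)

/-- The time-time correlation function `Π_E(t, t_w)` with time unit `τ₀` in the energy
landscape `e`. -/
noncomputable def trapCorrelation (e : ℕ → ℝ) (τ₀ E t tw : ℝ) : ℝ :=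
  walkCorrelation (numSites e E) (trapRate e τ₀) t tw

/-! ### The infinite contour -/

/-- The support of the contour `γ_∞`. -/
def gammaInf : Set ℂ :=
  {z | (-1 ≤ z.re ∧ (z.im = 1 ∨ z.im = -1)) ∨ (z.re = -1 ∧ |z.im| ≤ 1)}

/-- Absolute integrability of `f` along the contour `γ_∞`. -/
def IntegrableOnGammaInf (f : ℂ → ℂ) : Prop :=
  IntegrableOn (fun a : ℝ => f (a + Complex.I)) (Ioi (-1)) ∧
  IntegrableOn (fun b : ℝ => f (-1 + b * Complex.I)) (Icc (-1) 1) ∧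
  IntegrableOn (fun a : ℝ => f (a - Complex.I)) (Ioi (-1))

/-- The integral of `f` along `γ_∞`, oriented from `∞ + i` via `-1 + i` and `-1 - i`
to `∞ - i`. -/
noncomputable def integralGammaInf (f : ℂ → ℂ) : ℂ :=
  -(∫ a in Ioi (-1 : ℝ), f (a + Complex.I))
    - Complex.I * (∫ b in (-1 : ℝ)..1, f (-1 + b * Complex.I))
    + ∫ a in Ioi (-1 : ℝ), f (a - Complex.I)

/-- The integrand
`(e^{-t_w z} / z) (τ₀^α ∑_j e^{-x_j t} / (x_j - z)) / (τ₀^α ∑_j 1 / (x_j - z))`. -/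
noncomputable def limitIntegrand (α τ₀ : ℝ) (x : ℕ → ℝ) (t tw : ℝ) (z : ℂ) : ℂ :=
  Complex.exp (-tw * z) / z *
    ((((τ₀ ^ α : ℝ) : ℂ) * ∑' j, Complex.exp (-(x j) * t) / (x j - z)) /
      (((τ₀ ^ α : ℝ) : ℂ) * ∑' j, 1 / (x j - z)))

/-- The ageing function `θ ↦ (sin (π α) / π) ∫_{θ/(1+θ)}^1 u^{-α} (1-u)^{α-1} du`. -/
noncomputable def ageingFunction (α θ : ℝ) : ℝ :=
  Real.sin (Real.pi * α) / Real.pi *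
    ∫ u in (θ / (1 + θ))..1, u ^ (-α) * (1 - u) ^ (α - 1)

/-!
The proof avoids solving for the law of the walk. Summing over the visited sites, the Laplace
transform in `t_w` of `Π_E(t, t_w)` is, with `N` sites and `c_i = e^{-x_i t (N - 1) / N}`,
`s⁻¹ (∑ c_i / (x_i + s)) / (∑ 1 / (x_i + s))` (`integral_exp_mul_walkCorrelation`). Since the
probability of rest is monotone in the interval `[t_w, t_w + t]`, a Tauberian theorem
(`tendsto_of_laplace_of_isNested`) recovers pointwise values from Laplace transforms: convergence at
the positive integers is convergence of all moments in the variable `e^{-v}`, and monotonicity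
squeezes the value at a point between local averages.

For finite `N` the spectral theorem expands the transform into partial fractions with poles on
`[0, ∞)` (`exists_partialFractions`). The residue theorem for one pole inside the contour then turns
`Π_E` into a contour integral (`walkCorrelation_eq_integralGammaInf`). On the contour the denominator
`∑ 1 / (x_i - z)` has a lower bound independent of `N`, because its terms do not cancel, so that
dominated convergence gives part (i) as soon as `∑ 1 / x_i < ∞` (`tendsto_walkCorrelation`).

Part (ii) needs no contour. The Laplace transform of the limit is again explicit, and a Poisson
variable has variance equal to its mean, so that by the Borel-Cantelli argument the number of
`e^{-E_j}` up to `r` is almost surely asymptotic to `r ^ α` (`ae_hasPowerCount`). An Abelian theorem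
shows that the numerator and the denominator, multiplied by `τ₀ ^ α`, converge as `τ₀ ↓ 0` to
`Γ(α + 1) ∫ e^{-s w} (t + w)^{-α} dw` and its value at `t = 0`. The resulting quotient is the Laplace
transform of the ageing function, which is a convolution of `u^{α - 1}` and `(t + u)^{-α}`, and the
Tauberian theorem applies once more (`HasPowerCount.tendsto_limitCorrelation_smul`).
-/

/-! ### Resampling one coordinate, and exponential clocks -/

/-- Replacing the `k`-th coordinate by an independent copy does not change an infinite product
measure. -/
theorem measurePreserving_update_infinitePi {S : Type*} [MeasurableSpace S] (μ : Measure S)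
    [IsProbabilityMeasure μ] (k : ℕ) :
    MeasurePreserving (fun p : (ℕ → S) × S => Function.update p.1 k p.2)
      ((Measure.infinitePi (fun _ : ℕ => μ)).prod μ) (Measure.infinitePi (fun _ : ℕ => μ)) := by
  have hm : Measurable (fun p : (ℕ → S) × S => Function.update p.1 k p.2) := by
    rw [measurable_pi_iff]
    intro j
    by_cases h : j = k
    · subst h; simpa using measurable_snd
    · simpa [Function.update_of_ne h] using! (measurable_pi_apply j).comp measurable_fst
  refine ⟨hm, Measure.eq_infinitePi _ fun s t ht => ?_⟩
  rw [Measure.map_apply hm (MeasurableSet.pi s.countable_toSet fun i _ => ht i)]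
  by_cases hk : k ∈ s
  · have : (fun p : (ℕ → S) × S => Function.update p.1 k p.2) ⁻¹' (Set.pi s t)
        = (Set.pi (s.erase k) t) ×ˢ (t k) := by
      ext p
      simp only [mem_preimage, Set.mem_pi, Finset.mem_coe, Finset.coe_erase, mem_prod, Set.mem_sdiff,
        mem_singleton_iff]
      constructor
      · intro h
        refine ⟨fun i hi => ?_, ?_⟩
        · simpa [Function.update_of_ne hi.2] using h i hi.1
        · simpa using h k hk
      · rintro ⟨h1, h2⟩ i hi
        by_cases hik : i = k
        · subst hik; simpa using h2
        · simpa [Function.update_of_ne hik] using h1 i ⟨hi, hik⟩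
    rw [this, Measure.prod_prod, Measure.infinitePi_pi _ (fun i _ => ht i),
      Finset.prod_erase_mul s _ hk]
  · have : (fun p : (ℕ → S) × S => Function.update p.1 k p.2) ⁻¹' (Set.pi s t)
        = (Set.pi s t) ×ˢ univ := by
      ext p
      simp only [mem_preimage, Set.mem_pi, Finset.mem_coe, mem_prod, mem_univ, and_true]
      refine forall₂_congr fun i hi => ?_
      rw [Function.update_of_ne (fun h => hk (by rw [← h]; exact hi))]
    rw [this, Measure.prod_prod, Measure.infinitePi_pi _ (fun i _ => ht i), measure_univ, mul_one]

theorem lintegral_infinitePi_eq_lintegral_update {S : Type*} [MeasurableSpace S] (μ : Measure S)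
    [IsProbabilityMeasure μ] (k : ℕ) {f : (ℕ → S) → ENNReal} (hf : Measurable f) :
    ∫⁻ η, f η ∂(Measure.infinitePi (fun _ : ℕ => μ))
      = ∫⁻ η, ∫⁻ y, f (Function.update η k y) ∂μ ∂(Measure.infinitePi (fun _ : ℕ => μ)) := by
  have h := measurePreserving_update_infinitePi μ k
  rw [← h.lintegral_comp hf]
  exact lintegral_prod _ (hf.comp h.measurable).aemeasurable

instance : IsProbabilityMeasure (expMeasure 1) := isProbabilityMeasure_expMeasure one_pos

instance (n : ℕ) : IsProbabilityMeasure (walkMeasure n) := by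
  unfold walkMeasure; infer_instance

/-- The jump choice and the clock of index `k` may be resampled. Since the walk up to its `k`-th jump
does not depend on them, this replaces the Markov property. -/
theorem lintegral_walkMeasure_eq_lintegral_update {n : ℕ} (k : ℕ) {f : WalkSpace n → ENNReal}
    (hf : Measurable f) :
    ∫⁻ w, f w ∂(walkMeasure n)
      = ∫⁻ w, ∫⁻ z, ∫⁻ y, f (w.1, Function.update w.2.1 k z, Function.update w.2.2 k y)
          ∂(expMeasure 1) ∂(PMF.uniformOfFintype (Fin (n + 1))).toMeasure ∂(walkMeasure n) := by
  set ν := (PMF.uniformOfFintype (Fin (n + 1))).toMeasure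
  have h1 := measurePreserving_update_infinitePi ν k
  have h2 := measurePreserving_update_infinitePi (expMeasure 1) k
  have e1 := h1.measurable
  have e2 := h2.measurable
  unfold walkMeasure
  have hm : Measurable (fun w : WalkSpace n => ∫⁻ z, ∫⁻ y, f (w.1, Function.update w.2.1 k z,
      Function.update w.2.2 k y) ∂(expMeasure 1) ∂ν) := by
    refine Measurable.lintegral_prod_right' (f := fun p : WalkSpace n × Fin (n + 1) => ∫⁻ y, f (p.1.1,
      Function.update p.1.2.1 k p.2, Function.update p.1.2.2 k y) ∂(expMeasure 1)) ?_
    refine Measurable.lintegral_prod_right' (f := fun p : (WalkSpace n × Fin (n + 1)) × ℝ =>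
      f (p.1.1.1, Function.update p.1.1.2.1 k p.1.2, Function.update p.1.1.2.2 k p.2)) ?_
    refine hf.comp (Measurable.prodMk (by fun_prop) (Measurable.prodMk ?_ ?_))
    · exact e1.comp (f := fun p : (WalkSpace n × Fin (n + 1)) × ℝ => (p.1.1.2.1, p.1.2)) (by fun_prop)
    · exact e2.comp (f := fun p : (WalkSpace n × Fin (n + 1)) × ℝ => (p.1.1.2.2, p.2)) (by fun_prop)
  rw [lintegral_prod _ hf.aemeasurable, lintegral_prod _ hm.aemeasurable]
  refine lintegral_congr fun a => ?_
  have hfa : Measurable fun q : (ℕ → Fin (n + 1)) × (ℕ → ℝ) => f (a, q) := by fun_prop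
  have hma : Measurable fun q : (ℕ → Fin (n + 1)) × (ℕ → ℝ) =>
    ∫⁻ z, ∫⁻ y, f (a, Function.update q.1 k z, Function.update q.2 k y) ∂(expMeasure 1) ∂ν :=
    hm.comp (f := fun q : (ℕ → Fin (n + 1)) × (ℕ → ℝ) => ((a, q) : WalkSpace n)) (by fun_prop)
  rw [lintegral_prod _ hfa.aemeasurable, lintegral_prod _ hma.aemeasurable]
  have hz : Measurable fun ξ : ℕ → Fin (n + 1) =>
      ∫⁻ η, f (a, ξ, η) ∂(Measure.infinitePi fun _ : ℕ => expMeasure 1) :=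
    Measurable.lintegral_prod_right hfa
  rw [lintegral_infinitePi_eq_lintegral_update ν k hz]
  refine lintegral_congr fun ξ => ?_
  have hy (z) : Measurable fun η : ℕ → ℝ => f (a, Function.update ξ k z, η) := by fun_prop
  rw [lintegral_congr fun z => lintegral_infinitePi_eq_lintegral_update (expMeasure 1) k (hy z),
    lintegral_lintegral_swap]
  · refine Measurable.aemeasurable ?_
    refine Measurable.lintegral_prod_right' (f := fun p : (Fin (n + 1) × (ℕ → ℝ)) × ℝ =>
      f (a, Function.update ξ k p.1.1, Function.update p.1.2 k p.2)) ?_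
    refine hf.comp (Measurable.prodMk (by fun_prop) (Measurable.prodMk ?_ ?_))
    · exact e1.comp (f := fun p : (Fin (n + 1) × (ℕ → ℝ)) × ℝ => (ξ, p.1.1)) (by fun_prop)
    · exact e2.comp (f := fun p : (Fin (n + 1) × (ℕ → ℝ)) × ℝ => (p.1.2, p.2)) (by fun_prop)

theorem measure_expMeasure_Ioi {a : ℝ} (ha : 0 ≤ a) :
    expMeasure 1 (Ioi a) = ENNReal.ofReal (Real.exp (-a)) := by
  have h := cdf_expMeasure_eq one_pos a
  rw [cdf_eq_real, if_pos ha] at h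
  have h2 : (expMeasure 1).real (Ioi a) = Real.exp (-a) := by
    rw [← compl_Iic, probReal_compl_eq_one_sub measurableSet_Iic, h]; simp
  rw [← h2, ofReal_measureReal]

theorem ae_expMeasure_pos : ∀ᵐ y ∂(expMeasure 1), 0 < y := by
  rw [ae_iff]
  have : {a : ℝ | ¬ 0 < a} = (Ioi 0)ᶜ := by ext; simp
  rw [this, prob_compl_eq_zero_iff measurableSet_Ioi, measure_expMeasure_Ioi le_rfl]
  simp

theorem lintegral_exp_neg_mul_Ioi {r : ℝ} (hr : 0 < r) (a : ℝ) :
    ∫⁻ v in Ioi a, ENNReal.ofReal (Real.exp (-r * v)) = ENNReal.ofReal (Real.exp (-r * a) / r) := by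
  rw [← ofReal_integral_eq_lintegral_ofReal (integrableOn_exp_mul_Ioi (by linarith) a)
    (ae_of_all _ fun _ => (Real.exp_pos _).le), integral_exp_mul_Ioi (by linarith)]
  congr 1
  field_simp

theorem lintegral_expMeasure_exp {p : ℝ} (hp : 0 ≤ p) :
    ∫⁻ y, ENNReal.ofReal (Real.exp (-p * y)) ∂(expMeasure 1) = ENNReal.ofReal (1 / (1 + p)) := by
  have : expMeasure 1 = (volume.restrict (Ioi 0)).withDensity
      (fun y => ENNReal.ofReal (Real.exp (-y))) := by
    rw [expMeasure, gammaMeasure, ← withDensity_indicator measurableSet_Ioi]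
    refine withDensity_congr_ae ?_
    filter_upwards [Measure.ae_ne volume 0] with y hy
    rcases lt_or_gt_of_ne hy with h | h
    · rw [gammaPDF_of_neg h, indicator_of_notMem (by simpa using h.le)]
    · rw [gammaPDF_of_nonneg h.le, indicator_of_mem (by simpa using h)]; simp
  rw [this, lintegral_withDensity_eq_lintegral_mul _ (by fun_prop) (by fun_prop)]
  have h2 := lintegral_exp_neg_mul_Ioi (r := 1 + p) (by linarith) 0
  simp only [mul_zero, Real.exp_zero] at h2
  rw [← h2]
  refine lintegral_congr fun y => ?_
  rw [Pi.mul_apply, ← ENNReal.ofReal_mul (Real.exp_pos _).le, ← Real.exp_add]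
  ring_nf

/-- Laplace transform, in the observation time `v`, of the event that an exponential clock of
rate `r` started at time `T` has started by `v` and does not ring before `v + t`. -/
theorem lintegral_expMeasure_lintegral_holding {s r t T : ℝ} (hs : 0 < s) (hr : 0 < r) (ht : 0 ≤ t)
    (hT : 0 ≤ T) :
    ∫⁻ y, (∫⁻ v in Ioi (0 : ℝ), ENNReal.ofReal (Real.exp (-s * v)) *
        {v | T ≤ v ∧ v + t < T + y / r}.indicator 1 v) ∂(expMeasure 1)
      = ENNReal.ofReal (Real.exp (-s * T)) * ENNReal.ofReal (Real.exp (-r * t) / (s + r)) := by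
  rw [lintegral_lintegral_swap]
  · have : ∀ v : ℝ, ∫⁻ y, ENNReal.ofReal (Real.exp (-s * v)) *
        {v | T ≤ v ∧ v + t < T + y / r}.indicator 1 v ∂(expMeasure 1)
        = (Ici T).indicator (fun v => ENNReal.ofReal (Real.exp (r * (T - t))) *
            ENNReal.ofReal (Real.exp (-(s + r) * v))) v := by
      intro v
      by_cases hv : T ≤ v
      · rw [indicator_of_mem (mem_Ici.2 hv)]
        have h1 : ∀ y : ℝ, ENNReal.ofReal (Real.exp (-s * v)) *
            {v | T ≤ v ∧ v + t < T + y / r}.indicator 1 v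
            = (Ioi (r * (v + t - T))).indicator
              (fun _ => ENNReal.ofReal (Real.exp (-s * v))) y := by
          intro y
          have : v + t < T + y / r ↔ r * (v + t - T) < y := by
            rw [← sub_lt_iff_lt_add', lt_div_iff₀ hr, mul_comm]
          simp only [indicator, mem_ofPred_eq, this, hv, true_and, mem_Ioi]
          split_ifs <;> simp
        simp_rw [h1]
        rw [lintegral_indicator_const measurableSet_Ioi,
          measure_expMeasure_Ioi (by apply mul_nonneg hr.le; linarith),
          ← ENNReal.ofReal_mul (Real.exp_pos _).le, ← ENNReal.ofReal_mul (Real.exp_pos _).le,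
          ← Real.exp_add, ← Real.exp_add]
        ring_nf
      · rw [indicator_of_notMem (by simpa using hv)]
        simp [hv]
    refine (lintegral_congr this).trans ?_
    rw [lintegral_indicator measurableSet_Ici, Measure.restrict_restrict measurableSet_Ici,
      lintegral_const_mul _ (by fun_prop)]
    have hr2 : volume.restrict (Ici T ∩ Ioi (0 : ℝ)) = volume.restrict (Ioi T) := by
      rcases hT.eq_or_lt with h | h
      · subst h
        have : Ici (0 : ℝ) ∩ Ioi 0 = Ioi 0 := by
          ext; simp only [mem_inter_iff, mem_Ici, mem_Ioi]; constructor
          · exact fun h => h.2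
          · exact fun h => ⟨h.le, h⟩
        rw [this]
      · have : Ici T ∩ Ioi (0 : ℝ) = Ici T := by
          ext a; simp only [mem_inter_iff, mem_Ici, mem_Ioi]; constructor
          · exact fun h => h.1
          · exact fun h' => ⟨h', h.trans_le h'⟩
        rw [this, Measure.restrict_congr_set Ioi_ae_eq_Ici]
    rw [hr2, lintegral_exp_neg_mul_Ioi (by linarith),
      ← ENNReal.ofReal_mul (Real.exp_pos _).le, ← ENNReal.ofReal_mul (Real.exp_pos _).le,
      ← mul_div_assoc, ← mul_div_assoc, ← Real.exp_add, ← Real.exp_add]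
    ring_nf
  · refine Measurable.aemeasurable (f := fun p : ℝ × ℝ => ENNReal.ofReal (Real.exp (-s * p.2)) *
      {v | T ≤ v ∧ v + t < T + p.1 / r}.indicator 1 p.2) ?_
    have : MeasurableSet {p : ℝ × ℝ | T ≤ p.2 ∧ p.2 + t < T + p.1 / r} :=
      (measurableSet_le measurable_const measurable_snd).inter
        (measurableSet_lt (measurable_snd.add_const t)
          (measurable_const.add (measurable_fst.div_const r)))
    have he : Measurable fun p : ℝ × ℝ => ENNReal.ofReal (Real.exp (-s * p.2)) := by fun_prop
    exact he.mul ((measurable_one (α := ENNReal)).indicator this)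

/-! ### The jump times of the walk -/

/-- The time of the `k`-th jump of the walk, with `jumpTime x w 0 = 0`. -/
noncomputable def jumpTime {n : ℕ} (x : ℕ → ℝ) (w : WalkSpace n) (k : ℕ) : ℝ :=
  ∑ i ∈ Finset.range k, holdingTime x w i

/-- The rate `x_i (N - 1) / N`, with `N = n + 2`, at which the walk leaves the site `i`. -/
noncomputable def exitRate (n : ℕ) (x : ℕ → ℝ) (i : ℕ) : ℝ := x i * (n + 1) / (n + 2)

theorem exitRate_pos (n : ℕ) {x : ℕ → ℝ} {i : ℕ} (hx : 0 < x i) : 0 < exitRate n x i := by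
  unfold exitRate; positivity

theorem holdingTime_eq {n : ℕ} {x : ℕ → ℝ} (w : WalkSpace n) (k : ℕ) :
    holdingTime x w k = w.2.2 k / exitRate n x (jumpChain w k) := by
  simp only [holdingTime, exitRate, div_eq_mul_inv, mul_inv, inv_inv]
  ring

theorem jumpTime_succ {n : ℕ} (x : ℕ → ℝ) (w : WalkSpace n) (k : ℕ) :
    jumpTime x w (k + 1) = jumpTime x w k + w.2.2 k / exitRate n x (jumpChain w k) := by
  rw [jumpTime, Finset.sum_range_succ, holdingTime_eq, jumpTime]

theorem measurable_jumpChain {n : ℕ} (k : ℕ) : Measurable (fun w : WalkSpace n => jumpChain w k) := by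
  induction k with
  | zero => exact measurable_fst
  | succ k ih =>
    have h : Measurable (fun p : Fin (n + 2) × Fin (n + 1) => p.1.succAbove p.2) :=
      Measurable.of_discrete
    exact h.comp (ih.prodMk (by fun_prop : Measurable fun w : WalkSpace n => w.2.1 k))

theorem measurable_jumpTime {n : ℕ} (x : ℕ → ℝ) (k : ℕ) :
    Measurable (fun w : WalkSpace n => jumpTime x w k) := by
  refine Finset.measurable_fun_sum _ fun i _ => ?_
  simp only [holdingTime_eq]
  have h : Measurable (fun j : Fin (n + 2) => exitRate n x j) := Measurable.of_discrete
  exact Measurable.div (by fun_prop) (h.comp (measurable_jumpChain i))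

theorem jumpChain_update {n : ℕ} (w : WalkSpace n) (k : ℕ) (z : Fin (n + 1)) (y : ℝ) :
    ∀ j ≤ k, jumpChain ((w.1, Function.update w.2.1 k z, Function.update w.2.2 k y) : WalkSpace n) j
      = jumpChain w j
  | 0, _ => rfl
  | j + 1, h => by
    have ih := jumpChain_update w k z y j (by omega)
    simp only [jumpChain, ih]
    rw [Function.update_of_ne (by omega)]

theorem jumpTime_update {n : ℕ} (x : ℕ → ℝ) (w : WalkSpace n) (k : ℕ) (z : Fin (n + 1)) (y : ℝ) :
    jumpTime x ((w.1, Function.update w.2.1 k z, Function.update w.2.2 k y) : WalkSpace n) k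
      = jumpTime x w k := by
  refine Finset.sum_congr rfl fun i hi => ?_
  have hi' := Finset.mem_range.1 hi
  simp only [holdingTime_eq]
  rw [jumpChain_update w k z y i hi'.le, Function.update_of_ne hi'.ne]

theorem jumpChain_update_succ {n : ℕ} (w : WalkSpace n) (k : ℕ) (z : Fin (n + 1)) (y : ℝ) :
    jumpChain ((w.1, Function.update w.2.1 k z, Function.update w.2.2 k y) : WalkSpace n) (k + 1)
      = (jumpChain w k).succAbove z := by
  simp only [jumpChain, Function.update_self]
  rw [jumpChain_update w k z y k le_rfl]

theorem jumpTime_update_succ {n : ℕ} (x : ℕ → ℝ) (w : WalkSpace n) (k : ℕ) (z : Fin (n + 1))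
    (y : ℝ) :
    jumpTime x ((w.1, Function.update w.2.1 k z, Function.update w.2.2 k y) : WalkSpace n) (k + 1)
      = jumpTime x w k + y / exitRate n x (jumpChain w k) := by
  rw [jumpTime_succ, jumpTime_update, jumpChain_update w k z y k le_rfl]
  simp only [Function.update_self]

/-! ### The discounted jump chain -/

/-- The expectation of `e^{-s T_k} φ(J_k)`, where `T_k` is the time of the `k`-th jump and `J_k` the
site it leads to. -/
noncomputable def discounted (n : ℕ) (x : ℕ → ℝ) (s : ℝ) (k : ℕ) (φ : Fin (n + 2) → ENNReal) :
    ENNReal :=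
  ∫⁻ w, ENNReal.ofReal (Real.exp (-s * jumpTime x w k)) * φ (jumpChain w k) ∂(walkMeasure n)

theorem lintegral_uniform {m : ℕ} (g : Fin (m + 1) → ENNReal) :
    ∫⁻ z, g z ∂(PMF.uniformOfFintype (Fin (m + 1))).toMeasure
      = (∑ z, g z) * ((m + 1 : ℕ) : ENNReal)⁻¹ := by
  rw [lintegral_fintype, Finset.sum_mul]
  refine Finset.sum_congr rfl fun z _ => ?_
  rw [PMF.toMeasure_apply_singleton _ _ (measurableSet_singleton _)]
  simp

theorem discounted_zero (n : ℕ) (x : ℕ → ℝ) (s : ℝ) (φ : Fin (n + 2) → ENNReal) :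
    discounted n x s 0 φ = (∑ i, φ i) * ((n + 2 : ℕ) : ENNReal)⁻¹ := by
  unfold discounted walkMeasure
  simp only [jumpTime, Finset.range_zero, Finset.sum_empty, mul_zero, Real.exp_zero,
    ENNReal.ofReal_one, one_mul, jumpChain]
  have hm : Measurable fun w : WalkSpace n => φ w.1 :=
    (Measurable.of_discrete (f := φ)).comp measurable_fst
  rw [lintegral_prod _ hm.aemeasurable]
  simp only [lintegral_const, measure_univ, mul_one]
  exact lintegral_uniform φ

theorem measurable_discount {n : ℕ} (x : ℕ → ℝ) (s : ℝ) (k : ℕ) (φ : Fin (n + 2) → ENNReal) :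
    Measurable fun w : WalkSpace n =>
      ENNReal.ofReal (Real.exp (-s * jumpTime x w k)) * φ (jumpChain w k) := by
  have h1 := measurable_jumpTime (n := n) x k
  have h2 : Measurable fun w : WalkSpace n => φ (jumpChain w k) :=
    (Measurable.of_discrete (f := φ)).comp (measurable_jumpChain k)
  exact Measurable.mul (by fun_prop) h2

/-- One step of the discounted jump chain: a site with exit rate `r` contributes the Laplace transform
`r / (s + r)` of its holding time and the average over the other sites. -/
theorem discounted_succ {n : ℕ} {x : ℕ → ℝ} (hx : ∀ j, 0 < x j) {s : ℝ} (hs : 0 < s) (k : ℕ)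
    (φ : Fin (n + 2) → ENNReal) :
    discounted n x s (k + 1) φ = discounted n x s k (fun i =>
      ENNReal.ofReal (exitRate n x i / (s + exitRate n x i)) *
        ((∑ z : Fin (n + 1), φ (i.succAbove z)) * ((n + 1 : ℕ) : ENNReal)⁻¹)) := by
  unfold discounted
  rw [lintegral_walkMeasure_eq_lintegral_update k (measurable_discount x s (k + 1) φ)]
  refine lintegral_congr fun w => ?_
  simp only [jumpTime_update_succ, jumpChain_update_succ]
  set r := exitRate n x (jumpChain w k)
  have hr : 0 < r := exitRate_pos n (hx _)
  have h : ∀ z : Fin (n + 1), ∫⁻ y, ENNReal.ofReal (Real.exp (-s * (jumpTime x w k + y / r))) *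
      φ ((jumpChain w k).succAbove z) ∂(expMeasure 1)
      = ENNReal.ofReal (Real.exp (-s * jumpTime x w k)) * ENNReal.ofReal (r / (s + r)) *
        φ ((jumpChain w k).succAbove z) := by
    intro z
    rw [lintegral_mul_const _ (by fun_prop)]
    congr 1
    have : ∀ y : ℝ, ENNReal.ofReal (Real.exp (-s * (jumpTime x w k + y / r)))
        = ENNReal.ofReal (Real.exp (-s * jumpTime x w k)) *
          ENNReal.ofReal (Real.exp (-(s / r) * y)) := by
      intro y
      rw [← ENNReal.ofReal_mul (Real.exp_pos _).le, ← Real.exp_add]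
      ring_nf
    simp_rw [this]
    rw [lintegral_const_mul _ (by fun_prop), lintegral_expMeasure_exp (by positivity)]
    congr 2
    field_simp
    ring
  simp_rw [h]
  rw [lintegral_uniform, ← Finset.mul_sum]
  ring

theorem discounted_mono {n : ℕ} (x : ℕ → ℝ) (s : ℝ) (k : ℕ) {φ ψ : Fin (n + 2) → ENNReal}
    (h : φ ≤ ψ) : discounted n x s k φ ≤ discounted n x s k ψ :=
  lintegral_mono fun _ => mul_le_mul_right (h _) _

theorem discounted_add {n : ℕ} (x : ℕ → ℝ) (s : ℝ) (k : ℕ) (φ ψ : Fin (n + 2) → ENNReal) :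
    discounted n x s k (φ + ψ) = discounted n x s k φ + discounted n x s k ψ := by
  unfold discounted
  rw [← lintegral_add_left (measurable_discount x s k φ)]
  simp only [Pi.add_apply, mul_add]

theorem discounted_const {n : ℕ} (x : ℕ → ℝ) (s : ℝ) (k : ℕ) (c : ENNReal) :
    discounted n x s k (fun _ => c) = c * discounted n x s k 1 := by
  have h1 := measurable_jumpTime (n := n) x k
  unfold discounted
  rw [lintegral_mul_const _ (by fun_prop)]
  simp [mul_comm]

/-- The discounted mass decays geometrically, since each of the finitely many sites is left after
a time whose Laplace transform is less than `1`. -/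
theorem exists_discounted_one_le {n : ℕ} {x : ℕ → ℝ} (hx : ∀ j, 0 < x j) {s : ℝ} (hs : 0 < s) :
    ∃ ρ : ENNReal, ρ < 1 ∧ ∀ k, discounted n x s k 1 ≤ ρ ^ k := by
  set q : Fin (n + 2) → ENNReal := fun i =>
    ENNReal.ofReal (exitRate n x i / (s + exitRate n x i)) with hq
  refine ⟨Finset.univ.sup q, ?_, fun k => ?_⟩
  · rw [Finset.sup_lt_iff (by simp)]
    intro i _
    have := exitRate_pos n (hx i)
    rw [hq, ENNReal.ofReal_lt_one, div_lt_one (by positivity)]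
    linarith
  · induction k with
    | zero =>
      rw [discounted_zero]
      simp only [Pi.one_apply, Finset.sum_const, Finset.card_univ, Fintype.card_fin, nsmul_eq_mul,
        mul_one, pow_zero]
      exact ENNReal.mul_inv_le_one _
    | succ k ih =>
      rw [discounted_succ hx hs]
      refine (discounted_mono x s k (ψ := fun _ => Finset.univ.sup q) fun i => ?_).trans ?_
      · have : (∑ z : Fin (n + 1), (1 : Fin (n + 2) → ENNReal) (i.succAbove z)) *
            ((n + 1 : ℕ) : ENNReal)⁻¹ ≤ 1 := by
          simp only [Pi.one_apply, Finset.sum_const, Finset.card_univ, Fintype.card_fin,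
            nsmul_eq_mul, mul_one]
          exact ENNReal.mul_inv_le_one _
        calc _ ≤ q i * 1 := mul_le_mul_right this _
          _ ≤ _ := by rw [mul_one]; exact Finset.le_sup (Finset.mem_univ i)
      · rw [discounted_const, pow_succ']
        exact mul_le_mul_right ih _

theorem tsum_discounted_one_ne_top {n : ℕ} {x : ℕ → ℝ} (hx : ∀ j, 0 < x j) {s : ℝ} (hs : 0 < s) :
    ∑' k, discounted n x s k 1 ≠ ⊤ := by
  obtain ⟨ρ, hρ, h⟩ := exists_discounted_one_le (n := n) hx hs
  refine ne_top_of_le_ne_top ?_ (ENNReal.tsum_le_tsum h)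
  rw [ENNReal.tsum_geometric]
  exact ENNReal.inv_ne_top.2 (tsub_pos_of_lt hρ).ne'

/-- If `f = ψ + Q f`, where `Q` is the one-step operator of the discounted jump chain, then the
discounted occupation functional of `ψ` is the mean of `f` under the initial law. -/
theorem tsum_discounted_eq {n : ℕ} {x : ℕ → ℝ} (hx : ∀ j, 0 < x j) {s : ℝ} (hs : 0 < s)
    {f ψ : Fin (n + 2) → ENNReal} (hf : ∀ i, f i ≠ ⊤)
    (h : ∀ i, f i = ψ i + ENNReal.ofReal (exitRate n x i / (s + exitRate n x i)) *
        ((∑ z : Fin (n + 1), f (i.succAbove z)) * ((n + 1 : ℕ) : ENNReal)⁻¹)) :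
    ∑' k, discounted n x s k ψ = (∑ i, f i) * ((n + 2 : ℕ) : ENNReal)⁻¹ := by
  have hstep : ∀ k, discounted n x s k f = discounted n x s k ψ + discounted n x s (k + 1) f := by
    intro k
    rw [discounted_succ hx hs, ← discounted_add]
    congr 1
    funext i
    exact h i
  have hsum : ∀ K, ∑ k ∈ Finset.range K, discounted n x s k ψ + discounted n x s K f
      = discounted n x s 0 f := by
    intro K
    induction K with
    | zero => simp
    | succ K ih => rw [Finset.sum_range_succ, add_assoc, ← hstep, ih]
  have hM : Finset.univ.sup f ≠ ⊤ := by
    refine (Finset.sup_lt_iff (by simp)).2 (fun i _ => (hf i).lt_top) |>.ne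
  have hlim : Tendsto (fun K => discounted n x s K f) atTop (𝓝 0) := by
    have h0 := ENNReal.Tendsto.const_mul (a := Finset.univ.sup f)
      (ENNReal.tendsto_atTop_zero_of_tsum_ne_top (tsum_discounted_one_ne_top (n := n) hx hs))
      (Or.inr hM)
    rw [mul_zero] at h0
    refine tendsto_of_tendsto_of_tendsto_of_le_of_le tendsto_const_nhds h0 (fun _ => zero_le)
      fun K => ?_
    rw [← discounted_const]
    exact discounted_mono x s K fun i => Finset.le_sup (Finset.mem_univ i)
  have h2 := (ENNReal.summable.hasSum (f := fun k => discounted n x s k ψ)).tendsto_sum_nat.add hlim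
  simp only [hsum, add_zero] at h2
  rw [tendsto_nhds_unique h2 tendsto_const_nhds, discounted_zero]

/-! ### The Laplace transform of the correlation function -/

theorem ae_clock_pos (n : ℕ) : ∀ᵐ w ∂(walkMeasure n), ∀ k, 0 < w.2.2 k := by
  rw [ae_all_iff]
  intro k
  have h : MeasurePreserving (fun w : WalkSpace n => w.2.2 k) (walkMeasure n) (expMeasure 1) := by
    have h3 := measurePreserving_eval_infinitePi (fun _ : ℕ => expMeasure 1) k
    exact h3.comp (measurePreserving_snd.comp measurePreserving_snd)
  exact h.quasiMeasurePreserving.ae ae_expMeasure_pos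

/-- Almost surely the jump times tend to infinity: the walk does not explode. -/
theorem ae_tendsto_jumpTime {n : ℕ} {x : ℕ → ℝ} (hx : ∀ j, 0 < x j) :
    ∀ᵐ w ∂(walkMeasure n), Tendsto (jumpTime x w) atTop atTop := by
  have h1 : ∫⁻ w, ∑' k, ENNReal.ofReal (Real.exp (-1 * jumpTime x w k)) ∂(walkMeasure n) ≠ ⊤ := by
    have hm (k : ℕ) := measurable_jumpTime (n := n) x k
    rw [lintegral_tsum fun k => by have := hm k; fun_prop]
    have := tsum_discounted_one_ne_top (n := n) hx one_pos
    simpa only [discounted, Pi.one_apply, mul_one] using this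
  have hm : Measurable fun w : WalkSpace n =>
      ∑' k, ENNReal.ofReal (Real.exp (-1 * jumpTime x w k)) := by
    refine Measurable.tsum fun k => ?_
    have := measurable_jumpTime (n := n) x k
    fun_prop
  filter_upwards [ae_lt_top hm h1] with w hw
  have h2 := ENNReal.tendsto_atTop_zero_of_tsum_ne_top hw.ne
  have h3 := (ENNReal.tendsto_toReal ENNReal.zero_ne_top).comp h2
  simp only [Function.comp_def, ENNReal.toReal_ofReal (Real.exp_pos _).le, neg_mul, one_mul,
    ENNReal.toReal_zero, Real.tendsto_exp_comp_nhds_zero, tendsto_neg_atBot_iff] at h3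
  exact h3

section
variable {n : ℕ} {x : ℕ → ℝ} {w : WalkSpace n}

theorem strictMono_jumpTime (hx : ∀ j, 0 < x j) (hw : ∀ k, 0 < w.2.2 k) :
    StrictMono (jumpTime x w) := by
  refine strictMono_nat_of_lt_succ fun k => ?_
  rw [jumpTime_succ]
  have := div_pos (hw k) (exitRate_pos n (hx (jumpChain w k)))
  linarith

theorem jumpTime_nonneg (hx : ∀ j, 0 < x j) (hw : ∀ k, 0 < w.2.2 k) (k : ℕ) :
    0 ≤ jumpTime x w k := by
  have := (strictMono_jumpTime hx hw).monotone (Nat.zero_le k)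
  simpa [jumpTime] using this

theorem walkPosition_eq (hx : ∀ j, 0 < x j) (hw : ∀ k, 0 < w.2.2 k) {v : ℝ} {k : ℕ}
    (h1 : jumpTime x w k ≤ v) (h2 : v < jumpTime x w (k + 1)) :
    walkPosition x w v = jumpChain w k := by
  unfold walkPosition
  congr 1
  have hT := (strictMono_jumpTime hx hw)
  refine le_antisymm (Nat.sInf_le h2) ?_
  refine le_csInf ⟨k, h2⟩ fun j hj => ?_
  by_contra hjk
  have h3 : jumpTime x w (j + 1) ≤ jumpTime x w k := hT.monotone (by omega)
  have h4 : v < jumpTime x w (j + 1) := hj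
  linarith

theorem exists_jumpTime_le_lt (hT : Tendsto (jumpTime x w) atTop atTop) {v : ℝ} (hv : 0 ≤ v) :
    ∃ k, jumpTime x w k ≤ v ∧ v < jumpTime x w (k + 1) := by
  classical
  have hex : ∃ k, v < jumpTime x w k := (hT.eventually_gt_atTop v).exists
  obtain ⟨h1, h2⟩ := And.intro (Nat.find_spec hex) (fun m => Nat.find_min (m := m) hex)
  have h0 : Nat.find hex ≠ 0 := by
    intro h
    rw [h] at h1
    simp only [jumpTime, Finset.range_zero, Finset.sum_empty] at h1
    linarith
  obtain ⟨k, hk⟩ := Nat.exists_eq_succ_of_ne_zero h0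
  refine ⟨k, ?_, by rw [hk] at h1; exact h1⟩
  have := h2 k (by omega)
  push Not at this
  exact this

/-- The walk rests during `[v, v + t]` if and only if no jump time falls into `(v, v + t]`. -/
theorem rest_iff (hx : ∀ j, 0 < x j) (hw : ∀ k, 0 < w.2.2 k)
    (hT : Tendsto (jumpTime x w) atTop atTop) {v t : ℝ} (hv : 0 ≤ v) (ht : 0 ≤ t) :
    (∀ s ∈ Icc v (v + t), walkPosition x w s = walkPosition x w v) ↔
      ∃ k, jumpTime x w k ≤ v ∧ v + t < jumpTime x w (k + 1) := by
  constructor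
  · intro h
    obtain ⟨k, h1, h2⟩ := exists_jumpTime_le_lt hT hv
    refine ⟨k, h1, ?_⟩
    by_contra h3
    push Not at h3
    have h4 := h _ ⟨h2.le, h3⟩
    rw [walkPosition_eq hx hw h1 h2, walkPosition_eq hx hw le_rfl
      (strictMono_jumpTime hx hw (Nat.lt_succ_self (k + 1)))] at h4
    exact Fin.succAbove_ne _ _ h4
  · rintro ⟨k, h1, h2⟩ s hs
    rw [walkPosition_eq hx hw h1 (by linarith), walkPosition_eq hx hw (h1.trans hs.1)
      (hs.2.trans_lt h2)]

end

/-- The event that the walk rests during `[v, v + t]` at the `k`-th visited site. -/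
def restEvent (n : ℕ) (x : ℕ → ℝ) (t v : ℝ) (k : ℕ) : Set (WalkSpace n) :=
  {w | jumpTime x w k ≤ v ∧ v + t < jumpTime x w (k + 1)}

theorem measurableSet_restEvent (n : ℕ) (x : ℕ → ℝ) (t v : ℝ) (k : ℕ) :
    MeasurableSet (restEvent n x t v k) :=
  (measurableSet_le (measurable_jumpTime x k) measurable_const).inter
    (measurableSet_lt measurable_const (measurable_jumpTime x (k + 1)))

theorem measurableSet_restEvent_prod (n : ℕ) (x : ℕ → ℝ) (t : ℝ) (k : ℕ) :
    MeasurableSet {p : WalkSpace n × ℝ | p.1 ∈ restEvent n x t p.2 k} :=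
  (measurableSet_le ((measurable_jumpTime x k).comp measurable_fst) measurable_snd).inter
    (measurableSet_lt (measurable_snd.add_const t)
      ((measurable_jumpTime x (k + 1)).comp measurable_fst))

theorem measure_rest_eq_tsum {n : ℕ} {x : ℕ → ℝ} (hx : ∀ j, 0 < x j) {v t : ℝ}
    (hv : 0 ≤ v) (ht : 0 ≤ t) :
    walkMeasure n {w | ∀ s ∈ Icc v (v + t), walkPosition x w s = walkPosition x w v}
      = ∑' k, walkMeasure n (restEvent n x t v k) := by
  have hae : ∀ᵐ w ∂(walkMeasure n), (∀ k, 0 < w.2.2 k) ∧ Tendsto (jumpTime x w) atTop atTop :=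
    (ae_clock_pos n).and (ae_tendsto_jumpTime hx)
  rw [← measure_iUnion₀ _ fun k => (measurableSet_restEvent n x t v k).nullMeasurableSet]
  · refine measure_congr ?_
    filter_upwards [hae] with w hw
    exact propext ((rest_iff hx hw.1 hw.2 hv ht).trans
      (Set.mem_iUnion (s := restEvent n x t v)).symm)
  · intro j k hjk
    rw [Function.onFun, AEDisjoint, measure_eq_zero_iff_ae_notMem]
    filter_upwards [hae] with w hw h
    have hT := strictMono_jumpTime hx hw.1
    have a : jumpTime x w j < jumpTime x w (k + 1) := by linarith [h.1.1, h.2.2]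
    have b : jumpTime x w k < jumpTime x w (j + 1) := by linarith [h.2.1, h.1.2]
    have a' := hT.lt_iff_lt.1 a
    have b' := hT.lt_iff_lt.1 b
    omega

/-- The clock of the `k`-th visited site is independent of the past, so that the rest at this site
contributes a discounted functional of the jump chain. -/
theorem lintegral_exp_mul_measure_restEvent {n : ℕ} {x : ℕ → ℝ} (hx : ∀ j, 0 < x j) {s t : ℝ}
    (hs : 0 < s) (ht : 0 ≤ t) (k : ℕ) :
    ∫⁻ v in Ioi (0 : ℝ), ENNReal.ofReal (Real.exp (-s * v)) * walkMeasure n (restEvent n x t v k)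
      = discounted n x s k (fun i =>
          ENNReal.ofReal (Real.exp (-exitRate n x i * t) / (s + exitRate n x i))) := by
  have h1 : ∀ v, ENNReal.ofReal (Real.exp (-s * v)) * walkMeasure n (restEvent n x t v k)
      = ∫⁻ w, ENNReal.ofReal (Real.exp (-s * v)) *
          {v | jumpTime x w k ≤ v ∧ v + t < jumpTime x w (k + 1)}.indicator 1 v
            ∂(walkMeasure n) := by
    intro v
    rw [← lintegral_indicator_one (measurableSet_restEvent n x t v k), ← lintegral_const_mul]
    · rfl
    · exact measurable_one.indicator (measurableSet_restEvent n x t v k)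
  have hm : Measurable fun p : WalkSpace n × ℝ => ENNReal.ofReal (Real.exp (-s * p.2)) *
      {v | jumpTime x p.1 k ≤ v ∧ v + t < jumpTime x p.1 (k + 1)}.indicator
        (1 : ℝ → ENNReal) p.2 := by
    have he : Measurable fun p : WalkSpace n × ℝ => ENNReal.ofReal (Real.exp (-s * p.2)) := by
      fun_prop
    exact he.mul ((measurable_one (α := ENNReal)).indicator (measurableSet_restEvent_prod n x t k))
  simp_rw [h1]
  rw [lintegral_lintegral_swap (f := fun v w => ENNReal.ofReal (Real.exp (-s * v)) *
      {v | jumpTime x w k ≤ v ∧ v + t < jumpTime x w (k + 1)}.indicator 1 v) (hm.comp measurable_swap).aemeasurable,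
    lintegral_walkMeasure_eq_lintegral_update k (hm.lintegral_prod_right' (ν := volume.restrict (Ioi 0)))]
  unfold discounted
  refine lintegral_congr_ae ?_
  filter_upwards [ae_clock_pos n] with w hw
  simp only [jumpTime_update_succ, jumpTime_update]
  have := fun z : Fin (n + 1) => lintegral_expMeasure_lintegral_holding hs
    (exitRate_pos n (hx (jumpChain w k))) ht (jumpTime_nonneg hx hw k)
  refine (lintegral_congr this).trans ?_
  rw [lintegral_const, measure_univ, mul_one]

/-- The solution of the first-step equations for the Laplace transform, in the observation time,
of the probability that the walk started at a given site is at rest. -/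
theorem firstStep_eq {n : ℕ} {x : ℕ → ℝ} (hx : ∀ j, 0 < x j) {s : ℝ} (hs : 0 < s)
    (c : Fin (n + 2) → ℝ) (i : Fin (n + 2)) :
    let F := (n + 2) * (∑ j : Fin (n + 2), c j / (x j + s)) /
      (s * ∑ j : Fin (n + 2), 1 / (x j + s))
    let f : Fin (n + 2) → ℝ := fun i => (c i + x i * F / (n + 2)) / (x i + s)
    ∑ j, f j = F ∧ f i = c i / (s + exitRate n x i) + exitRate n x i / (s + exitRate n x i) *
      ((∑ z : Fin (n + 1), f (i.succAbove z)) * (n + 1 : ℝ)⁻¹) := by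
  intro F f
  have hxs : ∀ j : Fin (n + 2), 0 < x j + s := fun j => by have := hx j; linarith
  have hD : 0 < ∑ j : Fin (n + 2), 1 / (x j + s) :=
    Finset.sum_pos (fun j _ => by have := hxs j; positivity) (by simp)
  have hF : ∑ j, f j = F := by
    have h1 : ∑ j, f j = ∑ j : Fin (n + 2), (c j / (x j + s) +
        F / (n + 2) * (1 - s * (1 / (x j + s)))) := by
      refine Finset.sum_congr rfl fun j _ => ?_
      have := (hxs j).ne'
      simp only [f]
      field_simp
      ring
    rw [h1, Finset.sum_add_distrib, ← Finset.mul_sum, Finset.sum_sub_distrib, ← Finset.mul_sum]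
    simp only [Finset.sum_const, Finset.card_univ, Fintype.card_fin, nsmul_eq_mul, mul_one]
    push_cast
    have h2 : F * (s * ∑ j : Fin (n + 2), 1 / (x j + s))
        = (n + 2) * (∑ j : Fin (n + 2), c j / (x j + s)) := by
      simp only [F]
      field_simp
    have h3 : (n + 2 : ℝ) ≠ 0 := by positivity
    generalize (∑ j : Fin (n + 2), c j / (x j + s)) = C at *
    generalize (∑ j : Fin (n + 2), 1 / (x j + s)) = D at *
    generalize F = F' at *
    field_simp
    linarith
  refine ⟨hF, ?_⟩
  have h4 : ∑ z : Fin (n + 1), f (i.succAbove z) = F - f i := by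
    rw [← hF, Fin.sum_univ_succAbove f i]; ring
  rw [h4]
  have h5 : 0 < s + exitRate n x i := by have := exitRate_pos n (hx i); linarith
  have h6 : f i * (x i + s) = c i + x i * F / (n + 2) := by
    have := (hxs i).ne'
    simp only [f]; field_simp
  have h7 : (n + 1 : ℝ) ≠ 0 := by positivity
  have h8 : (n + 2 : ℝ) ≠ 0 := by positivity
  generalize f i = y at *
  generalize F = F' at *
  rw [div_mul_eq_mul_div, ← add_div, eq_div_iff h5.ne']
  unfold exitRate
  field_simp
  field_simp at h6
  linear_combination h6

theorem lintegral_exp_mul_measure_rest {n : ℕ} {x : ℕ → ℝ} (hx : ∀ j, 0 < x j) {s t : ℝ}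
    (hs : 0 < s) (ht : 0 ≤ t) :
    ∫⁻ v in Ioi (0 : ℝ), ENNReal.ofReal (Real.exp (-s * v)) *
        walkMeasure n {w | ∀ s ∈ Icc v (v + t), walkPosition x w s = walkPosition x w v}
      = ENNReal.ofReal ((∑ j : Fin (n + 2), Real.exp (-exitRate n x j * t) / (x j + s)) /
          (s * ∑ j : Fin (n + 2), 1 / (x j + s))) := by
  have h1 : ∀ v ∈ Ioi (0 : ℝ), ENNReal.ofReal (Real.exp (-s * v)) *
        walkMeasure n {w | ∀ s ∈ Icc v (v + t), walkPosition x w s = walkPosition x w v}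
      = ∑' k, ENNReal.ofReal (Real.exp (-s * v)) * walkMeasure n (restEvent n x t v k) := by
    intro v hv
    rw [measure_rest_eq_tsum hx (le_of_lt hv) ht, ENNReal.tsum_mul_left]
  rw [setLIntegral_congr_fun measurableSet_Ioi h1, lintegral_tsum]
  swap
  · intro k
    have : Measurable fun v => walkMeasure n (restEvent n x t v k) :=
      measurable_measure_prodMk_right (measurableSet_restEvent_prod n x t k)
    fun_prop
  simp_rw [lintegral_exp_mul_measure_restEvent hx hs ht]
  obtain ⟨c, hc⟩ : ∃ c : Fin (n + 2) → ℝ, c = fun j : Fin (n + 2) => Real.exp (-exitRate n x j * t) := ⟨_, rfl⟩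
  have hc0 : ∀ j, 0 < c j := fun j => by rw [hc]; exact Real.exp_pos _
  have hxs : ∀ j : Fin (n + 2), 0 < x j + s := fun j => by have := hx j; linarith
  have hD : 0 < ∑ j : Fin (n + 2), 1 / (x j + s) :=
    Finset.sum_pos (fun j _ => by have := hxs j; positivity) (by simp)
  have hC : 0 < ∑ j : Fin (n + 2), c j / (x j + s) :=
    Finset.sum_pos (fun j _ => div_pos (hc0 j) (hxs j)) (by simp)
  have key := firstStep_eq hx hs c
  have hcx : ∀ j : Fin (n + 2), Real.exp (-exitRate n x j * t) = c j := fun j => by rw [hc]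
  simp_rw [hcx]
  set F := (n + 2) * (∑ j : Fin (n + 2), c j / (x j + s)) /
      (s * ∑ j : Fin (n + 2), 1 / (x j + s)) with hF
  have hF0 : 0 < F := by positivity
  set f : Fin (n + 2) → ℝ := fun i => (c i + x i * F / (n + 2)) / (x i + s) with hf
  have hf0 : ∀ i, 0 ≤ f i := fun i => by
    have := hc0 i; have := hx i; have := hxs i
    simp only [f]; positivity
  rw [tsum_discounted_eq hx hs (f := fun i => ENNReal.ofReal (f i))
    (fun _ => ENNReal.ofReal_ne_top)]
  · rw [← ENNReal.ofReal_sum_of_nonneg fun i _ => hf0 i, (key 0).1, ← ENNReal.ofReal_natCast,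
      ← ENNReal.ofReal_inv_of_pos (by positivity), ← ENNReal.ofReal_mul hF0.le]
    congr 1
    rw [hF]
    push_cast
    field_simp
  · intro i
    have hr := exitRate_pos n (hx i)
    have h5 : 0 < s + exitRate n x i := by linarith
    have hci := hc0 i
    have hsum : 0 ≤ ∑ z : Fin (n + 1), f (i.succAbove z) := Finset.sum_nonneg fun z _ => hf0 _
    rw [← ENNReal.ofReal_sum_of_nonneg fun z _ => hf0 _, ← ENNReal.ofReal_natCast,
      ← ENNReal.ofReal_inv_of_pos (by positivity), ← ENNReal.ofReal_mul hsum,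
      ← ENNReal.ofReal_mul (by positivity), ← ENNReal.ofReal_add (by positivity) (by positivity)]
    congr 1
    refine (key i).2.trans ?_
    push_cast
    rfl

theorem aestronglyMeasurable_walkCorrelation {n : ℕ} {x : ℕ → ℝ} (hx : ∀ j, 0 < x j) {t : ℝ}
    (ht : 0 ≤ t) :
    AEStronglyMeasurable (fun v => walkCorrelation (n + 2) x t v) (volume.restrict (Ioi 0)) := by
  have hm : Measurable fun v => (∑' k, walkMeasure n (restEvent n x t v k)).toReal := by
    refine Measurable.ennreal_toReal (Measurable.tsum fun k => ?_)
    exact measurable_measure_prodMk_right (measurableSet_restEvent_prod n x t k)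
  refine hm.aestronglyMeasurable.congr ?_
  filter_upwards [ae_restrict_mem measurableSet_Ioi] with v hv
  rw [← measure_rest_eq_tsum hx (le_of_lt hv) ht]
  rfl

/-- The Laplace transform of the correlation function in the waiting time. -/
theorem integral_exp_mul_walkCorrelation {n : ℕ} {x : ℕ → ℝ} (hx : ∀ j, 0 < x j) {s t : ℝ}
    (hs : 0 < s) (ht : 0 ≤ t) :
    ∫ v in Ioi (0 : ℝ), Real.exp (-s * v) * walkCorrelation (n + 2) x t v
      = (∑ j : Fin (n + 2), Real.exp (-exitRate n x j * t) / (x j + s)) /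
          (s * ∑ j : Fin (n + 2), 1 / (x j + s)) := by
  have hxs : ∀ j : Fin (n + 2), 0 < x j + s := fun j => by have := hx j; linarith
  rw [integral_eq_lintegral_of_nonneg_ae]
  · have : ∀ v, ENNReal.ofReal (Real.exp (-s * v) * walkCorrelation (n + 2) x t v)
        = ENNReal.ofReal (Real.exp (-s * v)) *
          walkMeasure n {w | ∀ s ∈ Icc v (v + t), walkPosition x w s = walkPosition x w v} := by
      intro v
      rw [ENNReal.ofReal_mul (Real.exp_pos _).le, walkCorrelation, ofReal_measureReal]
    simp_rw [this]
    rw [lintegral_exp_mul_measure_rest hx hs ht, ENNReal.toReal_ofReal]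
    exact div_nonneg (Finset.sum_nonneg fun j _ => div_nonneg (Real.exp_pos _).le (hxs j).le)
      (mul_nonneg hs.le (Finset.sum_nonneg fun j _ => div_nonneg zero_le_one (hxs j).le))
  · exact ae_of_all _ fun v => mul_nonneg (Real.exp_pos _).le measureReal_nonneg
  · exact (by fun_prop : Continuous fun v : ℝ => Real.exp (-s * v)).aestronglyMeasurable.mul
      (aestronglyMeasurable_walkCorrelation hx ht)

theorem walkCorrelation_nonneg : ∀ (N : ℕ) (x : ℕ → ℝ) (t v : ℝ), 0 ≤ walkCorrelation N x t v
  | 0, _, _, _ => le_rfl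
  | 1, _, _, _ => zero_le_one
  | _ + 2, _, _, _ => measureReal_nonneg

theorem walkCorrelation_le_one : ∀ (N : ℕ) (x : ℕ → ℝ) (t v : ℝ), walkCorrelation N x t v ≤ 1
  | 0, _, _, _ => zero_le_one
  | 1, _, _, _ => le_rfl
  | _ + 2, _, _, _ => measureReal_le_one

/-- A walk which rests during an interval rests during each subinterval. -/
theorem walkCorrelation_nested : ∀ (N : ℕ) (x : ℕ → ℝ) {t v t' v' : ℝ}, 0 ≤ t' → v ≤ v' →
    v' + t' ≤ v + t → walkCorrelation N x t v ≤ walkCorrelation N x t' v'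
  | 0, _, _, _, _, _, _, _, _ => le_rfl
  | 1, _, _, _, _, _, _, _, _ => le_rfl
  | n + 2, x, t, v, t', v', ht', h1, h2 => by
    refine measureReal_mono fun w hw s hs => ?_
    have a := hw s ⟨h1.trans hs.1, hs.2.trans h2⟩
    have b := hw v' ⟨h1, by linarith⟩
    rw [a, b]

/-! ### A Tauberian theorem for nested functions -/

theorem integrableOn_exp_neg_Ioi_zero : IntegrableOn (fun v : ℝ => Real.exp (-v)) (Ioi 0) := by
  simpa using integrableOn_exp_mul_Ioi (a := -1) (by norm_num) 0

theorem exp_neg_mem_Icc {v : ℝ} (hv : v ∈ Ioi (0 : ℝ)) : Real.exp (-v) ∈ Icc (0 : ℝ) 1 :=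
  ⟨(Real.exp_pos _).le, Real.exp_le_one_iff.2 (by simpa using le_of_lt hv)⟩

theorem integrableOn_comp_exp_mul {φ : ℝ → ℝ} (hφ : Continuous φ) {g : ℝ → ℝ}
    (hg : IntegrableOn g (Ioi 0)) : IntegrableOn (fun v => φ (Real.exp (-v)) * g v) (Ioi 0) := by
  obtain ⟨C, hC⟩ := isCompact_Icc.exists_bound_of_continuousOn (hφ.continuousOn (s := Icc 0 1))
  refine Integrable.bdd_mul (c := C) hg ?_ ?_
  · exact (hφ.comp (by fun_prop)).aestronglyMeasurable
  · filter_upwards [ae_restrict_mem measurableSet_Ioi] with v hv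
    exact hC _ (exp_neg_mem_Icc hv)

theorem integrableOn_exp_mul_of_le_one {F : ℝ → ℝ}
    (hm : AEStronglyMeasurable F (volume.restrict (Ioi 0)))
    (hF : ∀ v, 0 < v → 0 ≤ F v ∧ F v ≤ 1) :
    IntegrableOn (fun v => Real.exp (-v) * F v) (Ioi 0) := by
  refine Integrable.mul_bdd (c := 1) integrableOn_exp_neg_Ioi_zero hm ?_
  filter_upwards [ae_restrict_mem measurableSet_Ioi] with v hv
  rw [Real.norm_eq_abs, abs_of_nonneg (hF v hv).1]
  exact (hF v hv).2

/-- Convergence of the Laplace transforms at the positive integers implies vague convergence: the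
integers give the moments in the variable `u = e^{-v}`, and polynomials are dense in `C([0, 1])`. -/
theorem tendsto_integral_comp_exp_of_laplace {ι : Type*} {l : Filter ι} {F : ι → ℝ → ℝ}
    {H : ℝ → ℝ}
    (hm : ∀ᶠ n in l, AEStronglyMeasurable (F n) (volume.restrict (Ioi 0)))
    (hF : ∀ᶠ n in l, ∀ v, 0 < v → 0 ≤ F n v ∧ F n v ≤ 1)
    (hH : IntegrableOn (fun v => Real.exp (-v) * H v) (Ioi 0))
    (hL : ∀ k : ℕ, Tendsto (fun n => ∫ v in Ioi (0 : ℝ), Real.exp (-(k + 1) * v) * F n v) l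
      (𝓝 (∫ v in Ioi (0 : ℝ), Real.exp (-(k + 1) * v) * H v)))
    {φ : ℝ → ℝ} (hφ : Continuous φ) :
    Tendsto (fun n => ∫ v in Ioi (0 : ℝ), φ (Real.exp (-v)) * (Real.exp (-v) * F n v)) l
      (𝓝 (∫ v in Ioi (0 : ℝ), φ (Real.exp (-v)) * (Real.exp (-v) * H v))) := by
  have hpoly : ∀ (p : Polynomial ℝ) (g : ℝ → ℝ),
      IntegrableOn (fun v => Real.exp (-v) * g v) (Ioi 0) →
      ∫ v in Ioi (0 : ℝ), p.eval (Real.exp (-v)) * (Real.exp (-v) * g v)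
        = ∑ k ∈ Finset.range (p.natDegree + 1),
          p.coeff k * ∫ v in Ioi (0 : ℝ), Real.exp (-(k + 1) * v) * g v := by
    intro p g hg
    simp_rw [Polynomial.eval_eq_sum_range, Finset.sum_mul]
    rw [integral_finsetSum]
    · refine Finset.sum_congr rfl fun k _ => ?_
      rw [← integral_const_mul]
      congr 1
      ext v
      have : Real.exp (-(k + 1) * v) = Real.exp (-v) ^ k * Real.exp (-v) := by
        rw [← Real.exp_nat_mul, ← Real.exp_add]; ring_nf
      rw [this]; ring
    · intro k _
      exact integrableOn_comp_exp_mul (φ := fun u => p.coeff k * u ^ k) (by fun_prop) hg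
  have hpt : ∀ p : Polynomial ℝ,
      Tendsto (fun n => ∫ v in Ioi (0 : ℝ), p.eval (Real.exp (-v)) * (Real.exp (-v) * F n v)) l
        (𝓝 (∫ v in Ioi (0 : ℝ), p.eval (Real.exp (-v)) * (Real.exp (-v) * H v))) := by
    intro p
    rw [hpoly p H hH]
    refine (tendsto_finsetSum _ fun k _ => (hL k).const_mul (p.coeff k)).congr' ?_
    filter_upwards [hm, hF] with n hn1 hn2
    rw [hpoly p (F n) (integrableOn_exp_mul_of_le_one hn1 hn2)]
  -- replacing `φ` by a polynomial changes the integrals by little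
  have happrox : ∀ (p : Polynomial ℝ) (ε : ℝ), (∀ u ∈ Icc (0 : ℝ) 1, |p.eval u - φ u| < ε) →
      ∀ g : ℝ → ℝ, IntegrableOn g (Ioi 0) →
      |(∫ v in Ioi (0 : ℝ), p.eval (Real.exp (-v)) * g v) -
        ∫ v in Ioi (0 : ℝ), φ (Real.exp (-v)) * g v| ≤ ε * ∫ v in Ioi (0 : ℝ), |g v| := by
    intro p ε hp g hg
    rw [← integral_sub (integrableOn_comp_exp_mul p.continuous hg) (integrableOn_comp_exp_mul hφ hg),
      ← integral_const_mul, ← Real.norm_eq_abs]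
    refine norm_integral_le_of_norm_le (hg.abs.const_mul ε) ?_
    filter_upwards [ae_restrict_mem measurableSet_Ioi] with v hv
    rw [← sub_mul, norm_mul, Real.norm_eq_abs, Real.norm_eq_abs]
    exact mul_le_mul_of_nonneg_right (hp _ (exp_neg_mem_Icc hv)).le (abs_nonneg _)
  rw [Metric.tendsto_nhds]
  intro ε hε
  set A := ∫ v in Ioi (0 : ℝ), |Real.exp (-v) * H v|
  have hA : 0 ≤ A := integral_nonneg fun _ => abs_nonneg _
  obtain ⟨p, hp⟩ := exists_polynomial_near_of_continuousOn 0 1 φ hφ.continuousOn (ε / (2 * (2 + A)))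
    (by positivity)
  filter_upwards [hm, hF, Metric.tendsto_nhds.1 (hpt p) (ε / 2) (by positivity)] with n h1 h2 h3
  have hi := integrableOn_exp_mul_of_le_one h1 h2
  have a1 := happrox p _ hp _ hi
  have a2 := happrox p _ hp _ hH
  have a3 : ∫ v in Ioi (0 : ℝ), |Real.exp (-v) * F n v| ≤ 1 := by
    rw [← integral_exp_neg_Ioi_zero]
    refine setIntegral_mono_on hi.abs integrableOn_exp_neg_Ioi_zero measurableSet_Ioi fun v hv => ?_
    rw [abs_of_nonneg (mul_nonneg (Real.exp_pos _).le (h2 v hv).1)]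
    exact mul_le_of_le_one_right (Real.exp_pos _).le (h2 v hv).2
  have a4 : ε / (2 * (2 + A)) * ∫ v in Ioi (0 : ℝ), |Real.exp (-v) * F n v|
      ≤ ε / (2 * (2 + A)) := mul_le_of_le_one_right (by positivity) a3
  have a5 : ε / (2 * (2 + A)) + ε / (2 * (2 + A)) * A < ε / 2 := by
    have : ε / (2 * (2 + A)) + ε / (2 * (2 + A)) * A = ε / 2 * ((1 + A) / (2 + A)) := by
      field_simp
    rw [this]
    refine mul_lt_of_lt_one_right (by positivity) ?_
    rw [div_lt_one (by positivity)]; linarith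
  rw [Real.dist_eq] at h3 ⊢
  rw [abs_le] at a1 a2
  rw [abs_lt] at h3 ⊢
  constructor <;> linarith [a1.1, a1.2, a2.1, a2.2, h3.1, h3.2]

/-- A continuous bump on `(e^{-b}, e^{-a})`, which becomes a bump on `(a, b)` in the variable
`v = -log u`. -/
noncomputable def expWindow (a b u : ℝ) : ℝ :=
  max 0 ((u - Real.exp (-b)) * (Real.exp (-a) - u))

theorem continuous_expWindow (a b : ℝ) : Continuous (expWindow a b) := by
  unfold expWindow; fun_prop

theorem expWindow_nonneg (a b u : ℝ) : 0 ≤ expWindow a b u := le_max_left _ _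

theorem expWindow_eq_zero {a b v : ℝ} (hab : a ≤ b) (h : v ∉ Ioo a b) :
    expWindow a b (Real.exp (-v)) = 0 := by
  refine max_eq_left ?_
  rcases le_or_gt v a with h1 | h1
  · have e1 : Real.exp (-a) ≤ Real.exp (-v) := Real.exp_le_exp.2 (by linarith)
    have e2 : Real.exp (-b) ≤ Real.exp (-v) := Real.exp_le_exp.2 (by linarith)
    exact mul_nonpos_of_nonneg_of_nonpos (by linarith) (by linarith)
  · have h2 : b ≤ v := not_lt.1 fun h2 => h ⟨h1, h2⟩
    have e1 : Real.exp (-v) ≤ Real.exp (-a) := Real.exp_le_exp.2 (by linarith)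
    have e2 : Real.exp (-v) ≤ Real.exp (-b) := Real.exp_le_exp.2 (by linarith)
    exact mul_nonpos_of_nonpos_of_nonneg (by linarith) (by linarith)

theorem expWindow_pos {a b v : ℝ} (h : v ∈ Ioo a b) : 0 < expWindow a b (Real.exp (-v)) := by
  refine lt_max_of_lt_right (mul_pos ?_ ?_)
  · rw [sub_pos]; exact Real.exp_lt_exp.2 (by linarith [h.2])
  · rw [sub_pos]; exact Real.exp_lt_exp.2 (by linarith [h.1])

theorem integral_expWindow_pos {a b : ℝ} (ha : 0 ≤ a) (hab : a < b) :
    0 < ∫ v in Ioi (0 : ℝ), expWindow a b (Real.exp (-v)) * Real.exp (-v) := by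
  rw [setIntegral_pos_iff_support_of_nonneg_ae]
  · refine lt_of_lt_of_le ?_ (measure_mono (s := Ioo a b) fun v hv => ⟨?_, ?_⟩)
    · simpa using hab
    · exact (mul_pos (expWindow_pos hv) (Real.exp_pos _)).ne'
    · exact ha.trans_lt hv.1
  · exact ae_of_all _ fun v => mul_nonneg (expWindow_nonneg _ _ _) (Real.exp_pos _).le
  · exact integrableOn_comp_exp_mul (continuous_expWindow a b) integrableOn_exp_neg_Ioi_zero

theorem integral_expWindow_mono {a b : ℝ} (hab : a ≤ b) {f g : ℝ → ℝ}
    (hf : IntegrableOn (fun v => Real.exp (-v) * f v) (Ioi 0))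
    (hg : IntegrableOn (fun v => Real.exp (-v) * g v) (Ioi 0))
    (h : ∀ v, 0 < v → v ∈ Ioo a b → f v ≤ g v) :
    ∫ v in Ioi (0 : ℝ), expWindow a b (Real.exp (-v)) * (Real.exp (-v) * f v)
      ≤ ∫ v in Ioi (0 : ℝ), expWindow a b (Real.exp (-v)) * (Real.exp (-v) * g v) := by
  refine setIntegral_mono_on (integrableOn_comp_exp_mul (continuous_expWindow a b) hf)
    (integrableOn_comp_exp_mul (continuous_expWindow a b) hg) measurableSet_Ioi fun v hv => ?_
  by_cases hv' : v ∈ Ioo a b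
  · exact mul_le_mul_of_nonneg_left (mul_le_mul_of_nonneg_left (h v hv hv') (Real.exp_pos _).le)
      (expWindow_nonneg _ _ _)
  · rw [expWindow_eq_zero hab hv']; simp

theorem integral_expWindow_const (a b K : ℝ) :
    ∫ v in Ioi (0 : ℝ), expWindow a b (Real.exp (-v)) * (Real.exp (-v) * K)
      = (∫ v in Ioi (0 : ℝ), expWindow a b (Real.exp (-v)) * Real.exp (-v)) * K := by
  rw [← integral_mul_const]; simp only [mul_assoc]

/-- A family of functions `F t v` with values in `[0, 1]`, read as the probability of an event
attached to the interval `[v, v + t]`, is *nested* if it decreases in the interval. -/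
structure IsNested (F : ℝ → ℝ → ℝ) : Prop where
  aestronglyMeasurable : ∀ t, 0 < t → AEStronglyMeasurable (F t) (volume.restrict (Ioi 0))
  nonneg : ∀ t v, 0 < t → 0 < v → 0 ≤ F t v
  le_one : ∀ t v, 0 < t → 0 < v → F t v ≤ 1
  mono : ∀ t v t' v', 0 < t' → 0 < v → v ≤ v' → v' + t' ≤ v + t → F t v ≤ F t' v'

/-- A Tauberian theorem: for nested functions, convergence of the Laplace transforms in `v` at the
positive integers to those of a continuous limit implies pointwise convergence. Nestedness
sandwiches `F t v` between local averages of `F (t ± δ)` over windows next to `v`. -/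
theorem tendsto_of_laplace_of_isNested {ι : Type*} {l : Filter ι} {F : ι → ℝ → ℝ → ℝ}
    {H : ℝ → ℝ → ℝ} (hF : ∀ᶠ n in l, IsNested (F n))
    (hH : ∀ t, 0 < t → IntegrableOn (fun v => Real.exp (-v) * H t v) (Ioi 0))
    (hL : ∀ t, 0 < t → ∀ k : ℕ,
      Tendsto (fun n => ∫ v in Ioi (0 : ℝ), Real.exp (-(k + 1) * v) * F n t v) l
        (𝓝 (∫ v in Ioi (0 : ℝ), Real.exp (-(k + 1) * v) * H t v)))
    {t₀ v₀ : ℝ} (ht₀ : 0 < t₀) (hv₀ : 0 < v₀)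
    (hc : ContinuousAt (fun p : ℝ × ℝ => H p.1 p.2) (t₀, v₀)) :
    Tendsto (fun n => F n t₀ v₀) l (𝓝 (H t₀ v₀)) := by
  rw [Metric.tendsto_nhds]
  intro ε hε
  obtain ⟨η, hη, hηc⟩ := Metric.continuousAt_iff.1 hc (ε / 2) (by positivity)
  obtain ⟨δ, hδ0, hδη, hδt, hδv⟩ : ∃ δ : ℝ, 0 < δ ∧ δ < η ∧ δ < t₀ ∧ δ < v₀ := by
    obtain ⟨δ, h0, h1⟩ := exists_between (lt_min hη (lt_min ht₀ hv₀))
    exact ⟨δ, h0, h1.trans_le (min_le_left _ _),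
      h1.trans_le ((min_le_right _ _).trans (min_le_left _ _)),
      h1.trans_le ((min_le_right _ _).trans (min_le_right _ _))⟩
  have hclose : ∀ t v, |t - t₀| ≤ δ → |v - v₀| ≤ δ → |H t v - H t₀ v₀| < ε / 2 := by
    intro t v h1 h2
    have := @hηc (t, v) (by
      rw [Prod.dist_eq, max_lt_iff, Real.dist_eq, Real.dist_eq]
      exact ⟨h1.trans_lt hδη, h2.trans_lt hδη⟩)
    rwa [Real.dist_eq] at this
  have hconst : ∀ K : ℝ, IntegrableOn (fun v => Real.exp (-v) * K) (Ioi 0) := fun K =>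
    integrableOn_exp_neg_Ioi_zero.mul_const K
  have hconv : ∀ t, 0 < t → ∀ a b, Tendsto (fun n => ∫ v in Ioi (0 : ℝ),
      expWindow a b (Real.exp (-v)) * (Real.exp (-v) * F n t v)) l
      (𝓝 (∫ v in Ioi (0 : ℝ), expWindow a b (Real.exp (-v)) * (Real.exp (-v) * H t v))) := by
    intro t ht a b
    refine tendsto_integral_comp_exp_of_laplace ?_ ?_ (hH t ht) (hL t ht) (continuous_expWindow a b)
    · filter_upwards [hF] with n hn using hn.aestronglyMeasurable t ht
    · filter_upwards [hF] with n hn using fun v hv => ⟨hn.nonneg t v ht hv, hn.le_one t v ht hv⟩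
  have hup : ∀ᶠ n in l, F n t₀ v₀ < H t₀ v₀ + ε := by
    set c := ∫ v in Ioi (0 : ℝ), expWindow v₀ (v₀ + δ) (Real.exp (-v)) * Real.exp (-v)
    have hc0 : 0 < c := integral_expWindow_pos hv₀.le (by linarith)
    have h1 : ∫ v in Ioi (0 : ℝ), expWindow v₀ (v₀ + δ) (Real.exp (-v)) *
        (Real.exp (-v) * H (t₀ - δ) v) ≤ c * (H t₀ v₀ + ε / 2) := by
      rw [← integral_expWindow_const]
      refine integral_expWindow_mono (by linarith) (hH _ (by linarith)) (hconst _) fun v _ hv => ?_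
      have := hclose (t₀ - δ) v (by rw [abs_le]; constructor <;> linarith)
        (by rw [abs_le]; constructor <;> linarith [hv.1, hv.2])
      linarith [(abs_lt.1 this).2]
    have h2 := (hconv (t₀ - δ) (by linarith) v₀ (v₀ + δ)).eventually_lt_const
      (show _ < c * (H t₀ v₀ + ε) from h1.trans_lt (by gcongr; linarith))
    filter_upwards [hF, h2] with n hn h3
    have h4 : c * F n t₀ v₀ ≤ ∫ v in Ioi (0 : ℝ), expWindow v₀ (v₀ + δ) (Real.exp (-v)) *
        (Real.exp (-v) * F n (t₀ - δ) v) := by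
      rw [← integral_expWindow_const]
      refine integral_expWindow_mono (by linarith) (hconst _) (integrableOn_exp_mul_of_le_one
        (hn.aestronglyMeasurable _ (by linarith)) fun v hv =>
        ⟨hn.nonneg _ _ (by linarith) hv, hn.le_one _ _ (by linarith) hv⟩) fun v _ hv => ?_
      exact hn.mono _ _ _ _ (by linarith) hv₀ hv.1.le (by linarith [hv.2])
    exact lt_of_mul_lt_mul_left (h4.trans_lt h3) hc0.le
  have hlow : ∀ᶠ n in l, H t₀ v₀ - ε < F n t₀ v₀ := by
    set c := ∫ v in Ioi (0 : ℝ), expWindow (v₀ - δ) v₀ (Real.exp (-v)) * Real.exp (-v)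
    have hc0 : 0 < c := integral_expWindow_pos (by linarith) (by linarith)
    have h1 : c * (H t₀ v₀ - ε / 2) ≤ ∫ v in Ioi (0 : ℝ), expWindow (v₀ - δ) v₀ (Real.exp (-v)) *
        (Real.exp (-v) * H (t₀ + δ) v) := by
      rw [← integral_expWindow_const]
      refine integral_expWindow_mono (by linarith) (hconst _) (hH _ (by linarith)) fun v _ hv => ?_
      have := hclose (t₀ + δ) v (by rw [abs_le]; constructor <;> linarith)
        (by rw [abs_le]; constructor <;> linarith [hv.1, hv.2])
      linarith [(abs_lt.1 this).1]
    have h2 := (hconv (t₀ + δ) (by linarith) (v₀ - δ) v₀).eventually_const_lt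
      (show c * (H t₀ v₀ - ε) < _ from lt_of_lt_of_le (by gcongr; linarith) h1)
    filter_upwards [hF, h2] with n hn h3
    have h4 : ∫ v in Ioi (0 : ℝ), expWindow (v₀ - δ) v₀ (Real.exp (-v)) *
        (Real.exp (-v) * F n (t₀ + δ) v) ≤ c * F n t₀ v₀ := by
      rw [← integral_expWindow_const]
      refine integral_expWindow_mono (by linarith) (integrableOn_exp_mul_of_le_one
        (hn.aestronglyMeasurable _ (by linarith)) fun v hv =>
        ⟨hn.nonneg _ _ (by linarith) hv, hn.le_one _ _ (by linarith) hv⟩) (hconst _) fun v h0 hv => ?_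
      exact hn.mono _ _ _ _ ht₀ h0 hv.2.le (by linarith [hv.1])
    exact lt_of_mul_lt_mul_left (h3.trans_le h4) hc0.le
  filter_upwards [hup, hlow] with n h1 h2
  rw [Real.dist_eq, abs_lt]
  constructor <;> linarith

/-! ### Integrals along the contour -/

section
variable {f g : ℂ → ℂ}

theorem add_I_mem_gammaInf {a : ℝ} (ha : a ∈ Ioi (-1 : ℝ)) : (a + Complex.I : ℂ) ∈ gammaInf :=
  Or.inl ⟨by simpa using le_of_lt ha, Or.inl (by simp)⟩

theorem sub_I_mem_gammaInf {a : ℝ} (ha : a ∈ Ioi (-1 : ℝ)) : (a - Complex.I : ℂ) ∈ gammaInf :=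
  Or.inl ⟨by simpa using le_of_lt ha, Or.inr (by simp)⟩

theorem neg_one_add_mem_gammaInf {b : ℝ} (hb : b ∈ Icc (-1 : ℝ) 1) :
    (-1 + b * Complex.I : ℂ) ∈ gammaInf :=
  Or.inr ⟨by simp, by simpa [abs_le] using hb⟩

theorem integralGammaInf_congr (h : ∀ z ∈ gammaInf, f z = g z) :
    integralGammaInf f = integralGammaInf g := by
  unfold integralGammaInf
  rw [setIntegral_congr_fun measurableSet_Ioi fun a ha => h _ (add_I_mem_gammaInf ha),
    setIntegral_congr_fun measurableSet_Ioi fun a ha => h _ (sub_I_mem_gammaInf ha),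
    intervalIntegral.integral_congr fun b hb => h _ (neg_one_add_mem_gammaInf (by simpa using hb))]

theorem integralGammaInf_const_mul (c : ℂ) (f : ℂ → ℂ) :
    integralGammaInf (fun z => c * f z) = c * integralGammaInf f := by
  unfold integralGammaInf
  rw [integral_const_mul, integral_const_mul, intervalIntegral.integral_const_mul]
  ring

theorem integralGammaInf_sum {ι : Type*} (s : Finset ι) (f : ι → ℂ → ℂ)
    (hf : ∀ i ∈ s, IntegrableOnGammaInf (f i)) :
    integralGammaInf (fun z => ∑ i ∈ s, f i z) = ∑ i ∈ s, integralGammaInf (f i) := by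
  unfold integralGammaInf
  rw [integral_finsetSum _ fun i hi => (hf i hi).1, integral_finsetSum _ fun i hi => (hf i hi).2.2,
    intervalIntegral.integral_finsetSum fun i hi => ?_]
  · rw [Finset.sum_add_distrib, Finset.sum_sub_distrib, Finset.sum_neg_distrib, Finset.mul_sum]
  · rw [intervalIntegrable_iff_integrableOn_Icc_of_le (by norm_num)]
    exact (hf i hi).2.1

theorem integrableOn_exp_neg_mul {κ : ℝ} (hκ : 0 < κ) (C a : ℝ) :
    IntegrableOn (fun v : ℝ => C * Real.exp (-κ * v)) (Ioi a) :=
  (integrableOn_exp_mul_Ioi (by linarith) a).const_mul C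

/-- Dominated convergence along the contour. -/
theorem tendsto_integralGammaInf {F : ℕ → ℂ → ℂ} (hF : ∀ n, Measurable (F n)) {κ C : ℝ}
    (hκ : 0 < κ) (hb : ∀ n, ∀ z ∈ gammaInf, ‖F n z‖ ≤ C * Real.exp (-κ * z.re))
    (hlim : ∀ z ∈ gammaInf, Tendsto (fun n => F n z) atTop (𝓝 (f z))) :
    IntegrableOnGammaInf f ∧
      Tendsto (fun n => integralGammaInf (F n)) atTop (𝓝 (integralGammaInf f)) := by
  have hbf : ∀ z ∈ gammaInf, ‖f z‖ ≤ C * Real.exp (-κ * z.re) := fun z hz =>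
    le_of_tendsto' (hlim z hz).norm fun n => hb n z hz
  have key : ∀ (p : ℝ → ℂ) (S : Set ℝ), Measurable p → MeasurableSet S → (∀ a ∈ S, p a ∈ gammaInf) →
      IntegrableOn (fun a => C * Real.exp (-κ * (p a).re)) S →
      IntegrableOn (fun a => f (p a)) S ∧
      Tendsto (fun n => ∫ a in S, F n (p a)) atTop (𝓝 (∫ a in S, f (p a))) := by
    intro p S hp hS hpS hi
    have hl : ∀ᵐ a ∂(volume.restrict S), Tendsto (fun n => F n (p a)) atTop (𝓝 (f (p a))) := by
      filter_upwards [ae_restrict_mem hS] with a ha using hlim _ (hpS a ha)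
    have hm : ∀ n, AEStronglyMeasurable (fun a => F n (p a)) (volume.restrict S) := fun n =>
      ((hF n).comp hp).aestronglyMeasurable
    refine ⟨Integrable.mono' hi (aestronglyMeasurable_of_tendsto_ae _ hm hl) ?_,
      tendsto_integral_of_dominated_convergence _ hm hi (fun n => ?_) hl⟩
    · filter_upwards [ae_restrict_mem hS] with a ha using hbf _ (hpS a ha)
    · filter_upwards [ae_restrict_mem hS] with a ha using hb n _ (hpS a ha)
  obtain ⟨i1, t1⟩ := key (fun a : ℝ => (a + Complex.I : ℂ)) (Ioi (-1)) (by fun_prop)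
    measurableSet_Ioi (fun a ha => add_I_mem_gammaInf ha)
    (by simpa using integrableOn_exp_neg_mul hκ C (-1))
  obtain ⟨i2, t2⟩ := key (fun b : ℝ => (-1 + b * Complex.I : ℂ)) (Icc (-1) 1) (by fun_prop)
    measurableSet_Icc (fun a ha => neg_one_add_mem_gammaInf ha)
    (Continuous.integrableOn_Icc (by fun_prop))
  obtain ⟨i3, t3⟩ := key (fun a : ℝ => (a - Complex.I : ℂ)) (Ioi (-1)) (by fun_prop)
    measurableSet_Ioi (fun a ha => sub_I_mem_gammaInf ha)
    (by simpa using integrableOn_exp_neg_mul hκ C (-1))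
  refine ⟨⟨i1, i2, i3⟩, ?_⟩
  have e : ∀ h : ℂ → ℂ, ∫ b in (-1 : ℝ)..1, h (-1 + b * Complex.I)
      = ∫ b in Icc (-1 : ℝ) 1, h (-1 + b * Complex.I) := fun h => by
    rw [intervalIntegral.integral_of_le (by norm_num), integral_Icc_eq_integral_Ioc]
  unfold integralGammaInf
  simp only [e]
  exact (t1.neg.sub (t2.const_mul _)).add t3

end

theorem norm_exp_neg_mul (v : ℝ) (z : ℂ) : ‖Complex.exp (-v * z)‖ = Real.exp (-v * z.re) := by
  rw [Complex.norm_exp]; simp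

theorem gammaInf_re {z : ℂ} (hz : z ∈ gammaInf) : -1 ≤ z.re := by
  rcases hz with h | h
  · exact h.1
  · exact h.1.ge

/-- The contour keeps distance at least `1` from the half-line `[0, ∞)`. -/
theorem one_le_norm_sub {z : ℂ} (hz : z ∈ gammaInf) {μ : ℝ} (hμ : 0 ≤ μ) : 1 ≤ ‖(μ : ℂ) - z‖ := by
  rcases hz with ⟨_, h⟩ | ⟨h, _⟩
  · refine le_trans ?_ (Complex.abs_im_le_norm _)
    rcases h with h | h <;> simp [h]
  · refine le_trans ?_ (Complex.abs_re_le_norm _)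
    rw [Complex.sub_re, Complex.ofReal_re, h, abs_of_nonneg (by linarith)]
    linarith

theorem one_le_norm_of_mem_gammaInf {z : ℂ} (hz : z ∈ gammaInf) : 1 ≤ ‖z‖ := by
  simpa using one_le_norm_sub hz le_rfl

/-- The winding number of a rectangle around an interior point `0`. -/
theorem integral_boundary_rect_inv {a b : ℝ} (ha : 0 < a) (hb : 0 < b) :
    (∫ s in (-a)..b, ((s - Complex.I : ℂ))⁻¹) - (∫ s in (-a)..b, ((s + Complex.I : ℂ))⁻¹)
      + Complex.I * (∫ y in (-1 : ℝ)..1, ((b + y * Complex.I : ℂ))⁻¹)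
      - Complex.I * (∫ y in (-1 : ℝ)..1, ((-a + y * Complex.I : ℂ))⁻¹)
      = 2 * Real.pi * Complex.I := by
  have ne : ∀ z : ℂ, (0 < z.re ∨ z.im ≠ 0) → z ≠ 0 := by
    rintro z h rfl; simp at h
  have h1 : ∫ s in (-a)..b, ((s - Complex.I : ℂ))⁻¹
      = Complex.log (b - Complex.I) - Complex.log (-a - Complex.I) := by
    have := intervalIntegral.integral_eq_sub_of_hasDerivAt (a := -a) (b := b)
      (f := fun s : ℝ => Complex.log (s - Complex.I)) (f' := fun s : ℝ => ((s - Complex.I : ℂ))⁻¹)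
      (fun s _ => by
        have hd : HasDerivAt (fun s : ℝ => (s - Complex.I : ℂ)) 1 s :=
          (Complex.ofRealCLM.hasDerivAt (x := s)).sub_const _
        simpa using hd.clog_real (Or.inr (by simp)))
      (ContinuousOn.intervalIntegrable (ContinuousOn.inv₀ (by fun_prop)
        fun s _ => ne _ (Or.inr (by simp))))
    simpa using this
  have h2 : ∫ s in (-a)..b, ((s + Complex.I : ℂ))⁻¹
      = Complex.log (b + Complex.I) - Complex.log (-a + Complex.I) := by
    have := intervalIntegral.integral_eq_sub_of_hasDerivAt (a := -a) (b := b)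
      (f := fun s : ℝ => Complex.log (s + Complex.I)) (f' := fun s : ℝ => ((s + Complex.I : ℂ))⁻¹)
      (fun s _ => by
        have hd : HasDerivAt (fun s : ℝ => (s + Complex.I : ℂ)) 1 s :=
          (Complex.ofRealCLM.hasDerivAt (x := s)).add_const _
        simpa using hd.clog_real (Or.inr (by simp)))
      (ContinuousOn.intervalIntegrable (ContinuousOn.inv₀ (by fun_prop)
        fun s _ => ne _ (Or.inr (by simp))))
    simpa using this
  have h3 : Complex.I * ∫ y in (-1 : ℝ)..1, ((b + y * Complex.I : ℂ))⁻¹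
      = Complex.log (b + Complex.I) - Complex.log (b - Complex.I) := by
    rw [← intervalIntegral.integral_const_mul]
    have := intervalIntegral.integral_eq_sub_of_hasDerivAt (a := -1) (b := 1)
      (f := fun y : ℝ => Complex.log (b + y * Complex.I))
      (f' := fun y : ℝ => Complex.I * ((b + y * Complex.I : ℂ))⁻¹)
      (fun y _ => by
        have hd : HasDerivAt (fun y : ℝ => (b + y * Complex.I : ℂ)) Complex.I y := by
          simpa using ((Complex.ofRealCLM.hasDerivAt (x := y)).mul_const Complex.I).const_add (b : ℂ)
        simpa [div_eq_mul_inv] using hd.clog_real (Or.inl (by simpa using hb)))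
      (ContinuousOn.intervalIntegrable (ContinuousOn.mul continuousOn_const
        (ContinuousOn.inv₀ (by fun_prop) fun y _ => ne _ (Or.inl (by simpa using hb)))))
    simpa [sub_eq_add_neg] using this
  -- on the left edge the branch `log (-z)` has to be used
  have h4 : Complex.I * ∫ y in (-1 : ℝ)..1, ((-a + y * Complex.I : ℂ))⁻¹
      = Complex.log (a - Complex.I) - Complex.log (a + Complex.I) := by
    rw [← intervalIntegral.integral_const_mul]
    have := intervalIntegral.integral_eq_sub_of_hasDerivAt (a := -1) (b := 1)
      (f := fun y : ℝ => Complex.log (a - y * Complex.I))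
      (f' := fun y : ℝ => Complex.I * ((-a + y * Complex.I : ℂ))⁻¹)
      (fun y _ => by
        have hd : HasDerivAt (fun y : ℝ => (a - y * Complex.I : ℂ)) (-Complex.I) y := by
          simpa using ((Complex.ofRealCLM.hasDerivAt (x := y)).mul_const Complex.I).const_sub (a : ℂ)
        have h := hd.clog_real (Or.inl (by simpa using ha))
        have e : (a - y * Complex.I : ℂ) = -(-a + y * Complex.I) := by ring
        convert! h using 1
        rw [e, neg_div_neg_eq, div_eq_mul_inv])
      (ContinuousOn.intervalIntegrable (ContinuousOn.mul continuousOn_const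
        (ContinuousOn.inv₀ (by fun_prop) fun y _ => by
          have e : (-a + y * Complex.I : ℂ) = -(a - y * Complex.I) := by ring
          rw [e]
          exact neg_ne_zero.2 (ne _ (Or.inl (by simpa using ha))))))
    simpa [sub_eq_add_neg] using this
  have l1 : Complex.log (-a + Complex.I) = Complex.log (a - Complex.I) + Real.pi * Complex.I := by
    have e : (-a + Complex.I : ℂ) = -(a - Complex.I) := by ring
    rw [e, Complex.log, Complex.log, norm_neg, Complex.arg_neg_eq_arg_add_pi_of_im_neg (by simp)]
    push_cast; ring
  have l2 : Complex.log (-a - Complex.I) = Complex.log (a + Complex.I) - Real.pi * Complex.I := by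
    have e : (-a - Complex.I : ℂ) = -(a + Complex.I) := by ring
    rw [e, Complex.log, Complex.log, norm_neg, Complex.arg_neg_eq_arg_sub_pi_of_im_pos (by simp)]
    push_cast; ring
  rw [h1, h2, h3, h4, l1, l2]
  ring

theorem integrableOnGammaInf_exp_div {v : ℝ} (hv : 0 < v) {μ : ℝ} (hμ : 0 ≤ μ) :
    IntegrableOnGammaInf (fun z => Complex.exp (-v * z) / (z - μ)) := by
  refine (tendsto_integralGammaInf (F := fun _ z => Complex.exp (-v * z) / (z - μ))
    (fun _ => by fun_prop) hv (C := 1) (fun _ z hz => ?_) fun z _ => tendsto_const_nhds).1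
  rw [norm_div, norm_exp_neg_mul, norm_sub_rev, one_mul]
  exact div_le_self (Real.exp_pos _).le (one_le_norm_sub hz hμ)

/-- The residue theorem for a simple pole enclosed by the contour. -/
theorem integralGammaInf_exp_div {v : ℝ} (hv : 0 < v) {μ : ℝ} (hμ : 0 ≤ μ) :
    integralGammaInf (fun z => Complex.exp (-v * z) / (z - μ))
      = 2 * Real.pi * Complex.I * Complex.exp (-v * μ) := by
  obtain ⟨i1, i2, i3⟩ := integrableOnGammaInf_exp_div hv hμ
  set f : ℂ → ℂ := fun z => Complex.exp (-v * z) / (z - μ) with hf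
  set e : ℂ → ℂ := fun z => Complex.exp (-v * z) with he
  have hrect : ∀ R : ℝ, μ + 1 ≤ R →
      (∫ s in (-1 : ℝ)..R, f (s - Complex.I)) - (∫ s in (-1 : ℝ)..R, f (s + Complex.I))
      + Complex.I * (∫ y in (-1 : ℝ)..1, f (R + y * Complex.I))
      - Complex.I * (∫ y in (-1 : ℝ)..1, f (-1 + y * Complex.I))
      = 2 * Real.pi * Complex.I * e μ := by
    intro R hR
    -- subtracting the singular part leaves the entire function `dslope e μ`, whose boundary
    -- integral vanishes
    have hd : Differentiable ℂ (dslope e μ) := by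
      have h := (Complex.differentiableOn_dslope (f := e) (c := (μ : ℂ)) (s := univ)
        Filter.univ_mem).2 (by fun_prop : Differentiable ℂ e).differentiableOn
      exact differentiableOn_univ.1 h
    have h0 := Complex.integral_boundary_rect_eq_zero_of_differentiableOn (dslope e μ)
      (-1 - Complex.I) (R + Complex.I) hd.differentiableOn
    simp only [Complex.sub_re, Complex.neg_re, Complex.one_re, Complex.I_re, Complex.sub_im,
      Complex.neg_im, Complex.one_im, Complex.I_im, Complex.add_re, Complex.ofReal_re,
      Complex.add_im, Complex.ofReal_im, sub_zero, neg_zero, zero_sub, zero_add, add_zero,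
      Complex.ofReal_neg, Complex.ofReal_one, neg_mul, one_mul, ← sub_eq_add_neg, smul_eq_mul] at h0
    have hsplit : ∀ z : ℂ, z ≠ μ → f z = dslope e μ z + e μ * (z - μ)⁻¹ := by
      intro z hz
      rw [dslope_of_ne _ hz, slope_def_field]
      simp only [hf, div_eq_mul_inv]
      ring
    have hint : ∀ (p : ℝ → ℂ) (a b : ℝ), Continuous p → (∀ s ∈ uIcc a b, p s ≠ μ) →
        ∫ s in a..b, f (p s)
          = (∫ s in a..b, dslope e μ (p s)) + e μ * ∫ s in a..b, (p s - μ)⁻¹ := by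
      intro p a b hp hne
      rw [intervalIntegral.integral_congr fun s hs => hsplit (p s) (hne s hs),
        intervalIntegral.integral_add, intervalIntegral.integral_const_mul]
      · exact (hd.continuous.comp hp).intervalIntegrable _ _
      · refine (ContinuousOn.mul continuousOn_const (ContinuousOn.inv₀ (by fun_prop) ?_)).intervalIntegrable
        exact fun s hs => sub_ne_zero.2 (hne s hs)
    rw [hint (fun s => s - Complex.I) _ _ (by fun_prop)
        fun s _ h => by simpa using congrArg Complex.im h,
      hint (fun s => s + Complex.I) _ _ (by fun_prop)
        fun s _ h => by simpa using congrArg Complex.im h,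
      hint (fun y => R + y * Complex.I) _ _ (by fun_prop)
        fun s _ h => by have := congrArg Complex.re h; simp at this; linarith,
      hint (fun y => -1 + y * Complex.I) _ _ (by fun_prop)
        fun s _ h => by have := congrArg Complex.re h; simp at this; linarith]
    have hw := integral_boundary_rect_inv (a := 1 + μ) (b := R - μ) (by linarith) (by linarith)
    have c1 : ∫ s in (-1 : ℝ)..R, ((s - Complex.I : ℂ) - μ)⁻¹
        = ∫ s in (-(1 + μ))..(R - μ), ((s - Complex.I : ℂ))⁻¹ := by
      have := intervalIntegral.integral_comp_sub_right (a := -1) (b := R)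
        (fun s : ℝ => ((s - Complex.I : ℂ))⁻¹) μ
      rw [show -(1 + μ) = -1 - μ by ring, ← this]
      refine intervalIntegral.integral_congr fun s _ => ?_
      push_cast; ring_nf
    have c2 : ∫ s in (-1 : ℝ)..R, ((s + Complex.I : ℂ) - μ)⁻¹
        = ∫ s in (-(1 + μ))..(R - μ), ((s + Complex.I : ℂ))⁻¹ := by
      have := intervalIntegral.integral_comp_sub_right (a := -1) (b := R)
        (fun s : ℝ => ((s + Complex.I : ℂ))⁻¹) μ
      rw [show -(1 + μ) = -1 - μ by ring, ← this]
      refine intervalIntegral.integral_congr fun s _ => ?_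
      push_cast; ring_nf
    have c3 : ∀ y : ℝ, (R + y * Complex.I : ℂ) - μ = ((R - μ : ℝ) : ℂ) + y * Complex.I := by
      intro y; push_cast; ring
    have c4 : ∀ y : ℝ, (-1 + y * Complex.I : ℂ) - μ = -((1 + μ : ℝ) : ℂ) + y * Complex.I := by
      intro y; push_cast; ring
    simp only [c3, c4]
    rw [c1, c2]
    linear_combination h0 + e μ * hw
  have hR0 : Tendsto (fun R : ℝ => Complex.I * ∫ y in (-1 : ℝ)..1, f (R + y * Complex.I)) atTop
      (𝓝 0) := by
    rw [tendsto_zero_iff_norm_tendsto_zero]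
    have hz : Tendsto (fun R : ℝ => Real.exp (-v * R) * 2) atTop (𝓝 0) := by
      have : Tendsto (fun R : ℝ => Real.exp (-v * R)) atTop (𝓝 0) :=
        Real.tendsto_exp_comp_nhds_zero.2
          ((tendsto_const_mul_atBot_of_neg (by linarith)).2 tendsto_id)
      simpa using this.mul_const 2
    refine tendsto_of_tendsto_of_tendsto_of_le_of_le' tendsto_const_nhds hz
      (Eventually.of_forall fun _ => norm_nonneg _) ?_
    filter_upwards [eventually_ge_atTop (μ + 1)] with R hR
    rw [norm_mul, Complex.norm_I, one_mul]
    refine (intervalIntegral.norm_integral_le_of_norm_le_const (C := Real.exp (-v * R))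
      fun y _ => ?_).trans (by norm_num)
    simp only [hf]
    rw [norm_div, norm_exp_neg_mul]
    have : 1 ≤ ‖(R + y * Complex.I : ℂ) - μ‖ := by
      refine le_trans ?_ (Complex.abs_re_le_norm _)
      simp only [Complex.sub_re, Complex.add_re, Complex.ofReal_re, Complex.mul_re, Complex.I_re,
        mul_zero, Complex.ofReal_im, Complex.I_im, mul_one, sub_zero, add_zero]
      exact le_trans (by linarith) (le_abs_self _)
    refine (div_le_self (Real.exp_pos _).le this).trans (le_of_eq ?_)
    simp
  have t1 := intervalIntegral_tendsto_integral_Ioi (-1 : ℝ) i1 tendsto_id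
  have t3 := intervalIntegral_tendsto_integral_Ioi (-1 : ℝ) i3 tendsto_id
  have tt := ((t3.sub t1).add hR0).sub
    (tendsto_const_nhds (x := Complex.I * ∫ y in (-1 : ℝ)..1, f (-1 + y * Complex.I)))
  have tc : Tendsto (fun _ : ℝ => 2 * Real.pi * Complex.I * e μ) atTop
      (𝓝 (2 * Real.pi * Complex.I * e μ)) := tendsto_const_nhds
  have := tendsto_nhds_unique_of_eventuallyEq tt tc (by
    filter_upwards [eventually_ge_atTop (μ + 1)] with R hR using hrect R hR)
  rw [← this]
  unfold integralGammaInf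
  ring

/-! ### Partial fractions from the spectral theorem -/

/-- A real positive semidefinite matrix has a complete orthonormal system of eigenvectors, stated
in coordinates: `V k i` is the `i`-th coordinate of the `k`-th eigenvector. -/
theorem exists_orthonormal_eigenvectors {ι : Type*} [Fintype ι] [DecidableEq ι]
    {M : Matrix ι ι ℝ} (hM : M.PosSemidef) :
    ∃ (μ : ι → ℝ) (V : ι → ι → ℝ), (∀ k, 0 ≤ μ k) ∧
      (∀ k j, ∑ i, V k i * M i j = μ k * V k j) ∧
      ∀ i j, ∑ k, V k i * V k j = if i = j then 1 else 0 := by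
  have hH := hM.isHermitian
  refine ⟨hH.eigenvalues, fun k i => hH.eigenvectorBasis k i, hM.eigenvalues_nonneg, ?_, ?_⟩
  · intro k j
    have h1 := congrFun (hH.mulVec_eigenvectorBasis k) j
    simp only [Matrix.mulVec, dotProduct, Pi.smul_apply, smul_eq_mul] at h1
    rw [← h1]
    refine Finset.sum_congr rfl fun i _ => ?_
    have : M i j = M j i := by simpa using hH.apply j i
    rw [this, mul_comm]
  · intro i j
    have h1 := Unitary.coe_mul_star_self hH.eigenvectorUnitary
    have h2 := congrFun (congrFun h1 i) j
    rw [Matrix.mul_apply, Matrix.one_apply] at h2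
    rw [← h2]
    refine Finset.sum_congr rfl fun k _ => ?_
    simp [Matrix.star_apply, Matrix.IsHermitian.eigenvectorUnitary_apply]

/-- The Laplace transforms of the occupation probabilities are rational with simple poles on
`[0, ∞)`: up to the weights `√x_i` they are coefficients of the resolvent of the symmetric positive
semidefinite matrix `diag x - √x √xᵀ / N`. -/
theorem exists_partialFractions {ι : Type*} [Fintype ι] [Nonempty ι] (x : ι → ℝ)
    (hx : ∀ i, 0 < x i) :
    ∃ (μ : ι → ℝ) (u : ι → ι → ℝ), (∀ k, 0 ≤ μ k) ∧ ∀ (c : ι → ℝ) (z : ℂ), z ≠ 0 →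
      (∀ i, (x i : ℂ) - z ≠ 0) → (∀ k, z - (μ k : ℂ) ≠ 0) → ∑ i, 1 / ((x i : ℂ) - z) ≠ 0 →
      1 / z * ((∑ i, (c i : ℂ) / (x i - z)) / ∑ i, 1 / ((x i : ℂ) - z))
        = ∑ k, ((∑ i, c i * u i k : ℝ) : ℂ) / (z - μ k) := by
  classical
  set N : ℝ := (Fintype.card ι : ℝ) with hN
  have hN0 : 0 < N := by rw [hN]; exact_mod_cast Fintype.card_pos
  set y : ι → ℝ := fun i => Real.sqrt (x i) with hy
  have hy0 : ∀ i, 0 < y i := fun i => Real.sqrt_pos.2 (hx i)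
  have hyx : ∀ i, y i * y i = x i := fun i => Real.mul_self_sqrt (hx i).le
  set M : Matrix ι ι ℝ := Matrix.of fun i j => (if i = j then x i else 0) - y i * y j / N with hMdef
  have hM : M.PosSemidef := by
    refine Matrix.PosSemidef.of_dotProduct_mulVec_nonneg ?_ ?_
    · ext i j
      simp only [hMdef, Matrix.conjTranspose_apply, Matrix.of_apply, star_trivial]
      by_cases h : i = j
      · subst h; rfl
      · rw [if_neg h, if_neg (Ne.symm h), mul_comm]
    · intro q
      have h1 : star q ⬝ᵥ M.mulVec q = ∑ i, (y i * q i) ^ 2 - (∑ i, y i * q i) ^ 2 / N := by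
        simp only [dotProduct, Matrix.mulVec, hMdef, Matrix.of_apply, star_trivial, sub_mul,
          Finset.sum_sub_distrib, ite_mul, zero_mul, Finset.sum_ite_eq, Finset.mem_univ, if_true,
          mul_sub]
        congr 1
        · refine Finset.sum_congr rfl fun i _ => ?_
          rw [← hyx]; ring
        · rw [sq, Finset.sum_mul_sum, Finset.sum_div]
          refine Finset.sum_congr rfl fun i _ => ?_
          rw [Finset.mul_sum, Finset.sum_div]
          refine Finset.sum_congr rfl fun j _ => ?_
          ring
      rw [h1, sub_nonneg, div_le_iff₀ hN0, mul_comm]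
      exact sq_sum_le_card_mul_sum_sq
  obtain ⟨μ, V, hμ, hV1, hV2⟩ := exists_orthonormal_eigenvectors hM
  refine ⟨μ, fun i k => (∑ j, V k j * y j) * V k i / (y i * N), hμ, fun c z hz hxz hμz hD => ?_⟩
  set D := ∑ i, 1 / ((x i : ℂ) - z) with hDdef
  -- `q` solves `(M - z) q = y / N`
  set q : ι → ℂ := fun i => y i / (z * D * (z - x i)) with hq
  have hNc : (N : ℂ) ≠ 0 := by exact_mod_cast hN0.ne'
  have hzx : ∀ i, z - (x i : ℂ) ≠ 0 := fun i h => hxz i (by rw [← neg_sub, h, neg_zero])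
  have hyq : ∑ j, (y j : ℂ) * q j = -(N + z * D) / (z * D) := by
    have h1 : ∀ j, (y j : ℂ) * q j = -(1 / (z * D)) * (1 + z * (1 / ((x j : ℂ) - z))) := by
      intro j
      have e : (y j : ℂ) * y j = x j := by exact_mod_cast hyx j
      have h2 : z - (x j : ℂ) = -((x j : ℂ) - z) := by ring
      simp only [hq]
      rw [← mul_div_assoc, e, h2]
      have := hxz j
      field_simp
      ring
    simp_rw [h1]
    rw [← Finset.mul_sum, Finset.sum_add_distrib, ← Finset.mul_sum, ← hDdef]
    simp only [Finset.sum_const, Finset.card_univ, nsmul_eq_mul, mul_one]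
    rw [show ((Fintype.card ι : ℕ) : ℂ) = (N : ℂ) by simp [hN]]
    field_simp
  have hMq : ∀ i, ∑ j, (M i j : ℂ) * q j - z * q i = y i / N := by
    intro i
    have h1 : ∑ j, (M i j : ℂ) * q j = x i * q i - y i / N * ∑ j, (y j : ℂ) * q j := by
      simp only [hMdef, Matrix.of_apply]
      push_cast
      simp only [sub_mul, Finset.sum_sub_distrib, Finset.mul_sum]
      congr 1
      · rw [Finset.sum_eq_single i]
        · simp
        · intro j _ hj; simp [Ne.symm hj]
        · simp
      · refine Finset.sum_congr rfl fun j _ => by ring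
    rw [h1, hyq]
    have h2 : (x i : ℂ) * q i - z * q i = -(y i / (z * D)) := by
      simp only [hq]
      have := hzx i
      field_simp
      ring
    have h3 : (x i : ℂ) * q i - y i / N * (-(N + z * D) / (z * D)) - z * q i
        = (x i * q i - z * q i) + y i / N * ((N + z * D) / (z * D)) := by ring
    rw [h3, h2]
    field_simp
    ring
  have hVq : ∀ k, ∑ i, (V k i : ℂ) * q i = -((∑ j, V k j * y j : ℝ) : ℂ) / (N * (z - μ k)) := by
    intro k
    have h1 : ∑ i, (V k i : ℂ) * (∑ j, (M i j : ℂ) * q j - z * q i)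
        = (μ k - z) * ∑ i, (V k i : ℂ) * q i := by
      have h2 : ∑ i, (V k i : ℂ) * (∑ j, (M i j : ℂ) * q j)
          = ∑ j, (μ k * V k j : ℂ) * q j := by
        simp_rw [Finset.mul_sum]
        rw [Finset.sum_comm]
        refine Finset.sum_congr rfl fun j _ => ?_
        have h3 : (μ k * V k j : ℂ) = ∑ i, (V k i : ℂ) * M i j := by exact_mod_cast (hV1 k j).symm
        rw [h3, Finset.sum_mul]
        exact Finset.sum_congr rfl fun i _ => by ring
      simp only [mul_sub, Finset.sum_sub_distrib]
      rw [h2, sub_mul, Finset.mul_sum, Finset.mul_sum]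
      congr 1
      · exact Finset.sum_congr rfl fun i _ => by ring
      · exact Finset.sum_congr rfl fun i _ => by ring
    simp_rw [hMq] at h1
    have h4 : ∑ i, (V k i : ℂ) * (y i / N) = ((∑ j, V k j * y j : ℝ) : ℂ) / N := by
      push_cast
      rw [Finset.sum_div]
      exact Finset.sum_congr rfl fun i _ => by ring
    rw [h4] at h1
    have := hμz k
    rw [eq_div_iff (mul_ne_zero hNc this)]
    rw [div_eq_iff hNc] at h1
    linear_combination h1
  have hcq : 1 / z * ((∑ i, (c i : ℂ) / (x i - z)) / D) = -∑ i, (c i / y i : ℂ) * q i := by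
    rw [Finset.sum_div, Finset.mul_sum, ← Finset.sum_neg_distrib]
    refine Finset.sum_congr rfl fun i _ => ?_
    have h1 : (y i : ℂ) ≠ 0 := by exact_mod_cast (hy0 i).ne'
    have h2 : z - (x i : ℂ) = -((x i : ℂ) - z) := by ring
    have := hxz i
    simp only [hq]
    rw [h2]
    field_simp
  have hexp : ∀ i, q i = ∑ k, (V k i : ℂ) * ∑ j, (V k j : ℂ) * q j := by
    intro i
    simp_rw [Finset.mul_sum]
    rw [Finset.sum_comm]
    have : ∀ j, ∑ k, (V k i : ℂ) * (V k j * q j) = if i = j then q j else 0 := by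
      intro j
      have h3 : ∑ k, (V k i : ℂ) * V k j = if i = j then 1 else 0 := by
        have := congrArg (fun r : ℝ => (r : ℂ)) (hV2 i j)
        push_cast at this
        exact this.trans (by split_ifs <;> simp)
      simp_rw [← mul_assoc]
      rw [← Finset.sum_mul, h3]
      split_ifs <;> simp
    simp_rw [this]
    simp
  rw [hcq]
  have h5 : ∀ i, (c i / y i : ℂ) * q i = ∑ k, (c i / y i : ℂ) * (V k i *
      (-((∑ j, V k j * y j : ℝ) : ℂ) / (N * (z - μ k)))) := by
    intro i
    rw [hexp i, Finset.mul_sum]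
    simp_rw [hVq]
  simp_rw [h5]
  rw [Finset.sum_comm, ← Finset.sum_neg_distrib]
  refine Finset.sum_congr rfl fun k _ => ?_
  rw [← Finset.sum_neg_distrib]
  push_cast
  rw [Finset.sum_div]
  refine Finset.sum_congr rfl fun i _ => ?_
  have h1 : (y i : ℂ) ≠ 0 := by exact_mod_cast (hy0 i).ne'
  have := hμz k
  field_simp

/-! ### The walk on finitely many sites as a contour integral -/

theorem isNested_walkCorrelation (n : ℕ) {x : ℕ → ℝ} (hx : ∀ j, 0 < x j) :
    IsNested (walkCorrelation (n + 2) x) where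
  aestronglyMeasurable _ ht := aestronglyMeasurable_walkCorrelation hx ht.le
  nonneg t v _ _ := walkCorrelation_nonneg _ _ t v
  le_one t v _ _ := walkCorrelation_le_one _ _ t v
  mono _ _ _ _ ht _ h1 h2 := walkCorrelation_nested _ _ ht.le h1 h2

/-- The integrand of the contour integral for the walk on `n + 2` sites. -/
noncomputable def walkIntegrand (n : ℕ) (x : ℕ → ℝ) (t v : ℝ) (z : ℂ) : ℂ :=
  Complex.exp (-v * z) / z *
    ((∑ i ∈ Finset.range (n + 2), ((Real.exp (-exitRate n x i * t) : ℝ) : ℂ) / (x i - z)) /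
      ∑ i ∈ Finset.range (n + 2), 1 / ((x i : ℂ) - z))

theorem measurable_walkIntegrand (n : ℕ) (x : ℕ → ℝ) (t v : ℝ) :
    Measurable (walkIntegrand n x t v) := by
  unfold walkIntegrand
  fun_prop

section
variable {z : ℂ}

theorem ofReal_sub_ne_zero (hz : z ∈ gammaInf) {μ : ℝ} (hμ : 0 ≤ μ) : (μ : ℂ) - z ≠ 0 :=
  norm_pos_iff.1 (one_pos.trans_le (one_le_norm_sub hz hμ))

theorem norm_inv_sub_le (hz : z ∈ gammaInf) {y : ℝ} (hy : 0 < y) :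
    ‖1 / ((y : ℂ) - z)‖ ≤ (2 + ‖z‖) * y⁻¹ := by
  have h1 := one_le_norm_sub hz hy.le
  have h2 : y ≤ ‖(y : ℂ) - z‖ + ‖z‖ := by
    have := norm_add_le ((y : ℂ) - z) z
    rwa [sub_add_cancel, Complex.norm_real, Real.norm_eq_abs, abs_of_pos hy] at this
  rw [norm_div, norm_one, ← div_eq_mul_inv, div_le_div_iff₀ (by linarith) hy]
  nlinarith [norm_nonneg z]

/-- The denominator of the integrand is bounded below on the contour: the terms have imaginary
parts of the same sign on the horizontal edges and positive real parts on the vertical one. -/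
theorem le_norm_sum_inv_sub (hz : z ∈ gammaInf) {x : ℕ → ℝ} (hx : ∀ j, 0 < x j) {s : Finset ℕ}
    (hs : 0 ∈ s) : 1 / (x 0 + ‖z‖) ^ 2 ≤ ‖∑ i ∈ s, 1 / ((x i : ℂ) - z)‖ := by
  have hpos : ∀ i, 0 < Complex.normSq ((x i : ℂ) - z) := fun i =>
    Complex.normSq_pos.2 (ofReal_sub_ne_zero hz (hx i).le)
  have h0 : 1 / (x 0 + ‖z‖) ^ 2 ≤ 1 / Complex.normSq ((x 0 : ℂ) - z) := by
    refine one_div_le_one_div_of_le (hpos 0) ?_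
    rw [Complex.normSq_eq_norm_sq]
    refine pow_le_pow_left₀ (norm_nonneg _) ?_ 2
    have := norm_sub_le (x 0 : ℂ) z
    rwa [Complex.norm_real, Real.norm_eq_abs, abs_of_pos (hx 0)] at this
  have hsum : 1 / Complex.normSq ((x 0 : ℂ) - z) ≤ ∑ i ∈ s, 1 / Complex.normSq ((x i : ℂ) - z) :=
    Finset.single_le_sum (f := fun i => 1 / Complex.normSq ((x i : ℂ) - z))
      (fun i _ => (one_div_pos.2 (hpos i)).le) hs
  rcases hz with ⟨_, h⟩ | ⟨h, _⟩
  · refine h0.trans (hsum.trans (le_trans ?_ (Complex.abs_im_le_norm _)))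
    have : (∑ i ∈ s, 1 / ((x i : ℂ) - z)).im = z.im * ∑ i ∈ s, 1 / Complex.normSq ((x i : ℂ) - z) := by
      rw [Complex.im_sum, Finset.mul_sum]
      refine Finset.sum_congr rfl fun i _ => ?_
      rw [one_div, Complex.inv_im]
      simp [div_eq_mul_inv]
    rw [this, abs_mul]
    rcases h with h | h <;> simp [h, le_abs_self]
  · refine h0.trans (le_trans ?_ (Complex.abs_re_le_norm _))
    refine le_trans ?_ (le_abs_self _)
    rw [Complex.re_sum]
    have hre : ∀ i, (1 / ((x i : ℂ) - z)).re = (x i + 1) * (1 / Complex.normSq ((x i : ℂ) - z)) := by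
      intro i
      rw [one_div, Complex.inv_re]
      simp [h, div_eq_mul_inv]
    simp_rw [hre]
    refine hsum.trans (Finset.sum_le_sum fun i _ => ?_)
    exact le_mul_of_one_le_left (one_div_pos.2 (hpos i)).le (by linarith [hx i])

theorem one_div_add_norm_sq_pos (hz : z ∈ gammaInf) {y : ℝ} (hy : 0 < y) :
    0 < 1 / (y + ‖z‖) ^ 2 := by
  have := one_le_norm_of_mem_gammaInf hz
  positivity

end

/-- Both sides equal a sum of exponentials `b_k e^{-μ_k v}`: the left one because it has the same
Laplace transform, the right one by residues at the poles `μ_k`. -/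
theorem walkCorrelation_eq_integralGammaInf (n : ℕ) {x : ℕ → ℝ} (hx : ∀ j, 0 < x j) {t v : ℝ}
    (ht : 0 < t) (hv : 0 < v) :
    ((walkCorrelation (n + 2) x t v : ℝ) : ℂ)
      = 1 / (2 * Real.pi * Complex.I) * integralGammaInf (walkIntegrand n x t v) := by
  obtain ⟨μ, u, hμ, hpf⟩ := exists_partialFractions (fun i : Fin (n + 2) => x i) fun i => hx i
  set b : ℝ → Fin (n + 2) → ℝ := fun t k => ∑ i : Fin (n + 2), Real.exp (-exitRate n x i * t) * u i k with hb
  have hH : walkCorrelation (n + 2) x t v = ∑ k, b t k * Real.exp (-μ k * v) := by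
    have hint : ∀ s : ℝ, 0 < s → ∀ k, IntegrableOn (fun v => Real.exp (-(s + μ k) * v)) (Ioi 0) :=
      fun s hs k => integrableOn_exp_mul_Ioi (by linarith [hμ k]) 0
    have hexp : ∀ s t v : ℝ, Real.exp (-s * v) * ∑ k, b t k * Real.exp (-μ k * v)
        = ∑ k, b t k * Real.exp (-(s + μ k) * v) := by
      intro s t v
      rw [Finset.mul_sum]
      refine Finset.sum_congr rfl fun k _ => ?_
      rw [mul_left_comm, ← Real.exp_add]
      ring_nf
    -- uniqueness of the Laplace transform is the Tauberian theorem for a constant sequence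
    refine tendsto_nhds_unique (f := fun _ : ℕ => walkCorrelation (n + 2) x t v) (l := atTop)
      tendsto_const_nhds (tendsto_of_laplace_of_isNested
        (F := fun _ : ℕ => walkCorrelation (n + 2) x)
        (H := fun t v => ∑ k, b t k * Real.exp (-μ k * v))
        (Eventually.of_forall fun _ => isNested_walkCorrelation n hx) (fun t _ => ?_)
        (fun t ht k => ?_) ht hv ?_)
    · have := integrable_finsetSum Finset.univ fun k _ => (hint 1 one_pos k).const_mul (b t k)
      refine Integrable.congr this (ae_of_all _ fun v => ?_)
      have := hexp 1 t v
      simp only [neg_mul, one_mul] at this ⊢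
      exact this.symm
    · refine tendsto_const_nhds.congr fun _ => ?_
      have hs : (0 : ℝ) < k + 1 := by positivity
      rw [integral_exp_mul_walkCorrelation hx hs ht.le]
      simp_rw [hexp]
      rw [integral_finsetSum _ fun i _ => (hint _ hs i).const_mul _]
      have hpos : ∀ i : Fin (n + 2), (0 : ℝ) < x i + (k + 1) := fun i => by linarith [hx i]
      have hD : 0 < ∑ i : Fin (n + 2), 1 / (x i + ((k : ℝ) + 1)) :=
        Finset.sum_pos (fun i _ => one_div_pos.2 (hpos i)) Finset.univ_nonempty
      have e1 : ∀ i : Fin (n + 2), (x i : ℂ) - ((-(k + 1 : ℝ) : ℝ) : ℂ) = ((x i + (k + 1) : ℝ) : ℂ) := by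
        intro i; push_cast; ring
      have h := hpf (fun i => Real.exp (-exitRate n x i * t)) ((-(k + 1 : ℝ) : ℝ) : ℂ)
        (by exact_mod_cast (neg_neg_of_pos hs).ne)
        (fun i => by rw [e1]; exact_mod_cast (hpos i).ne')
        (fun i => by
          rw [← Complex.ofReal_sub]
          exact_mod_cast (by linarith [hμ i] : (-(k + 1 : ℝ) - μ i) < 0).ne)
        (by simp_rw [e1]; exact_mod_cast hD.ne')
      simp_rw [e1] at h
      have h' : 1 / (-(k + 1 : ℝ)) * ((∑ i : Fin (n + 2), Real.exp (-exitRate n x i * t) / (x i + (k + 1)))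
          / ∑ i : Fin (n + 2), 1 / (x i + ((k : ℝ) + 1)))
          = ∑ i, b t i / (-(k + 1 : ℝ) - μ i) := by exact_mod_cast h
      have h2 : ∀ i, ∫ v in Ioi (0 : ℝ), b t i * Real.exp (-((k : ℝ) + 1 + μ i) * v)
          = -(b t i / (-(k + 1 : ℝ) - μ i)) := by
        intro i
        have hne : (k : ℝ) + 1 + μ i ≠ 0 := by linarith [hμ i] |> fun h : (0 : ℝ) < _ => h.ne'
        rw [integral_const_mul, integral_exp_mul_Ioi (by linarith [hμ i])]
        simp only [mul_zero, Real.exp_zero]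
        rw [show (-(k + 1 : ℝ) - μ i) = -((k : ℝ) + 1 + μ i) by ring]
        field_simp
      simp_rw [h2]
      rw [Finset.sum_neg_distrib, ← h', one_div_mul_eq_div, div_neg, neg_neg, div_div, mul_comm]
    · simp only [hb]
      fun_prop
  have hI : integralGammaInf (walkIntegrand n x t v)
      = ∑ k, (b t k : ℂ) * (2 * Real.pi * Complex.I * Complex.exp (-v * μ k)) := by
    have h1 : ∀ z ∈ gammaInf, walkIntegrand n x t v z
        = ∑ k, (b t k : ℂ) * (Complex.exp (-v * z) / (z - μ k)) := by
      intro z hz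
      have h2 := hpf (fun i => Real.exp (-exitRate n x i * t)) z
        (norm_pos_iff.1 (one_pos.trans_le (one_le_norm_of_mem_gammaInf hz)))
        (fun i => ofReal_sub_ne_zero hz (hx i).le)
        (fun k => by
          rw [← neg_sub]; exact neg_ne_zero.2 (ofReal_sub_ne_zero hz (hμ k)))
        (by
          rw [Fin.sum_univ_eq_sum_range (fun i => 1 / ((x i : ℂ) - z))]
          exact norm_pos_iff.1 ((one_div_add_norm_sq_pos hz (hx 0)).trans_le
            (le_norm_sum_inv_sub hz hx (by simp))))
      rw [Fin.sum_univ_eq_sum_range (fun i => 1 / ((x i : ℂ) - z)),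
        Fin.sum_univ_eq_sum_range
          (fun i => ((Real.exp (-exitRate n x i * t) : ℝ) : ℂ) / ((x i : ℂ) - z))] at h2
      rw [walkIntegrand, div_eq_mul_one_div, mul_assoc, h2, Finset.mul_sum]
      refine Finset.sum_congr rfl fun k _ => ?_
      simp only [hb]
      ring
    have hi : ∀ k, IntegrableOnGammaInf
        (fun z => (b t k : ℂ) * (Complex.exp (-v * z) / (z - μ k))) := by
      intro k
      obtain ⟨a1, a2, a3⟩ := integrableOnGammaInf_exp_div hv (hμ k)
      exact ⟨a1.const_mul _, a2.const_mul _, a3.const_mul _⟩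
    rw [integralGammaInf_congr h1, integralGammaInf_sum _ _ fun k _ => hi k]
    refine Finset.sum_congr rfl fun k _ => ?_
    rw [integralGammaInf_const_mul, integralGammaInf_exp_div hv (hμ k)]
  rw [hI, hH, Finset.mul_sum]
  push_cast
  refine Finset.sum_congr rfl fun k _ => ?_
  have : (Real.pi : ℂ) ≠ 0 := by exact_mod_cast Real.pi_ne_zero
  have hII := Complex.I_ne_zero
  rw [show -(μ k : ℂ) * v = -v * μ k by ring]
  field_simp

/-! ### Infinitely many sites -/

theorem tendsto_sum_range_of_dominated {E : Type*} [NormedAddCommGroup E] [CompleteSpace E]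
    {g : ℕ → ℝ} (hg : Summable g) {f : ℕ → ℕ → E} {F : ℕ → E} (hb : ∀ n i, ‖f n i‖ ≤ g i)
    (hf : ∀ i, Tendsto (fun n => f n i) atTop (𝓝 (F i))) :
    Tendsto (fun n => ∑ i ∈ Finset.range (n + 2), f n i) atTop (𝓝 (∑' i, F i)) := by
  have h : Tendsto (fun n => ∑' i, if i < n + 2 then f n i else 0) atTop (𝓝 (∑' i, F i)) := by
    refine tendsto_tsum_of_dominated_convergence hg (fun i => ?_) (Eventually.of_forall fun n i => ?_)
    · refine (hf i).congr' ?_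
      filter_upwards [eventually_ge_atTop i] with n hn
      rw [if_pos (by omega)]
    · split_ifs
      · exact hb n i
      · simpa using (norm_nonneg _).trans (hb n i)
  refine h.congr fun n => ?_
  rw [tsum_eq_sum (s := Finset.range (n + 2))]
  · refine Finset.sum_congr rfl fun i hi => ?_
    rw [if_pos (Finset.mem_range.1 hi)]
  · intro i hi
    rw [if_neg (by simpa using hi)]

theorem tendsto_exitRate (x : ℕ → ℝ) (i : ℕ) :
    Tendsto (fun n => exitRate n x i) atTop (𝓝 (x i)) := by
  have h : Tendsto (fun n : ℕ => x i * (1 - 1 / ((n + 1 : ℕ) + 1 : ℝ))) atTop (𝓝 (x i * (1 - 0))) :=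
    (tendsto_const_nhds.sub ((tendsto_add_atTop_iff_nat 1).2
      tendsto_one_div_add_atTop_nhds_zero_nat)).const_mul _
  rw [sub_zero, mul_one] at h
  refine h.congr fun n => ?_
  unfold exitRate
  push_cast
  field_simp
  ring

theorem exp_neg_exitRate_le_one (n : ℕ) {x : ℕ → ℝ} {i : ℕ} (hx : 0 < x i) {t : ℝ} (ht : 0 ≤ t) :
    Real.exp (-exitRate n x i * t) ≤ 1 := by
  rw [Real.exp_le_one_iff]
  nlinarith [exitRate_pos n hx]

section
variable {x : ℕ → ℝ} (hx : ∀ j, 0 < x j) (hs : Summable fun j => (x j)⁻¹) {z : ℂ}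
include hx hs

theorem summable_inv_sub (hz : z ∈ gammaInf) : Summable fun j => 1 / ((x j : ℂ) - z) :=
  Summable.of_norm_bounded (hs.mul_left (2 + ‖z‖)) fun j => norm_inv_sub_le hz (hx j)

theorem summable_exp_div_sub (hz : z ∈ gammaInf) {t : ℝ} (ht : 0 ≤ t) :
    Summable fun j => Complex.exp (-(x j) * t) / ((x j : ℂ) - z) := by
  refine Summable.of_norm_bounded (hs.mul_left (2 + ‖z‖)) fun j => ?_
  rw [div_eq_mul_one_div, norm_mul, Complex.norm_exp]
  refine le_trans (mul_le_of_le_one_left (norm_nonneg _) ?_) (norm_inv_sub_le hz (hx j))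
  rw [Real.exp_le_one_iff]
  simp only [Complex.mul_re, Complex.neg_re, Complex.ofReal_re, Complex.neg_im, Complex.ofReal_im]
  nlinarith [hx j]

theorem tsum_inv_sub_ne_zero (hz : z ∈ gammaInf) : ∑' j, 1 / ((x j : ℂ) - z) ≠ 0 := by
  have h := (summable_inv_sub hx hs hz).hasSum.tendsto_sum_nat.norm
  have h2 : 1 / (x 0 + ‖z‖) ^ 2 ≤ ‖∑' j, 1 / ((x j : ℂ) - z)‖ := by
    refine ge_of_tendsto h ?_
    filter_upwards [eventually_ge_atTop 1] with n hn
    exact le_norm_sum_inv_sub hz hx (Finset.mem_range.2 hn)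
  exact norm_pos_iff.1 ((one_div_add_norm_sq_pos hz (hx 0)).trans_le h2)

end

/-- On the contour, polynomials are absorbed into the exponential decay. -/
theorem exists_exp_mul_pow_le {v : ℝ} (hv : 0 < v) {m : ℝ} (hm : 0 ≤ m) :
    ∃ C : ℝ, ∀ z ∈ gammaInf,
      Real.exp (-v * z.re) * (m + ‖z‖) ^ 3 ≤ C * Real.exp (-(v / 2) * z.re) := by
  refine ⟨(2 / v) ^ 3 * 6 * Real.exp (v / 2 * (m + 3)), fun z hz => ?_⟩
  have hre := gammaInf_re hz
  have him : |z.im| ≤ 1 := by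
    rcases hz with ⟨_, h | h⟩ | ⟨_, h⟩
    · simp [h]
    · simp [h]
    · exact h
  have hn : ‖z‖ ≤ z.re + 3 := by
    refine (Complex.norm_le_abs_re_add_abs_im z).trans ?_
    have : |z.re| ≤ z.re + 2 := abs_le.2 ⟨by linarith, by linarith⟩
    linarith
  set y := v / 2 * (z.re + (m + 3)) with hy
  have hy0 : 0 ≤ y := mul_nonneg (by linarith) (by linarith)
  have h1 : (m + ‖z‖) ^ 3 ≤ ((2 / v) * y) ^ 3 := by
    refine pow_le_pow_left₀ (by positivity) ?_ 3
    rw [hy]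
    field_simp
    linarith
  have h2 : y ^ 3 ≤ 6 * Real.exp y := by
    have := Real.pow_div_factorial_le_exp y hy0 3
    rw [div_le_iff₀ (by positivity)] at this
    norm_num [Nat.factorial] at this
    linarith
  calc Real.exp (-v * z.re) * (m + ‖z‖) ^ 3
      ≤ Real.exp (-v * z.re) * ((2 / v) ^ 3 * (6 * Real.exp y)) := by
        rw [mul_pow] at h1
        gcongr
        exact h1.trans (by gcongr)
    _ = (2 / v) ^ 3 * 6 * Real.exp (v / 2 * (m + 3)) * Real.exp (-(v / 2) * z.re) := by
        have : Real.exp (-v * z.re) * Real.exp y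
            = Real.exp (v / 2 * (m + 3)) * Real.exp (-(v / 2) * z.re) := by
          rw [← Real.exp_add, ← Real.exp_add, hy]; ring_nf
        linear_combination ((2 / v) ^ 3 * 6) * this

section
variable {x : ℕ → ℝ} (hx : ∀ j, 0 < x j) (hs : Summable fun j => (x j)⁻¹)
include hx hs

theorem norm_walkIntegrand_le (n : ℕ) {t : ℝ} (ht : 0 ≤ t) (v : ℝ) {z : ℂ} (hz : z ∈ gammaInf) :
    ‖walkIntegrand n x t v z‖
      ≤ (∑' j, (x j)⁻¹) * (Real.exp (-v * z.re) * (2 + x 0 + ‖z‖) ^ 3) := by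
  have hz1 := one_le_norm_of_mem_gammaInf hz
  have hx0 := hx 0
  have hS : 0 ≤ ∑' j, (x j)⁻¹ := tsum_nonneg fun j => (inv_pos.2 (hx j)).le
  have hnum : ‖∑ i ∈ Finset.range (n + 2),
      ((Real.exp (-exitRate n x i * t) : ℝ) : ℂ) / ((x i : ℂ) - z)‖
      ≤ (2 + ‖z‖) * ∑' j, (x j)⁻¹ := by
    refine (norm_sum_le_of_le _ (n := fun i => (2 + ‖z‖) * (x i)⁻¹) fun i _ => ?_).trans ?_
    · rw [div_eq_mul_one_div, norm_mul, Complex.norm_real, Real.norm_eq_abs,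
        abs_of_pos (Real.exp_pos _)]
      exact (mul_le_of_le_one_left (norm_nonneg _) (exp_neg_exitRate_le_one n (hx i) ht)).trans
        (norm_inv_sub_le hz (hx i))
    · rw [← Finset.mul_sum]
      exact mul_le_mul_of_nonneg_left (hs.sum_le_tsum _ fun j _ => (inv_pos.2 (hx j)).le)
        (by positivity)
  have hden := le_norm_sum_inv_sub hz hx (s := Finset.range (n + 2)) (by simp)
  have hden0 := one_div_add_norm_sq_pos hz (hx 0)
  have hquot : ‖(∑ i ∈ Finset.range (n + 2), ((Real.exp (-exitRate n x i * t) : ℝ) : ℂ) / (x i - z)) /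
      ∑ i ∈ Finset.range (n + 2), 1 / ((x i : ℂ) - z)‖
      ≤ ((2 + ‖z‖) * ∑' j, (x j)⁻¹) / (1 / (x 0 + ‖z‖) ^ 2) := by
    rw [norm_div]
    exact div_le_div₀ (by positivity) hnum hden0 hden
  rw [walkIntegrand, norm_mul, norm_div, norm_exp_neg_mul]
  calc _ ≤ Real.exp (-v * z.re) * (((2 + ‖z‖) * ∑' j, (x j)⁻¹) / (1 / (x 0 + ‖z‖) ^ 2)) :=
        mul_le_mul (div_le_self (Real.exp_pos _).le hz1) hquot (norm_nonneg _) (Real.exp_pos _).le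
    _ = (∑' j, (x j)⁻¹) * (Real.exp (-v * z.re) * ((2 + ‖z‖) * (x 0 + ‖z‖) ^ 2)) := by
        field_simp
    _ ≤ _ := by
        have key : (2 + ‖z‖) * (x 0 + ‖z‖) ^ 2 ≤ (2 + x 0 + ‖z‖) * (2 + x 0 + ‖z‖) ^ 2 := by
          gcongr <;> linarith
        rw [← pow_succ'] at key
        gcongr

theorem tendsto_walkIntegrand {t : ℝ} (ht : 0 ≤ t) (v : ℝ) {z : ℂ} (hz : z ∈ gammaInf) :
    Tendsto (fun n => walkIntegrand n x t v z) atTop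
      (𝓝 (Complex.exp (-v * z) / z *
        ((∑' j, Complex.exp (-(x j) * t) / ((x j : ℂ) - z)) / ∑' j, 1 / ((x j : ℂ) - z)))) := by
  unfold walkIntegrand
  refine (Tendsto.div ?_ ?_ (tsum_inv_sub_ne_zero hx hs hz)).const_mul _
  · refine tendsto_sum_range_of_dominated (hs.mul_left (2 + ‖z‖)) (fun n i => ?_) fun i => ?_
    · rw [div_eq_mul_one_div, norm_mul, Complex.norm_real, Real.norm_eq_abs,
        abs_of_pos (Real.exp_pos _)]
      exact (mul_le_of_le_one_left (norm_nonneg _) (exp_neg_exitRate_le_one n (hx i) ht)).trans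
        (norm_inv_sub_le hz (hx i))
    · refine Tendsto.div_const ?_ _
      have h1 : Tendsto (fun n => Real.exp (-exitRate n x i * t)) atTop
          (𝓝 (Real.exp (-x i * t))) :=
        (Real.continuous_exp.tendsto _).comp ((tendsto_exitRate x i).neg.mul_const t)
      have h2 := (Complex.continuous_ofReal.tendsto _).comp h1
      have e : ((Real.exp (-x i * t) : ℝ) : ℂ) = Complex.exp (-(x i) * t) := by push_cast; rfl
      rw [← e]
      exact h2
  · exact (tendsto_add_atTop_iff_nat 2).2 (summable_inv_sub hx hs hz).hasSum.tendsto_sum_nat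

/-- The correlation function of the walk on the first `N` sites converges as `N → ∞`. -/
theorem tendsto_walkCorrelation {α τ₀ t v : ℝ} (hτ₀ : 0 < τ₀) (ht : 0 < t) (hv : 0 < v) :
    IntegrableOnGammaInf (limitIntegrand α τ₀ x t v) ∧
      Tendsto (fun N => ((walkCorrelation N x t v : ℝ) : ℂ)) atTop
        (𝓝 (1 / (2 * Real.pi * Complex.I) * integralGammaInf (limitIntegrand α τ₀ x t v))) := by
  have hx0 := hx 0
  obtain ⟨C, hC⟩ := exists_exp_mul_pow_le hv (m := 2 + x 0) (by positivity)
  have hS : 0 ≤ ∑' j, (x j)⁻¹ := tsum_nonneg fun j => (inv_pos.2 (hx j)).le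
  have h := tendsto_integralGammaInf (f := limitIntegrand α τ₀ x t v)
    (fun n => measurable_walkIntegrand n x t v) (half_pos hv)
    (C := (∑' j, (x j)⁻¹) * C) (fun n z hz => ?_) (fun z hz => ?_)
  · refine ⟨h.1, (tendsto_add_atTop_iff_nat 2).1 ?_⟩
    simp_rw [walkCorrelation_eq_integralGammaInf _ hx ht hv]
    exact h.2.const_mul _
  · refine (norm_walkIntegrand_le hx hs n ht.le v hz).trans ?_
    rw [mul_assoc]
    exact mul_le_mul_of_nonneg_left (hC z hz) hS
  · have hτ : ((τ₀ ^ α : ℝ) : ℂ) ≠ 0 := by exact_mod_cast (Real.rpow_pos_of_pos hτ₀ α).ne'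
    rw [limitIntegrand, mul_div_mul_left _ _ hτ]
    exact tendsto_walkIntegrand hx hs ht.le v hz

end

/-- The correlation function of the walk on infinitely many sites, defined as the limit of those of
the walks on the first `N` sites. The limit exists when the rates are positive with a summable series
of inverses. -/
noncomputable def limitCorrelation (x : ℕ → ℝ) (t v : ℝ) : ℝ :=
  limUnder atTop fun N => walkCorrelation N x t v

section
variable {x : ℕ → ℝ} (hx : ∀ j, 0 < x j) (hs : Summable fun j => (x j)⁻¹)
include hx hs

theorem tendsto_limitCorrelation {t v : ℝ} (ht : 0 < t) (hv : 0 < v) :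
    Tendsto (fun N => walkCorrelation N x t v) atTop (𝓝 (limitCorrelation x t v)) := by
  have h := (tendsto_walkCorrelation hx hs (α := 0) one_pos ht hv).2
  exact tendsto_nhds_limUnder ⟨_, (Complex.continuous_re.tendsto _).comp h⟩

theorem isNested_limitCorrelation : IsNested (limitCorrelation x) where
  aestronglyMeasurable t ht := by
    refine aestronglyMeasurable_of_tendsto_ae atTop
      (fun n => aestronglyMeasurable_walkCorrelation (n := n) hx ht.le) ?_
    filter_upwards [ae_restrict_mem measurableSet_Ioi] with v hv
    exact (tendsto_add_atTop_iff_nat 2).2 (tendsto_limitCorrelation hx hs ht hv)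
  nonneg t v ht hv := ge_of_tendsto' (tendsto_limitCorrelation hx hs ht hv) fun _ =>
    walkCorrelation_nonneg _ _ _ _
  le_one t v ht hv := le_of_tendsto' (tendsto_limitCorrelation hx hs ht hv) fun _ =>
    walkCorrelation_le_one _ _ _ _
  mono t v t' v' ht' hv h1 h2 := le_of_tendsto_of_tendsto'
    (tendsto_limitCorrelation hx hs (by linarith) hv)
    (tendsto_limitCorrelation hx hs ht' (by linarith)) fun _ =>
    walkCorrelation_nested _ _ ht'.le h1 h2

/-- The Laplace transform of the limit, by dominated convergence from finitely many sites. -/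
theorem integral_exp_mul_limitCorrelation {s t : ℝ} (h0 : 0 < s) (ht : 0 < t) :
    ∫ v in Ioi (0 : ℝ), Real.exp (-s * v) * limitCorrelation x t v
      = (∑' j, Real.exp (-x j * t) / (x j + s)) / (s * ∑' j, 1 / (x j + s)) := by
  have hpos : ∀ j, 0 < x j + s := fun j => by linarith [hx j]
  have hle : ∀ j, 1 / (x j + s) ≤ (x j)⁻¹ := fun j => by
    rw [one_div]; exact inv_anti₀ (hx j) (by linarith)
  have hsum : Summable fun j => 1 / (x j + s) :=
    Summable.of_nonneg_of_le (fun j => (one_div_pos.2 (hpos j)).le) hle hs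
  have hD : 0 < ∑' j, 1 / (x j + s) :=
    hsum.tsum_pos (fun j => (one_div_pos.2 (hpos j)).le) 0 (one_div_pos.2 (hpos 0))
  have h1 : Tendsto (fun n => ∫ v in Ioi (0 : ℝ), Real.exp (-s * v) * walkCorrelation (n + 2) x t v)
      atTop (𝓝 (∫ v in Ioi (0 : ℝ), Real.exp (-s * v) * limitCorrelation x t v)) := by
    refine tendsto_integral_of_dominated_convergence (fun v => Real.exp (-s * v)) (fun n => ?_)
      (integrableOn_exp_mul_Ioi (by linarith) 0) (fun n => ae_of_all _ fun v => ?_) ?_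
    · exact (by fun_prop : Continuous fun v : ℝ => Real.exp (-s * v)).aestronglyMeasurable.mul
        (aestronglyMeasurable_walkCorrelation hx ht.le)
    · rw [Real.norm_eq_abs, abs_of_nonneg
        (mul_nonneg (Real.exp_pos _).le (walkCorrelation_nonneg _ _ _ _))]
      exact mul_le_of_le_one_right (Real.exp_pos _).le (walkCorrelation_le_one _ _ _ _)
    · filter_upwards [ae_restrict_mem measurableSet_Ioi] with v hv
      exact ((tendsto_add_atTop_iff_nat 2).2 (tendsto_limitCorrelation hx hs ht hv)).const_mul _
  refine tendsto_nhds_unique h1 ?_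
  simp_rw [integral_exp_mul_walkCorrelation hx h0 ht.le]
  have e1 : ∀ n : ℕ, ∑ j : Fin (n + 2), 1 / (x j + s) = ∑ j ∈ Finset.range (n + 2), 1 / (x j + s) :=
    fun n => Fin.sum_univ_eq_sum_range (fun j => 1 / (x j + s)) _
  have e2 : ∀ n : ℕ, ∑ j : Fin (n + 2), Real.exp (-exitRate n x j * t) / (x j + s)
      = ∑ j ∈ Finset.range (n + 2), Real.exp (-exitRate n x j * t) / (x j + s) :=
    fun n => Fin.sum_univ_eq_sum_range (fun j => Real.exp (-exitRate n x j * t) / (x j + s)) _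
  simp_rw [e1, e2]
  refine Tendsto.div ?_ (Tendsto.const_mul _ ?_) (mul_pos h0 hD).ne'
  · refine tendsto_sum_range_of_dominated hs (fun n j => ?_) fun j => ?_
    · rw [Real.norm_eq_abs, abs_of_nonneg (div_nonneg (Real.exp_pos _).le (hpos j).le)]
      exact (div_le_div_of_nonneg_right (exp_neg_exitRate_le_one n (hx j) ht.le) (hpos j).le).trans
        (hle j)
    · exact ((Real.continuous_exp.tendsto _).comp
        ((tendsto_exitRate x j).neg.mul_const t)).div_const _
  · exact (tendsto_add_atTop_iff_nat 2).2 hsum.hasSum.tendsto_sum_nat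

end

/-! ### The Laplace transform of the ageing function -/

theorem integrableOn_exp_mul_rpow {s p : ℝ} (hs : 0 < s) (hp : -1 < p) :
    IntegrableOn (fun w : ℝ => Real.exp (-s * w) * w ^ p) (Ioi 0) := by
  have h := integrableOn_rpow_mul_exp_neg_mul_rpow hp one_pos hs
  refine h.congr_fun (fun w _ => ?_) measurableSet_Ioi
  simp only [Real.rpow_one]
  ring

theorem integral_exp_mul_rpow {s a : ℝ} (hs : 0 < s) (ha : 0 < a) :
    ∫ w in Ioi (0 : ℝ), Real.exp (-s * w) * w ^ (a - 1) = s ^ (-a) * Real.Gamma a := by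
  rw [Real.rpow_neg hs.le, ← Real.inv_rpow hs.le, ← one_div,
    ← Real.integral_rpow_mul_exp_neg_mul_Ioi ha hs]
  congr 1
  ext w
  rw [neg_mul, mul_comm]

theorem integrableOn_exp_mul_add_rpow {s t α : ℝ} (hs : 0 < s) (ht : 0 ≤ t) (hα₀ : 0 ≤ α)
    (hα₁ : α < 1) :
    IntegrableOn (fun w : ℝ => Real.exp (-s * w) * (t + w) ^ (-α)) (Ioi 0) := by
  refine Integrable.mono' (integrableOn_exp_mul_rpow hs (p := -α) (by linarith)) ?_ ?_
  · exact Measurable.aestronglyMeasurable (by fun_prop)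
  · filter_upwards [ae_restrict_mem measurableSet_Ioi] with w hw
    have hw : 0 < w := hw
    rw [Real.norm_eq_abs, abs_of_nonneg (by positivity)]
    exact mul_le_mul_of_nonneg_left
      (Real.rpow_le_rpow_of_nonpos hw (by linarith) (by linarith)) (Real.exp_pos _).le

/-- The ageing function as a convolution, by the substitution `p = 1 - u / (t + v)`. -/
theorem ageingFunction_div_eq {α t v : ℝ} (ht : 0 < t) (hv : 0 < v) :
    ageingFunction α (t / v) = Real.sin (Real.pi * α) / Real.pi *
      ∫ u in (0 : ℝ)..v, u ^ (α - 1) * (t + (v - u)) ^ (-α) := by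
  have hT : 0 < t + v := by linarith
  unfold ageingFunction
  congr 1
  have h := intervalIntegral.integral_comp_sub_div (a := 0) (b := v)
    (fun p : ℝ => p ^ (-α) * (1 - p) ^ (α - 1)) hT.ne' 1
  have e1 : 1 - v / (t + v) = t / v / (1 + t / v) := by field_simp; ring
  rw [zero_div, sub_zero, e1, smul_eq_mul] at h
  have h2 : ∀ u ∈ uIcc 0 v, (1 - u / (t + v)) ^ (-α) * (1 - (1 - u / (t + v))) ^ (α - 1)
      = (t + v) * (u ^ (α - 1) * (t + (v - u)) ^ (-α)) := by
    intro u hu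
    rw [uIcc_of_le hv.le] at hu
    have e2 : 1 - u / (t + v) = (t + (v - u)) / (t + v) := by field_simp; ring
    rw [sub_sub_cancel, e2, Real.div_rpow (by linarith [hu.2]) hT.le, Real.div_rpow hu.1 hT.le]
    have e3 : (t + v) ^ (-α) * (t + v) ^ (α - 1) = (t + v)⁻¹ := by
      rw [← Real.rpow_add hT, ← Real.rpow_neg_one]; ring_nf
    have e4 := (Real.rpow_pos_of_pos hT (-α)).ne'
    have e5 := (Real.rpow_pos_of_pos hT (α - 1)).ne'
    rw [div_mul_div_comm, e3, div_inv_eq_mul]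
    ring
  rw [intervalIntegral.integral_congr h2, intervalIntegral.integral_const_mul] at h
  exact (mul_left_cancel₀ hT.ne' h).symm

theorem exp_mul_ageingFunction_eq {α s t v : ℝ} (ht : 0 < t) (hv : 0 < v) :
    Real.exp (-s * v) * ageingFunction α (t / v) = Real.sin (Real.pi * α) / Real.pi *
      ∫ u in (0 : ℝ)..v, (Real.exp (-s * u) * u ^ (α - 1)) *
        (Real.exp (-s * (v - u)) * (t + (v - u)) ^ (-α)) := by
  rw [ageingFunction_div_eq ht hv, mul_left_comm, ← intervalIntegral.integral_const_mul]
  congr 1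
  refine intervalIntegral.integral_congr fun u _ => ?_
  have : Real.exp (-s * v) = Real.exp (-s * u) * Real.exp (-s * (v - u)) := by
    rw [← Real.exp_add]; ring_nf
  simp only [this]
  ring

section
variable {α : ℝ} (hα₀ : 0 < α) (hα₁ : α < 1)
include hα₀ hα₁

theorem integrableOn_exp_mul_ageingFunction {s t : ℝ} (hs : 0 < s) (ht : 0 < t) :
    IntegrableOn (fun v => Real.exp (-s * v) * ageingFunction α (t / v)) (Ioi 0) := by
  have h := integrable_posConvolution (integrableOn_exp_mul_rpow hs (p := α - 1) (by linarith))
    (integrableOn_exp_mul_add_rpow hs ht.le hα₀.le hα₁) (ContinuousLinearMap.mul ℝ ℝ)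
  have h2 := (h.const_mul (Real.sin (Real.pi * α) / Real.pi)).integrableOn (s := Ioi (0 : ℝ))
  refine h2.congr_fun (fun v hv => ?_) measurableSet_Ioi
  simp only [posConvolution]
  rw [indicator_of_mem hv, exp_mul_ageingFunction_eq ht hv]
  rfl

theorem integral_exp_mul_ageingFunction {s t : ℝ} (hs : 0 < s) (ht : 0 < t) :
    ∫ v in Ioi (0 : ℝ), Real.exp (-s * v) * ageingFunction α (t / v)
      = (∫ w in Ioi (0 : ℝ), Real.exp (-s * w) * (t + w) ^ (-α)) /
        (s * ∫ w in Ioi (0 : ℝ), Real.exp (-s * w) * w ^ (-α)) := by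
  have h := integral_posConvolution (integrableOn_exp_mul_rpow hs (p := α - 1) (by linarith))
    (integrableOn_exp_mul_add_rpow hs ht.le hα₀.le hα₁) (ContinuousLinearMap.mul ℝ ℝ)
  simp only [ContinuousLinearMap.mul_apply'] at h
  rw [setIntegral_congr_fun measurableSet_Ioi fun v hv =>
    exp_mul_ageingFunction_eq (s := s) ht hv, integral_const_mul, h,
    integral_exp_mul_rpow hs hα₀]
  have h1 := integral_exp_mul_rpow hs (a := 1 - α) (by linarith)
  rw [show 1 - α - 1 = -α by ring] at h1
  rw [h1]
  have g1 := Real.Gamma_pos_of_pos hα₀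
  have g2 := Real.Gamma_pos_of_pos (show 0 < 1 - α by linarith)
  have hsin : 0 < Real.sin (Real.pi * α) :=
    Real.sin_pos_of_pos_of_lt_pi (by have := Real.pi_pos; positivity)
      (by have := Real.pi_pos; nlinarith)
  have hG := Real.Gamma_mul_Gamma_one_sub α
  have hpow : s * s ^ (-(1 - α)) * s ^ (-α) = 1 := by
    rw [mul_assoc, ← Real.rpow_add hs, show -(1 - α) + -α = -1 by ring, Real.rpow_neg_one,
      mul_inv_cancel₀ hs.ne']
  have hp := Real.rpow_pos_of_pos hs (-(1 - α))
  have hpi := Real.pi_pos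
  rw [eq_div_iff hsin.ne'] at hG
  rw [eq_div_iff (by positivity)]
  generalize (∫ w in Ioi (0 : ℝ), Real.exp (-s * w) * (t + w) ^ (-α)) = A
  have : Real.sin (Real.pi * α) / Real.pi * (s ^ (-α) * Real.Gamma α * A) *
      (s * (s ^ (-(1 - α)) * Real.Gamma (1 - α)))
      = (s * s ^ (-(1 - α)) * s ^ (-α)) *
        (Real.Gamma α * Real.Gamma (1 - α) * Real.sin (Real.pi * α)) / Real.pi * A := by ring
  rw [this, hpow, hG]
  field_simp

theorem continuousAt_ageingFunction_div {t₀ v₀ : ℝ} (ht : 0 < t₀) (hv : 0 < v₀) :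
    ContinuousAt (fun p : ℝ × ℝ => ageingFunction α (p.1 / p.2)) (t₀, v₀) := by
  set θ₀ := t₀ / v₀ / (1 + t₀ / v₀) with hθ₀
  have hpos : 0 < t₀ / v₀ := by positivity
  have h0 : 0 < θ₀ := by positivity
  have h1 : θ₀ < 1 := by rw [hθ₀, div_lt_one (by positivity)]; linarith
  have hint : IntegrableOn (fun u : ℝ => u ^ (-α) * (1 - u) ^ (α - 1)) (uIcc (θ₀ / 2) 1) := by
    have a1 : IntervalIntegrable (fun u : ℝ => (1 - u) ^ (α - 1)) volume (θ₀ / 2) 1 := by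
      have := (intervalIntegral.intervalIntegrable_rpow' (a := 1 - θ₀ / 2) (b := 0)
        (r := α - 1) (by linarith)).comp_sub_left 1
      simpa using this
    have a2 : IntervalIntegrable (fun u : ℝ => u ^ (-α) * (1 - u) ^ (α - 1)) volume (θ₀ / 2) 1 := by
      refine a1.continuousOn_mul (ContinuousOn.rpow_const continuousOn_id fun u hu => Or.inl ?_)
      rw [uIcc_of_le (by linarith)] at hu
      exact (lt_of_lt_of_le (by linarith) hu.1).ne'
    rw [uIcc_of_le (by linarith)]
    exact (intervalIntegrable_iff_integrableOn_Icc_of_le (by linarith)).1 a2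
  have hc := intervalIntegral.continuousOn_primitive_interval_left hint
  have hc2 := hc.continuousAt (x := θ₀) (by
    rw [uIcc_of_le (by linarith)]; exact Icc_mem_nhds (by linarith) h1)
  have hθ : ContinuousAt (fun p : ℝ × ℝ => p.1 / p.2 / (1 + p.1 / p.2)) (t₀, v₀) := by
    have e : ContinuousAt (fun p : ℝ × ℝ => p.1 / p.2) (t₀, v₀) :=
      continuousAt_fst.div continuousAt_snd hv.ne'
    exact e.div (continuousAt_const.add e) (by positivity)
  exact (ContinuousAt.comp (f := fun p : ℝ × ℝ => p.1 / p.2 / (1 + p.1 / p.2)) hc2 hθ).const_mul _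

end

/-! ### Sequences whose counting function is asymptotic to a power -/

/-- The number of terms of the sequence `y` that are at most `r`, with the value `0` if there are
infinitely many. -/
noncomputable def pointCount (y : ℕ → ℝ) (r : ℝ) : ℕ := {j | y j ≤ r}.ncard

/-- The sequence `y` is positive and strictly increasing, and the number of its terms up to `r` is
asymptotic to `r ^ α`. -/
structure HasPowerCount (α : ℝ) (y : ℕ → ℝ) : Prop where
  pos : ∀ j, 0 < y j
  strictMono : StrictMono y
  tendsto : Tendsto (fun r => (pointCount y r : ℝ) / r ^ α) atTop (𝓝 1)

namespace HasPowerCount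
variable {α : ℝ} {y : ℕ → ℝ} (h : HasPowerCount α y)
include h

theorem finite (r : ℝ) : {j | y j ≤ r}.Finite := by
  obtain ⟨R, h1, h2⟩ := ((h.tendsto.eventually_const_lt (zero_lt_one)).and
    (eventually_ge_atTop r)).exists
  have : {j | y j ≤ R}.Finite := by
    -- an infinite set has `ncard` equal to `0`
    by_contra hinf
    rw [pointCount, Set.Infinite.ncard hinf] at h1
    simp at h1
  exact this.subset fun j hj => le_trans hj h2

theorem monotone_pointCount : Monotone (pointCount y) := fun _ _ hr =>
  Set.ncard_le_ncard (fun _ hj => le_trans hj hr) (h.finite _)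

theorem tsum_indicator_eq (r : ℝ) : ∑' j, (if y j ≤ r then (1 : ℝ) else 0) = pointCount y r := by
  rw [pointCount, Set.ncard_eq_toFinset_card _ (h.finite r),
    tsum_eq_sum (s := (h.finite r).toFinset) fun j hj => if_neg (by simpa using hj),
    Finset.sum_congr rfl fun j hj => if_pos (by simpa using hj)]
  simp

theorem exists_pointCount_le (hα : 0 < α) : ∃ C : ℝ, 0 < C ∧
    ∀ r, 0 < r → (pointCount y r : ℝ) ≤ C * r ^ α := by
  obtain ⟨R, hR⟩ := ((h.tendsto.eventually_lt_const (one_lt_two)).and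
    (eventually_gt_atTop 0)).exists_forall_of_atTop
  have hR0 : 0 < R := (hR R le_rfl).2
  have hy0 : 0 < y 0 ^ α := Real.rpow_pos_of_pos (h.pos 0) α
  refine ⟨2 + pointCount y R / y 0 ^ α, by positivity, fun r hr => ?_⟩
  have hrα : 0 < r ^ α := Real.rpow_pos_of_pos hr α
  rcases le_or_gt R r with h1 | h1
  · have h2 := (hR r h1).1
    rw [div_lt_iff₀ hrα] at h2
    refine h2.le.trans (mul_le_mul_of_nonneg_right ?_ hrα.le)
    have : 0 ≤ pointCount y R / y 0 ^ α := by positivity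
    linarith
  · rcases lt_or_ge r (y 0) with h2 | h2
    · have : {j | y j ≤ r} = ∅ := by
        ext j
        simp only [mem_ofPred_eq, mem_empty_iff_false, iff_false, not_le]
        exact h2.trans_le (h.strictMono.monotone (Nat.zero_le j))
      rw [pointCount, this]
      simp only [ncard_empty, Nat.cast_zero]
      positivity
    · have h3 : (pointCount y r : ℝ) ≤ pointCount y R := by
        exact_mod_cast h.monotone_pointCount h1.le
      have h4 : y 0 ^ α ≤ r ^ α := Real.rpow_le_rpow (h.pos 0).le h2 hα.le
      calc (pointCount y r : ℝ) ≤ pointCount y R / y 0 ^ α * y 0 ^ α := by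
            rwa [div_mul_cancel₀ _ hy0.ne']
        _ ≤ (2 + pointCount y R / y 0 ^ α) * r ^ α := by
            gcongr
            linarith

theorem summable_inv (hα₀ : 0 < α) (hα₁ : α < 1) : Summable fun j => (y j)⁻¹ := by
  obtain ⟨C, hC, hle⟩ := h.exists_pointCount_le hα₀
  have h1 : ∀ j : ℕ, (j + 1 : ℝ) ≤ C * y j ^ α := by
    intro j
    refine le_trans ?_ (hle _ (h.pos j))
    have : (Finset.range (j + 1) : Set ℕ).ncard ≤ pointCount y (y j) := by
      refine Set.ncard_le_ncard (fun i hi => ?_) (h.finite _)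
      exact h.strictMono.monotone (Nat.lt_succ_iff.1 (by simpa using hi))
    rw [Set.ncard_coe_finset, Finset.card_range] at this
    exact_mod_cast this
  have h2 : ∀ j : ℕ, (y j)⁻¹ ≤ C ^ (1 / α) * (((j + 1 : ℕ) : ℝ) ^ (1 / α))⁻¹ := by
    intro j
    have hj : (0 : ℝ) < j + 1 := by positivity
    have h3 := Real.rpow_le_rpow hj.le (h1 j) (by positivity : 0 ≤ 1 / α)
    rw [Real.mul_rpow hC.le (Real.rpow_pos_of_pos (h.pos j) α).le, ← Real.rpow_mul (h.pos j).le,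
      mul_one_div_cancel hα₀.ne', Real.rpow_one] at h3
    push_cast
    rw [← div_eq_mul_inv, inv_le_comm₀ (h.pos j) (by positivity), inv_div, div_le_iff₀ (by positivity)]
    linarith
  refine Summable.of_nonneg_of_le (fun j => (inv_pos.2 (h.pos j)).le) h2 (Summable.mul_left _ ?_)
  exact (summable_nat_add_iff 1).2 (Real.summable_nat_rpow_inv.2 (by rw [lt_div_iff₀ hα₀]; linarith))

theorem summable_exp (hα₀ : 0 < α) (hα₁ : α < 1) {u : ℝ} (hu : 0 < u) :
    Summable fun j => Real.exp (-y j * u) := by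
  refine Summable.of_nonneg_of_le (fun j => (Real.exp_pos _).le) (fun j => ?_)
    ((h.summable_inv hα₀ hα₁).mul_left u⁻¹)
  have h1 := mul_pos (h.pos j) hu
  rw [neg_mul, Real.exp_neg, ← mul_inv]
  refine inv_anti₀ (by rwa [mul_comm]) ?_
  have := Real.add_one_le_exp (y j * u)
  linarith

/-- Integration by parts against the counting function. -/
theorem tsum_exp_eq_integral (hα₀ : 0 < α) (hα₁ : α < 1) {u : ℝ} (hu : 0 < u) :
    ∑' j, Real.exp (-y j * u) = ∫ z in Ioi (0 : ℝ), Real.exp (-z) * pointCount y (z / u) := by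
  set F : ℕ → ℝ → ℝ := fun j => (Ici (y j * u)).indicator fun z => Real.exp (-z) with hF
  have hF0 : ∀ j z, 0 ≤ F j z := fun j z => indicator_nonneg (fun _ _ => (Real.exp_pos _).le) z
  have hFi : ∀ j, IntegrableOn (F j) (Ioi 0) := fun j =>
    integrableOn_exp_neg_Ioi_zero.indicator measurableSet_Ici
  have hFint : ∀ j, ∫ z in Ioi (0 : ℝ), F j z = Real.exp (-y j * u) := by
    intro j
    have h1 := mul_pos (h.pos j) hu
    have h2 : Ioi (0 : ℝ) ∩ Ici (y j * u) = Ici (y j * u) := by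
      ext a; simp only [mem_inter_iff, mem_Ici, mem_Ioi]
      exact ⟨fun h => h.2, fun h => ⟨h1.trans_le h, h⟩⟩
    rw [hF, setIntegral_indicator measurableSet_Ici, h2, integral_Ici_eq_integral_Ioi,
      integral_exp_neg_Ioi, neg_mul]
  have hsum := hasSum_integral_of_summable_integral_norm hFi (by
    simp_rw [Real.norm_eq_abs, abs_of_nonneg (hF0 _ _), hFint]
    exact h.summable_exp hα₀ hα₁ hu)
  simp_rw [hFint] at hsum
  rw [hsum.tsum_eq]
  congr 1
  ext z
  rw [← h.tsum_indicator_eq, ← tsum_mul_left]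
  refine tsum_congr fun j => ?_
  simp only [hF, indicator, mem_Ici, le_div_iff₀ hu, mul_ite, mul_one, mul_zero]

theorem exists_tsum_exp_le (hα₀ : 0 < α) (hα₁ : α < 1) :
    ∃ C : ℝ, ∀ u, 0 < u → ∑' j, Real.exp (-y j * u) ≤ C * u ^ (-α) := by
  obtain ⟨C, hC, hle⟩ := h.exists_pointCount_le hα₀
  have hG : IntegrableOn (fun z : ℝ => Real.exp (-z) * z ^ α) (Ioi 0) := by
    have := Real.GammaIntegral_convergent (s := α + 1) (by linarith)
    simpa using this
  refine ⟨C * ∫ z in Ioi (0 : ℝ), Real.exp (-z) * z ^ α, fun u hu => ?_⟩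
  rw [h.tsum_exp_eq_integral hα₀ hα₁ hu]
  have hbound : ∀ z ∈ Ioi (0 : ℝ), Real.exp (-z) * pointCount y (z / u)
      ≤ C * u ^ (-α) * (Real.exp (-z) * z ^ α) := by
    intro z hz
    have hz : 0 < z := hz
    have := hle (z / u) (by positivity)
    rw [Real.div_rpow hz.le hu.le] at this
    rw [Real.rpow_neg hu.le]
    calc Real.exp (-z) * pointCount y (z / u) ≤ Real.exp (-z) * (C * (z ^ α / u ^ α)) := by gcongr
      _ = _ := by rw [div_eq_mul_inv]; ring
  have hi := hG.const_mul (C * u ^ (-α))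
  calc ∫ z in Ioi (0 : ℝ), Real.exp (-z) * pointCount y (z / u)
      ≤ ∫ z in Ioi (0 : ℝ), C * u ^ (-α) * (Real.exp (-z) * z ^ α) := by
        refine integral_mono_of_nonneg (ae_of_all _ fun z => by positivity) hi ?_
        filter_upwards [ae_restrict_mem measurableSet_Ioi] with z hz using hbound z hz
    _ = _ := by rw [integral_const_mul]; ring

/-- An Abelian theorem for the sums `∑ e^{-y_j u}` as `u` tends to `0`. -/
theorem tendsto_tsum_exp (hα₀ : 0 < α) (hα₁ : α < 1) :
    Tendsto (fun u => u ^ α * ∑' j, Real.exp (-y j * u)) (𝓝[>] 0) (𝓝 (Real.Gamma (α + 1))) := by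
  obtain ⟨C, hC, hle⟩ := h.exists_pointCount_le hα₀
  have hG : IntegrableOn (fun z : ℝ => Real.exp (-z) * z ^ α) (Ioi 0) := by
    have := Real.GammaIntegral_convergent (s := α + 1) (by linarith)
    simpa using this
  have hGamma : Real.Gamma (α + 1) = ∫ z in Ioi (0 : ℝ), Real.exp (-z) * z ^ α := by
    rw [Real.Gamma_eq_integral (by linarith)]; simp
  have key : Tendsto (fun u : ℝ => ∫ z in Ioi (0 : ℝ),
      u ^ α * (Real.exp (-z) * pointCount y (z / u))) (𝓝[>] 0)
      (𝓝 (∫ z in Ioi (0 : ℝ), Real.exp (-z) * z ^ α)) := by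
    refine tendsto_integral_filter_of_dominated_convergence
      (fun z => C * (Real.exp (-z) * z ^ α)) ?_ ?_ (hG.const_mul C) ?_
    · filter_upwards [self_mem_nhdsWithin] with u hu
      have hm : Measurable fun r => (pointCount y r : ℝ) :=
        Monotone.measurable fun a b hab => by exact_mod_cast h.monotone_pointCount hab
      have hm2 : Measurable fun z => (pointCount y (z / u) : ℝ) :=
        hm.comp (measurable_id.div_const u)
      exact Measurable.aestronglyMeasurable (by fun_prop)
    · filter_upwards [self_mem_nhdsWithin] with u hu
      have hu : 0 < u := hu
      filter_upwards [ae_restrict_mem measurableSet_Ioi] with z hz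
      have hz : 0 < z := hz
      rw [Real.norm_eq_abs, abs_of_nonneg (by positivity)]
      have h1 := hle (z / u) (by positivity)
      have huα := Real.rpow_pos_of_pos hu α
      rw [Real.div_rpow hz.le hu.le, mul_div_assoc', le_div_iff₀ huα] at h1
      calc u ^ α * (Real.exp (-z) * pointCount y (z / u))
          = Real.exp (-z) * (pointCount y (z / u) * u ^ α) := by ring
        _ ≤ Real.exp (-z) * (C * z ^ α) := by gcongr
        _ = _ := by ring
    · filter_upwards [ae_restrict_mem measurableSet_Ioi] with z hz
      have hz : 0 < z := hz
      have h1 : Tendsto (fun u : ℝ => z / u) (𝓝[>] 0) atTop := by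
        simpa [div_eq_mul_inv] using tendsto_inv_nhdsGT_zero.const_mul_atTop hz
      have h2 := (h.tendsto.comp h1).const_mul (Real.exp (-z) * z ^ α)
      rw [mul_one] at h2
      refine h2.congr' ?_
      filter_upwards [self_mem_nhdsWithin] with u hu
      have hu : 0 < u := hu
      have hzα := Real.rpow_pos_of_pos hz α
      have huα := Real.rpow_pos_of_pos hu α
      simp only [Function.comp]
      rw [Real.div_rpow hz.le hu.le]
      field_simp
  rw [hGamma]
  refine key.congr' ?_
  filter_upwards [self_mem_nhdsWithin] with u hu
  rw [integral_const_mul, h.tsum_exp_eq_integral hα₀ hα₁ hu]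

/-- Here `e^{-x t} / (x + s)` is written as the Laplace transform of `w ↦ e^{-x (t + w)}`. -/
theorem tsum_exp_div_eq_integral (hα₀ : 0 < α) (hα₁ : α < 1) {τ s t : ℝ} (hτ : 0 < τ) (hs : 0 < s)
    (ht : 0 ≤ t) :
    ∑' j, Real.exp (-(τ * y j) * t) / (τ * y j + s)
      = ∫ w in Ioi (0 : ℝ), Real.exp (-s * w) * ∑' j, Real.exp (-y j * (τ * (t + w))) := by
  have hpos : ∀ j, 0 < τ * y j + s := fun j => add_pos (mul_pos hτ (h.pos j)) hs
  have e : ∀ j w, Real.exp (-s * w) * Real.exp (-y j * (τ * (t + w)))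
      = Real.exp (-(τ * y j) * t) * Real.exp (-(τ * y j + s) * w) := by
    intro j w
    rw [← Real.exp_add, ← Real.exp_add]; ring_nf
  have hi : ∀ j, IntegrableOn (fun w => Real.exp (-s * w) * Real.exp (-y j * (τ * (t + w))))
      (Ioi 0) := by
    intro j
    simp_rw [e]
    exact (integrableOn_exp_mul_Ioi (by linarith [hpos j]) 0).const_mul _
  have hint : ∀ j, ∫ w in Ioi (0 : ℝ), Real.exp (-s * w) * Real.exp (-y j * (τ * (t + w)))
      = Real.exp (-(τ * y j) * t) / (τ * y j + s) := by
    intro j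
    simp_rw [e]
    rw [integral_const_mul, integral_exp_mul_Ioi (by linarith [hpos j])]
    have := (hpos j).ne'
    rw [mul_zero, Real.exp_zero, neg_div_neg_eq, mul_one_div]
  have hsum := hasSum_integral_of_summable_integral_norm hi (by
    simp_rw [Real.norm_eq_abs, abs_of_pos (mul_pos (Real.exp_pos _) (Real.exp_pos _)), hint]
    refine Summable.of_nonneg_of_le (fun j => div_nonneg (Real.exp_pos _).le (hpos j).le)
      (fun j => ?_) ((h.summable_inv hα₀ hα₁).mul_left τ⁻¹)
    rw [← mul_inv, ← one_div]
    refine div_le_div₀ zero_le_one ?_ (mul_pos hτ (h.pos j)) (by linarith)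
    rw [Real.exp_le_one_iff]
    have := mul_pos hτ (h.pos j)
    nlinarith)
  simp_rw [hint] at hsum
  rw [hsum.tsum_eq]
  simp_rw [tsum_mul_left]

theorem tendsto_rpow_mul_tsum (hα₀ : 0 < α) (hα₁ : α < 1) {s t : ℝ} (hs : 0 < s) (ht : 0 ≤ t) :
    Tendsto (fun τ : ℝ => τ ^ α * ∑' j, Real.exp (-(τ * y j) * t) / (τ * y j + s)) (𝓝[>] 0)
      (𝓝 (Real.Gamma (α + 1) * ∫ w in Ioi (0 : ℝ), Real.exp (-s * w) * (t + w) ^ (-α))) := by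
  obtain ⟨C, hC⟩ := h.exists_tsum_exp_le hα₀ hα₁
  have hK0 : ∀ u, 0 ≤ ∑' j, Real.exp (-y j * u) := fun u => tsum_nonneg fun j => (Real.exp_pos _).le
  have key : Tendsto (fun τ : ℝ => ∫ w in Ioi (0 : ℝ),
      τ ^ α * (Real.exp (-s * w) * ∑' j, Real.exp (-y j * (τ * (t + w))))) (𝓝[>] 0)
      (𝓝 (∫ w in Ioi (0 : ℝ), Real.Gamma (α + 1) * (Real.exp (-s * w) * (t + w) ^ (-α)))) := by
    refine tendsto_integral_filter_of_dominated_convergence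
      (fun w => C * (Real.exp (-s * w) * (t + w) ^ (-α))) ?_ ?_
      ((integrableOn_exp_mul_add_rpow hs ht hα₀.le hα₁).const_mul C) ?_
    · refine Eventually.of_forall fun τ => Measurable.aestronglyMeasurable ?_
      have : Measurable fun w => ∑' j, Real.exp (-y j * (τ * (t + w))) :=
        Measurable.tsum fun j => by fun_prop
      fun_prop
    · filter_upwards [self_mem_nhdsWithin] with τ hτ
      have hτ : 0 < τ := hτ
      filter_upwards [ae_restrict_mem measurableSet_Ioi] with w hw
      have htw : 0 < t + w := add_pos_of_nonneg_of_pos ht hw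
      rw [Real.norm_eq_abs, abs_of_nonneg (mul_nonneg (by positivity)
        (mul_nonneg (Real.exp_pos _).le (hK0 _)))]
      have h1 := hC (τ * (t + w)) (by positivity)
      rw [Real.mul_rpow hτ.le htw.le, Real.rpow_neg hτ.le] at h1
      have hτα := Real.rpow_pos_of_pos hτ α
      calc _ ≤ τ ^ α * (Real.exp (-s * w) * (C * ((τ ^ α)⁻¹ * (t + w) ^ (-α)))) := by gcongr
        _ = _ := by field_simp
    · filter_upwards [ae_restrict_mem measurableSet_Ioi] with w hw
      have htw : 0 < t + w := add_pos_of_nonneg_of_pos ht hw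
      have h1 : Tendsto (fun τ : ℝ => τ * (t + w)) (𝓝[>] 0) (𝓝[>] 0) := by
        refine tendsto_nhdsWithin_iff.2 ⟨?_, ?_⟩
        · have : Tendsto (fun τ : ℝ => τ * (t + w)) (𝓝 0) (𝓝 (0 * (t + w))) :=
            tendsto_id.mul_const _
          rw [zero_mul] at this
          exact this.mono_left nhdsWithin_le_nhds
        · filter_upwards [self_mem_nhdsWithin] with τ hτ using mul_pos hτ htw
      have h2 := ((h.tendsto_tsum_exp hα₀ hα₁).comp h1).mul_const
        (Real.exp (-s * w) * (t + w) ^ (-α))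
      refine h2.congr' ?_
      filter_upwards [self_mem_nhdsWithin] with τ hτ
      have hτ : 0 < τ := hτ
      simp only [Function.comp]
      rw [Real.mul_rpow hτ.le htw.le, Real.rpow_neg htw.le]
      have := (Real.rpow_pos_of_pos htw α).ne'
      generalize ∑' j, Real.exp (-y j * (τ * (t + w))) = K
      field_simp
  rw [integral_const_mul] at key
  refine key.congr' ?_
  filter_upwards [self_mem_nhdsWithin] with τ hτ
  rw [integral_const_mul, h.tsum_exp_div_eq_integral hα₀ hα₁ hτ hs ht]

/-- In the limit of small time units the correlation function becomes the ageing function. -/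
theorem tendsto_limitCorrelation_smul (hα₀ : 0 < α) (hα₁ : α < 1) {t v : ℝ} (ht : 0 < t)
    (hv : 0 < v) :
    Tendsto (fun τ : ℝ => limitCorrelation (fun j => τ * y j) t v) (𝓝[>] 0)
      (𝓝 (ageingFunction α (t / v))) := by
  have hpos : ∀ τ : ℝ, 0 < τ → ∀ j, 0 < τ * y j := fun τ hτ j => mul_pos hτ (h.pos j)
  have hsum : ∀ τ : ℝ, Summable fun j => (τ * y j)⁻¹ := fun τ => by
    simp_rw [mul_inv]; exact (h.summable_inv hα₀ hα₁).mul_left _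
  refine tendsto_of_laplace_of_isNested
    (F := fun τ : ℝ => limitCorrelation (fun j => τ * y j))
    (H := fun t v => ageingFunction α (t / v)) ?_ (fun t ht => ?_) (fun t ht k => ?_) ht hv
    (continuousAt_ageingFunction_div hα₀ hα₁ ht hv)
  · filter_upwards [self_mem_nhdsWithin] with τ hτ
    exact isNested_limitCorrelation (hpos τ hτ) (hsum τ)
  · simpa using integrableOn_exp_mul_ageingFunction hα₀ hα₁ one_pos ht
  · have hs : (0 : ℝ) < k + 1 := by positivity
    rw [integral_exp_mul_ageingFunction hα₀ hα₁ hs ht]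
    have hΓ := Real.Gamma_pos_of_pos (show 0 < α + 1 by linarith)
    have hA : 0 < ∫ w in Ioi (0 : ℝ), Real.exp (-(k + 1) * w) * w ^ (-α) := by
      have := integral_exp_mul_rpow hs (a := 1 - α) (by linarith)
      rw [show 1 - α - 1 = -α by ring] at this
      rw [this]
      exact mul_pos (Real.rpow_pos_of_pos hs _) (Real.Gamma_pos_of_pos (by linarith))
    have h1 := h.tendsto_rpow_mul_tsum hα₀ hα₁ hs ht.le
    have h2 := h.tendsto_rpow_mul_tsum hα₀ hα₁ hs le_rfl
    simp only [mul_zero, Real.exp_zero, zero_add] at h2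
    have h3 := h1.div (h2.const_mul (k + 1 : ℝ)) (by positivity)
    rw [mul_left_comm, mul_div_mul_left _ _ hΓ.ne'] at h3
    refine h3.congr' ?_
    filter_upwards [self_mem_nhdsWithin] with τ hτ
    rw [Pi.div_apply, integral_exp_mul_limitCorrelation (hpos τ hτ) (hsum τ) hs ht, mul_left_comm,
      mul_div_mul_left _ _ (Real.rpow_pos_of_pos hτ α).ne']

end HasPowerCount

/-! ### The counting function of the energy landscape -/

/-- The variance of the Poisson law. -/
theorem hasSum_poisson_sq_sub (r : ℝ) :
    HasSum (fun n : ℕ => Real.exp (-r) * r ^ n / (n.factorial : ℝ) * ((n : ℝ) - r) ^ 2) r := by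
  set p : ℕ → ℝ := fun n => Real.exp (-r) * r ^ n / (n.factorial : ℝ) with hp
  have h0 : HasSum p 1 := by
    have h1 := (NormedSpace.expSeries_div_hasSum_exp r).mul_left (Real.exp (-r))
    rw [← Real.exp_eq_exp_ℝ, ← Real.exp_add, neg_add_cancel, Real.exp_zero] at h1
    refine h1.congr_fun ?_
    intro n
    simp only [hp]; ring
  have hstep : ∀ n : ℕ, ((n + 1 : ℕ) : ℝ) * p (n + 1) = r * p n := by
    intro n
    simp only [hp, Nat.factorial_succ]
    push_cast
    have : (n.factorial : ℝ) ≠ 0 := by positivity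
    field_simp
    ring
  have h1 : HasSum (fun n : ℕ => (n : ℝ) * p n) r := by
    have h := h0.mul_left r
    simp_rw [← hstep, mul_one] at h
    simpa using (hasSum_nat_add_iff (f := fun n : ℕ => (n : ℝ) * p n) 1).1 h
  have h2 : HasSum (fun n : ℕ => (n : ℝ) * (n - 1) * p n) (r * r) := by
    have h : HasSum (fun n : ℕ => ((n + 1 : ℕ) : ℝ) * (((n + 1 : ℕ) : ℝ) - 1) * p (n + 1)) (r * r) := by
      refine (h1.mul_left r).congr_fun ?_
      intro n
      rw [mul_right_comm, hstep]
      push_cast; ring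
    simpa using (hasSum_nat_add_iff (f := fun n : ℕ => (n : ℝ) * (n - 1) * p n) 1).1 h
  have h3 := ((h2.add h1).sub (h1.mul_left (2 * r))).add (h0.mul_left (r ^ 2))
  have e : r * r + r - 2 * r * r + r ^ 2 * 1 = r := by ring
  rw [e] at h3
  refine h3.congr_fun ?_
  intro n
  ring

theorem landscapeIntensity_Ici {α : ℝ} (hα : 0 < α) {r : ℝ} (hr : 0 < r) :
    landscapeIntensity α (Ici (-Real.log r)) = ENNReal.ofReal (r ^ α) := by
  rw [landscapeIntensity, withDensity_apply _ measurableSet_Ici,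
    Measure.restrict_congr_set Ioi_ae_eq_Ici.symm]
  have : ∀ e : ℝ, ENNReal.ofReal (α * Real.exp (-α * e))
      = ENNReal.ofReal α * ENNReal.ofReal (Real.exp (-α * e)) := fun e =>
    ENNReal.ofReal_mul hα.le
  simp_rw [this]
  rw [lintegral_const_mul _ (by fun_prop), lintegral_exp_neg_mul_Ioi hα, ← ENNReal.ofReal_mul hα.le,
    mul_div_cancel₀ _ hα.ne', Real.rpow_def_of_pos hr]
  ring_nf

theorem toReal_sum_dirac_Ici (e : ℕ → ℝ) {r : ℝ} (hr : 0 < r) :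
    (Measure.sum (fun j => Measure.dirac (e j)) (Ici (-Real.log r))).toReal
      = pointCount (fun j => Real.exp (-e j)) r := by
  have hset : {j | Real.exp (-e j) ≤ r} = {j | -Real.log r ≤ e j} := by
    ext j
    simp only [mem_ofPred_eq]
    rw [← Real.le_log_iff_exp_le hr, neg_le]
  rw [Measure.sum_apply _ measurableSet_Ici, pointCount, hset, Set.ncard_def]
  have : ∀ j, Measure.dirac (e j) (Ici (-Real.log r))
      = {j | -Real.log r ≤ e j}.indicator (fun _ => (1 : ENNReal)) j := by
    intro j
    rw [Measure.dirac_apply' _ measurableSet_Ici]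
    rfl
  simp_rw [this]
  rw [← tsum_subtype, ENNReal.tsum_set_one]
  cases hc : {j | -Real.log r ≤ e j}.encard with
  | top => simp
  | coe m => simp

section
variable {Ω : Type*} [MeasurableSpace Ω] {P : Measure Ω} {α : ℝ}
  {energy : ℕ → Ω → ℝ}

/-- The count of the points up to `r` is a Poisson variable of parameter `r ^ α`, whose variance
is `r ^ α` too. -/
theorem lintegral_sq_pointCount_sub (hα : 0 < α) (hE : IsEnergyLandscape P α energy) {r : ℝ}
    (hr : 0 < r) :
    AEMeasurable (fun ω => (pointCount (fun j => Real.exp (-energy j ω)) r : ℝ)) P ∧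
    ∫⁻ ω, ENNReal.ofReal (((pointCount (fun j => Real.exp (-energy j ω)) r : ℝ) - r ^ α) ^ 2) ∂P
      = ENNReal.ofReal (r ^ α) := by
  have hrα := Real.rpow_pos_of_pos hr α
  have hlaw := hE.poisson.hasLaw (Ici (-Real.log r)) measurableSet_Ici
    (by rw [landscapeIntensity_Ici hα hr]; exact ENNReal.ofReal_ne_top)
  rw [landscapeIntensity_Ici hα hr] at hlaw
  have hf : Measurable fun a : ENNReal => ENNReal.ofReal ((a.toReal - r ^ α) ^ 2) := by fun_prop
  refine ⟨?_, ?_⟩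
  · refine hlaw.aemeasurable.ennreal_toReal.congr (ae_of_all _ fun ω => ?_)
    exact toReal_sum_dirac_Ici (fun j => energy j ω) hr
  · simp_rw [← toReal_sum_dirac_Ici (fun j => energy j _) hr]
    rw [← lintegral_map' (f := fun a : ENNReal => ENNReal.ofReal ((a.toReal - r ^ α) ^ 2))
      hf.aemeasurable hlaw.aemeasurable, hlaw.map_eq, lintegral_map hf (by fun_prop),
      lintegral_countable']
    have h := hasSum_poisson_sq_sub (r ^ α)
    refine Eq.trans (tsum_congr fun n => ?_)
      ((ENNReal.ofReal_tsum_of_nonneg (fun n => by positivity) h.summable).symm.trans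
        (congrArg ENNReal.ofReal h.tsum_eq))
    rw [poissonMeasure_singleton, ← ENNReal.ofReal_mul (by positivity), mul_comm]
    simp only [ENNReal.toReal_natCast, ENNReal.coe_toNNReal_eq_toReal, ENNReal.toReal_ofReal hrα.le]

/-- The law of large numbers along the levels `(m + 1) ^ (2 / α)`, where the mean count is
`(m + 1) ^ 2`: the second moments of the relative errors are summable. -/
theorem ae_tendsto_pointCount_levels (hα : 0 < α) (hE : IsEnergyLandscape P α energy) :
    ∀ᵐ ω ∂P, Tendsto (fun m : ℕ => (pointCount (fun j => Real.exp (-energy j ω))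
      ((m + 1 : ℝ) ^ (2 / α)) : ℝ) / (m + 1 : ℝ) ^ 2) atTop (𝓝 1) := by
  have hpos : ∀ m : ℕ, (0 : ℝ) < (m + 1 : ℝ) ^ (2 / α) := fun m => by positivity
  have hlam : ∀ m : ℕ, ((m + 1 : ℝ) ^ (2 / α)) ^ α = (m + 1 : ℝ) ^ 2 := by
    intro m
    rw [← Real.rpow_mul (by positivity), div_mul_cancel₀ _ hα.ne', Real.rpow_ofNat]
  set X : ℕ → Ω → ℝ := fun m ω => (pointCount (fun j => Real.exp (-energy j ω))
      ((m + 1 : ℝ) ^ (2 / α)) : ℝ) / (m + 1 : ℝ) ^ 2 - 1 with hX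
  have hXm : ∀ m, AEMeasurable (fun ω => ENNReal.ofReal (X m ω ^ 2)) P := fun m =>
    ((((lintegral_sq_pointCount_sub hα hE (hpos m)).1.div_const _).sub_const _).pow_const
      2).ennreal_ofReal
  have hint : ∀ m, ∫⁻ ω, ENNReal.ofReal (X m ω ^ 2) ∂P
      = ENNReal.ofReal (((m + 1 : ℕ) : ℝ) ^ 2)⁻¹ := by
    intro m
    have h := (lintegral_sq_pointCount_sub hα hE (hpos m)).2
    rw [hlam] at h
    have hm : (0 : ℝ) < (m + 1 : ℝ) ^ 2 := by positivity
    have e : ∀ ω, ENNReal.ofReal (X m ω ^ 2) = ENNReal.ofReal (((m + 1 : ℝ) ^ 2)⁻¹ ^ 2) *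
        ENNReal.ofReal (((pointCount (fun j => Real.exp (-energy j ω))
          ((m + 1 : ℝ) ^ (2 / α)) : ℝ) - (m + 1 : ℝ) ^ 2) ^ 2) := by
      intro ω
      rw [← ENNReal.ofReal_mul (by positivity)]
      congr 1
      simp only [hX]
      field_simp
    simp_rw [e]
    rw [lintegral_const_mul' _ _ ENNReal.ofReal_ne_top, h, ← ENNReal.ofReal_mul (by positivity)]
    congr 1
    push_cast
    field_simp
  have hfin : ∫⁻ ω, ∑' m, ENNReal.ofReal (X m ω ^ 2) ∂P ≠ ⊤ := by
    rw [lintegral_tsum hXm]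
    simp_rw [hint]
    rw [← ENNReal.ofReal_tsum_of_nonneg (fun m => by positivity)]
    · exact ENNReal.ofReal_ne_top
    · exact (summable_nat_add_iff 1).2 (Real.summable_nat_pow_inv.2 one_lt_two)
  filter_upwards [ae_lt_top' (AEMeasurable.tsum hXm) hfin] with ω hω
  have h1 := ENNReal.tendsto_atTop_zero_of_tsum_ne_top hω.ne
  have h2 := (ENNReal.tendsto_toReal ENNReal.zero_ne_top).comp h1
  simp only [Function.comp_def, ENNReal.toReal_ofReal (sq_nonneg _), ENNReal.toReal_zero] at h2
  have h3 : Tendsto (fun m => X m ω) atTop (𝓝 0) := by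
    have := h2.sqrt
    simp only [Real.sqrt_sq_eq_abs, Real.sqrt_zero] at this
    exact tendsto_zero_iff_abs_tendsto_zero _ |>.2 this
  simpa [hX] using h3.add_const 1

end

/-- Monotone interpolation between the levels, whose mean counts have ratios tending to `1`. -/
theorem tendsto_pointCount_of_levels {α : ℝ} (hα : 0 < α) {y : ℕ → ℝ}
    (h : Tendsto (fun m : ℕ => (pointCount y ((m + 1 : ℝ) ^ (2 / α)) : ℝ) / (m + 1 : ℝ) ^ 2)
      atTop (𝓝 1)) :
    Tendsto (fun r => (pointCount y r : ℝ) / r ^ α) atTop (𝓝 1) := by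
  have h' : Tendsto (fun m : ℕ => (pointCount y ((m : ℝ) ^ (2 / α)) : ℝ) / (m : ℝ) ^ 2)
      atTop (𝓝 1) := by
    rw [← tendsto_add_atTop_iff_nat 1]
    simpa using h
  have hlev : Tendsto (fun m : ℕ => (m : ℝ) ^ (2 / α)) atTop atTop :=
    (tendsto_rpow_atTop (by positivity)).comp tendsto_natCast_atTop_atTop
  have hfin : ∀ r, {j | y j ≤ r}.Finite := by
    intro r
    obtain ⟨m, h1, h2⟩ := ((h'.eventually_const_lt zero_lt_one).and
      (hlev.eventually_ge_atTop r)).exists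
    have : {j | y j ≤ (m : ℝ) ^ (2 / α)}.Finite := by
      by_contra hinf
      rw [pointCount, Set.Infinite.ncard hinf] at h1
      simp at h1
    exact this.subset fun j hj => le_trans hj h2
  have hmono : Monotone (pointCount y) := fun _ _ hr =>
    Set.ncard_le_ncard (fun _ hj => le_trans hj hr) (hfin _)
  have hratio : Tendsto (fun m : ℕ => ((m : ℝ) / (m + 1)) ^ 2) atTop (𝓝 1) := by
    simpa using (tendsto_natCast_div_add_atTop (𝕜 := ℝ) 1).pow 2
  have hlow : Tendsto (fun m : ℕ => (pointCount y ((m : ℝ) ^ (2 / α)) : ℝ) / (m + 1 : ℝ) ^ 2)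
      atTop (𝓝 1) := by
    have := h'.mul hratio
    rw [mul_one] at this
    refine this.congr' ?_
    filter_upwards [eventually_gt_atTop 0] with m hm
    have hm' : (m : ℝ) ≠ 0 := by positivity
    field_simp
  have hupp : Tendsto (fun m : ℕ => (pointCount y ((m + 1 : ℝ) ^ (2 / α)) : ℝ) / (m : ℝ) ^ 2)
      atTop (𝓝 1) := by
    have := h.div hratio one_ne_zero
    rw [div_one] at this
    refine this.congr' ?_
    filter_upwards [eventually_gt_atTop 0] with m hm
    have hm' : (m : ℝ) ≠ 0 := by positivity
    simp only [Pi.div_apply]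
    field_simp
  have hfloor : Tendsto (fun r : ℝ => ⌊r ^ (α / 2)⌋₊) atTop atTop :=
    tendsto_nat_floor_atTop.comp (tendsto_rpow_atTop (by positivity))
  have hpow : ∀ r : ℝ, 0 < r → (r ^ (α / 2)) ^ (2 / α) = r := by
    intro r hr
    rw [← Real.rpow_mul hr.le, show α / 2 * (2 / α) = 1 by field_simp, Real.rpow_one]
  have hsq : ∀ r : ℝ, 0 < r → (r ^ (α / 2)) ^ 2 = r ^ α := by
    intro r hr
    rw [← Real.rpow_mul_natCast hr.le]
    congr 1
    push_cast
    ring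
  refine tendsto_of_tendsto_of_tendsto_of_le_of_le' (hlow.comp hfloor) (hupp.comp hfloor) ?_ ?_
  · filter_upwards [eventually_gt_atTop 0] with r hr
    have a1 : (⌊r ^ (α / 2)⌋₊ : ℝ) ≤ r ^ (α / 2) := Nat.floor_le (by positivity)
    have a2 : r ^ (α / 2) < ⌊r ^ (α / 2)⌋₊ + 1 := Nat.lt_floor_add_one _
    have b1 : (⌊r ^ (α / 2)⌋₊ : ℝ) ^ (2 / α) ≤ r := by
      conv_rhs => rw [← hpow r hr]
      exact Real.rpow_le_rpow (by positivity) a1 (by positivity)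
    refine div_le_div₀ (by positivity) (by exact_mod_cast hmono b1) (by positivity) ?_
    rw [← hsq r hr]
    exact pow_le_pow_left₀ (by positivity) a2.le 2
  · filter_upwards [eventually_gt_atTop 0, hfloor.eventually_gt_atTop 0] with r hr hr2
    have a1 : (⌊r ^ (α / 2)⌋₊ : ℝ) ≤ r ^ (α / 2) := Nat.floor_le (by positivity)
    have a2 : r ^ (α / 2) < ⌊r ^ (α / 2)⌋₊ + 1 := Nat.lt_floor_add_one _
    have b1 : r ≤ (⌊r ^ (α / 2)⌋₊ + 1 : ℝ) ^ (2 / α) := by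
      conv_lhs => rw [← hpow r hr]
      exact Real.rpow_le_rpow (by positivity) a2.le (by positivity)
    have hr3 : (0 : ℝ) < ⌊r ^ (α / 2)⌋₊ := by exact_mod_cast hr2
    refine div_le_div₀ (by positivity) (by exact_mod_cast hmono b1) (by positivity) ?_
    rw [← hsq r hr]
    exact pow_le_pow_left₀ hr3.le a1 2

/-- Almost surely the rates `e^{-E_j}` have a counting function asymptotic to `r ^ α`. -/
theorem ae_hasPowerCount {Ω : Type*} [MeasurableSpace Ω] {P : Measure Ω} [IsProbabilityMeasure P]
    {α : ℝ} (hα : 0 < α) {energy : ℕ → Ω → ℝ} (hE : IsEnergyLandscape P α energy) :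
    ∀ᵐ ω ∂P, HasPowerCount α (fun j => Real.exp (-energy j ω)) := by
  filter_upwards [ae_tendsto_pointCount_levels hα hE, hE.decreasing] with ω h1 h2
  exact ⟨fun j => Real.exp_pos _,
    fun i j hij => Real.exp_lt_exp.2 (neg_lt_neg (h2 hij)), tendsto_pointCount_of_levels hα h1⟩

theorem numSites_eq_pointCount (e : ℕ → ℝ) (E : ℝ) :
    numSites e E = pointCount (fun j => Real.exp (-e j)) (Real.exp (-E)) := by
  rw [numSites, pointCount]
  congr 1
  ext j
  simp

theorem HasPowerCount.tendsto_pointCount_atTop {α : ℝ} {y : ℕ → ℝ} (h : HasPowerCount α y)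
    (hα : 0 < α) : Tendsto (pointCount y) atTop atTop := by
  have h1 : Tendsto (fun r : ℝ => (pointCount y r : ℝ) / r ^ α * r ^ α) atTop atTop :=
    h.tendsto.pos_mul_atTop one_pos (tendsto_rpow_atTop hα)
  refine tendsto_natCast_atTop_iff.1 (h1.congr' ?_)
  filter_upwards [eventually_gt_atTop 0] with r hr
  rw [div_mul_cancel₀ _ (Real.rpow_pos_of_pos hr α).ne']

theorem proposition4p6 {Ω : Type*} [MeasurableSpace Ω] (P : Measure Ω) [IsProbabilityMeasure P]
    (α : ℝ) (hα₀ : 0 < α) (hα₁ : α < 1) (energy : ℕ → Ω → ℝ)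
    (hE : IsEnergyLandscape P α energy) :
    ∀ᵐ ω ∂P, ∀ t tw : ℝ, 0 < t → 0 < tw →
      -- the limit for every fixed time unit, the series and the integral being well defined
      (∀ τ₀ : ℝ, 0 < τ₀ →
        (∀ z ∈ gammaInf,
          Summable (fun j => 1 / ((trapRate (energy · ω) τ₀ j : ℂ) - z)) ∧
          Summable (fun j => Complex.exp (-(trapRate (energy · ω) τ₀ j) * t) /
            ((trapRate (energy · ω) τ₀ j : ℂ) - z)) ∧
          ∑' j, 1 / ((trapRate (energy · ω) τ₀ j : ℂ) - z) ≠ 0) ∧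
        IntegrableOnGammaInf (limitIntegrand α τ₀ (trapRate (energy · ω) τ₀) t tw) ∧
        Tendsto (fun E : ℝ => ((trapCorrelation (energy · ω) τ₀ E t tw : ℝ) : ℂ)) atBot
          (𝓝 (1 / (2 * Real.pi * Complex.I) *
            integralGammaInf (limitIntegrand α τ₀ (trapRate (energy · ω) τ₀) t tw)))) ∧
      -- the iterated limit
      ∃ G : ℝ → ℝ,
        (∀ τ₀ : ℝ, 0 < τ₀ →
          Tendsto (fun E : ℝ => trapCorrelation (energy · ω) τ₀ E t tw) atBot (𝓝 (G τ₀))) ∧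
        Tendsto G (𝓝[>] 0) (𝓝 (ageingFunction α (t / tw))) := by
  filter_upwards [ae_hasPowerCount hα₀ hE] with ω hω t tw ht htw
  have hN : Tendsto (numSites (energy · ω)) atBot atTop := by
    have h1 : Tendsto (fun E : ℝ => Real.exp (-E)) atBot atTop :=
      Real.tendsto_exp_atTop.comp tendsto_neg_atBot_atTop
    refine ((hω.tendsto_pointCount_atTop hα₀).comp h1).congr fun E => ?_
    exact (numSites_eq_pointCount _ E).symm
  have hx : ∀ τ₀ : ℝ, 0 < τ₀ → ∀ j, 0 < trapRate (energy · ω) τ₀ j := fun τ₀ hτ j =>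
    mul_pos hτ (Real.exp_pos _)
  have hs : ∀ τ₀ : ℝ, Summable fun j => (trapRate (energy · ω) τ₀ j)⁻¹ := fun τ₀ => by
    simp only [trapRate, mul_inv]
    exact (hω.summable_inv hα₀ hα₁).mul_left _
  refine ⟨fun τ₀ hτ => ⟨fun z hz => ⟨summable_inv_sub (hx τ₀ hτ) (hs τ₀) hz,
    summable_exp_div_sub (hx τ₀ hτ) (hs τ₀) hz ht.le,
    tsum_inv_sub_ne_zero (hx τ₀ hτ) (hs τ₀) hz⟩, ?_⟩,
    fun τ₀ => limitCorrelation (trapRate (energy · ω) τ₀) t tw, fun τ₀ hτ => ?_, ?_⟩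
  · obtain ⟨h1, h2⟩ := tendsto_walkCorrelation (hx τ₀ hτ) (hs τ₀) (α := α) hτ ht htw
    exact ⟨h1, h2.comp hN⟩
  · exact (tendsto_limitCorrelation (hx τ₀ hτ) (hs τ₀) ht htw).comp hN
  · exact hω.tendsto_limitCorrelation_smul hα₀ hα₁ ht htw
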